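/- **Setting.** Relation names, attribute names and data values are finite strings in which the three separator symbols "\#", "," and "=" do not occur; a tuple over a finite set of attributes assigns to each attribute a data value or $\mathtt{NULL}$. A schema $\mathbf R$ is a finite set of relation names $R$ with nonempty finite attribute sets $att(R)$; an instance $I$ assigns to each $R\in\mathbf R$ a finite set $R^I$ of tuples over $att(R)$. A key $R[A_1,\dots,A_n]$ ($n\ge 1$, distinct attributes of $R$) holds in $I$ if no tuple of $R^I$ has $\mathtt{NULL}$ in some $A_i$ and no two distinct tuples of $R^I$ agree on all $A_i$. A foreign key $R[A_1,\dots,A_n]\subseteq_{FK} S[B_1,\dots,B_n]$ (distinct attributes on each side) holds if the key $S[B_1,\dots,B_n]$ holds and every tuple of $R^I$ either has $\mathtt{NULL}$ in some $A_i$ or agrees, $A_i$ with $B_i$ for all $i$, with a tuple of $S^I$. $\Sigma$ denotes a set of keys and foreign keys over $\mathbf R$ with at most one key per relation name (the primary key). RDF graphs are finite sets of triples over IRIs, blank nodes and literals (data values are literals). **The mapping.** Fix a base IRI $b$ outside the reserved vocabulary (no string beginning with $b$ is a reserved RDF/RDFS/OWL name), an identifier string for each tuple (depending only on the relation name and the tuple,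 distinct tuples of a relation having distinct identifiers), and an IRI $a$. Call $R$ a *binary relation* between $S$ and $T$ (via $A,B,C,D$) if $att(R)=\{A,B\}$, $R[A,B]$ is the primary key, $R[A]\subseteq_{FK}S[C]$ and $R[B]\subseteq_{FK}T[D]$ are in $\Sigma$ with $S,T\ne R$, neither $A$ nor $B$ is the attribute of two distinct one-attribute foreign keys of $R$, there is no foreign key of $R$ on $(A,B)$ or $(B,A)$, and no foreign key with one or two attributes points to $R$. All other relation names are *classes*. The IRIs are the concatenations $bR$ for a class $R$; $bR\#A$ for an attribute $A$ of a class $R$; $bR\#A,B,C,D$ for a binary relation; $bS,T\#X_1,\dots,X_n,Y_1,\dots,Y_n$ for a foreign key $S[X_1,\dots,X_n]\subseteq_{FK}T[Y_1,\dots,Y_n]$ with $S$ a class. A tuple of a class $R$ is identified by the IRI $bR\#A_1=V_1,\dots,A_n=V_n$ given by its (non-null) values in the primary key if $R$ has one, and otherwise by the blank node labelled by $R$ followed by the identifier of the tuple. $\mathcal{DM}(\mathbf R,\Sigma,I)$ consists of: the `rdf:type` declarations of these names as `owl:Class`, `owl:DatatypeProperty`, `owl:ObjectProperty`; the `rdfs:domain`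 triples of the data type properties; the `rdfs:domain` and `rdfs:range` triples of the object properties (those of binary relations and those of foreign keys), where the domain or range relation is a class; for each tuple of a class its `rdf:type` triple and a literal triple for each of its non-null attribute values; and the reference triples, which for each foreign key of a class link a tuple to a tuple that it references, and for each tuple of a binary relation link the two tuples that it references. $\mathcal{DM}_{pk}$ adds the triple $(a,\texttt{owl:differentFrom},a)$ whenever two distinct tuples of a relation agree on its primary key or a tuple has $\mathtt{NULL}$ in a primary key attribute. **Proposition.** For every choice of $b$, tuple identifiers and $a$, the mapping $\mathcal M=\mathcal{DM}_{pk}$ is 1. *information preserving*: there is a computable mapping $\mathcal N$ from RDF graphs to relational instances with $\mathcal N(\mathcal M(\mathbf R,\Sigma,I))=I$ for all $\mathbf R$, $\Sigma$ and all instances $I$ of $\mathbf R$ with $I\models\Sigma$ (an instance comes with its schema); 2. *query preserving*: for every nonempty schema $\mathbf R$, every $\Sigma$ and every relational algebra query $Q$ over $\mathbf R$ (base relations, $\mathtt{NULL}_A$, the selections $A=a$, $A\neq a$, IsNull, IsNotNull, projection, renaming, natural join on non-null values, union, difference) there is a SPARQL query $Q^\star$ (a non-parametric graph pattern with AND, OPT,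 UNION, MINUS, FILTER and nested SELECT/AS, where filters are Boolean combinations of $\mathrm{bound}(?X)$, $?X=c$ and $?X=?Y$ with $c$ an IRI or a literal) such that for every instance $I$ of $\mathbf R$ with $I\models\Sigma$, the answers of $Q^\star$ over $\mathcal M(\mathbf R,\Sigma,I)$ are exactly the mappings $tr(t)$, $t$ an answer of $Q$ over $I$, where $tr(t)$ maps $?A$ to the value of $t$ in $A$ if that is not $\mathtt{NULL}$ and is undefined on $?A$ otherwise; 3. *monotone*: $I_1\subseteq I_2$ implies $\mathcal M(\mathbf R,\Sigma,I_1)\subseteq\mathcal M(\mathbf R,\Sigma,I_2)$, for all $\mathbf R$, $\Sigma$ and all instances $I_1,I_2$ of $\mathbf R$; 4. *semantics preserving for primary keys*: for every $\mathbf R$, every $\Sigma$ that contains only primary keys, and every instance $I$ of $\mathbf R$: $I\models\Sigma$ if and only if $\mathcal M(\mathbf R,\Sigma,I)$ is consistent under OWL semantics (has a model under the OWL 2 direct semantics, without datatypes). -/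

import Mathlib

namespace RDBToRDF

/-! ### Strings -/

/-- Names and data values are strings of ordinary characters; a character is given by its code
point. -/
abbrev Word : Type := List ℕ

/-- The symbols used in generated IRIs: ordinary characters, and the three separators, which are
not ordinary characters. -/
inductive Sym : Type
  | hash
  | comma
  | equals
  | ch (n : ℕ)
  deriving DecidableEq

abbrev Str : Type := List Sym

/-- A word read as a string. -/
def Word.str (x : Word) : Str := x.map Sym.ch

abbrev RelName : Type := Word
abbrev Attr : Type := Word

/-- The countably infinite domain of data values. -/
abbrev Value : Type := Word

/-! ### Relational databases -/

/-- A tuple is a function from attributes to data values or `NULL`, which is written `none`. A tuple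
over a finite set `U` of attributes is represented by its extension by `NULL` outside `U`. -/
abbrev Tuple : Type := Attr → Option Value

/-- A tuple over the attributes in `U`. -/
def Tuple.Over (t : Tuple) (U : Finset Attr) : Prop := ∀ A, A ∉ U → t A = none

structure Schema : Type where
  rels : Finset RelName
  att : RelName → Finset Attr
  att_nonempty : ∀ R ∈ rels, (att R).Nonempty
  att_eq_empty : ∀ R, R ∉ rels → att R = ∅

structure Instance (S : Schema) : Type where
  rel : RelName → Set Tuple
  finite : ∀ R, (rel R).Finite
  isOver : ∀ R, ∀ t ∈ rel R, Tuple.Over t (S.att R)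
  rel_eq_empty : ∀ R, R ∉ S.rels → rel R = ∅

/-- Containment of instances. -/
def Instance.Sub {S : Schema} (I J : Instance S) : Prop := ∀ R ∈ S.rels, I.rel R ⊆ J.rel R

/-- The set of all relational instances, over all schemas. -/
abbrev DBInstance : Type := Σ S : Schema, Instance S

/-! ### Relational algebra -/

inductive RA : Type
  | rel (R : RelName)
  | null (A : Attr)
  | selEq (A : Attr) (a : Value) (Q : RA)
  | selNe (A : Attr) (a : Value) (Q : RA)
  | selNull (A : Attr) (Q : RA)
  | selNotNull (A : Attr) (Q : RA)
  | proj (U : Finset Attr) (Q : RA)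
  | rename (A B : Attr) (Q : RA)
  | join (Q₁ Q₂ : RA)
  | union (Q₁ Q₂ : RA)
  | diff (Q₁ Q₂ : RA)

/-- The attributes of an expression. -/
def RA.att (S : Schema) : RA → Finset Attr
  | .rel R => S.att R
  | .null A => {A}
  | .selEq _ _ Q => Q.att S
  | .selNe _ _ Q => Q.att S
  | .selNull _ Q => Q.att S
  | .selNotNull _ Q => Q.att S
  | .proj U _ => U
  | .rename A B Q => insert B ((Q.att S).erase A)
  | .join Q₁ Q₂ => Q₁.att S ∪ Q₂.att S
  | .union Q₁ _ => Q₁.att S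
  | .diff Q₁ _ => Q₁.att S

/-- `Q` is a relational algebra expression over the schema `S`. -/
def RA.WF (S : Schema) : RA → Prop
  | .rel R => R ∈ S.rels
  | .null _ => True
  | .selEq A _ Q => A ∈ Q.att S ∧ Q.WF S
  | .selNe A _ Q => A ∈ Q.att S ∧ Q.WF S
  | .selNull A Q => A ∈ Q.att S ∧ Q.WF S
  | .selNotNull A Q => A ∈ Q.att S ∧ Q.WF S
  | .proj U Q => U ⊆ Q.att S ∧ Q.WF S
  | .rename A B Q => A ∈ Q.att S ∧ B ∉ Q.att S ∧ Q.WF S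
  | .join Q₁ Q₂ => Q₁.WF S ∧ Q₂.WF S
  | .union Q₁ Q₂ => Q₁.att S = Q₂.att S ∧ Q₁.WF S ∧ Q₂.WF S
  | .diff Q₁ Q₂ => Q₁.att S = Q₂.att S ∧ Q₁.WF S ∧ Q₂.WF S

/-- The evaluation of an expression over an instance. -/
def RA.eval {S : Schema} (I : Instance S) : RA → Set Tuple
  | .rel R => I.rel R
  | .null _ => {t | ∀ A, t A = none}
  | .selEq A a Q => {t | t ∈ Q.eval I ∧ t A = some a}
  | .selNe A a Q => {t | t ∈ Q.eval I ∧ t A ≠ none ∧ t A ≠ some a}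
  | .selNull A Q => {t | t ∈ Q.eval I ∧ t A = none}
  | .selNotNull A Q => {t | t ∈ Q.eval I ∧ t A ≠ none}
  | .proj U Q => {t | Tuple.Over t U ∧ ∃ t' ∈ Q.eval I, ∀ A ∈ U, t A = t' A}
  | .rename A B Q => {t | Tuple.Over t ((RA.rename A B Q).att S) ∧
      ∃ t' ∈ Q.eval I, t B = t' A ∧
        ∀ D ∈ (RA.rename A B Q).att S, D ≠ B → t D = t' D}
  | .join Q₁ Q₂ => {t | Tuple.Over t ((RA.join Q₁ Q₂).att S) ∧
      ∃ t₁ ∈ Q₁.eval I, ∃ t₂ ∈ Q₂.eval I,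
        (∀ A ∈ Q₁.att S ∩ Q₂.att S, t A = t₁ A ∧ t₁ A = t₂ A ∧ t A ≠ none) ∧
        (∀ A ∈ Q₁.att S \ Q₂.att S, t A = t₁ A) ∧
        (∀ A ∈ Q₂.att S \ Q₁.att S, t A = t₂ A)}
  | .union Q₁ Q₂ => Q₁.eval I ∪ Q₂.eval I
  | .diff Q₁ Q₂ => Q₁.eval I \ Q₂.eval I

/-! ### Keys and foreign keys -/

/-- `key R As` is the key `R[As]`; `fk R As T Bs` is the foreign key `R[As] ⊆ T[Bs]`. -/
inductive Constraint : Type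
  | key (R : RelName) (As : List Attr)
  | fk (R : RelName) (As : List Attr) (T : RelName) (Bs : List Attr)

/-- A nonempty list of distinct attributes of the relation name `R` of `S`. -/
def Schema.IsAttList (S : Schema) (R : RelName) (As : List Attr) : Prop :=
  R ∈ S.rels ∧ As ≠ [] ∧ As.Nodup ∧ ∀ A ∈ As, A ∈ S.att R

/-- The constraint is a key or a foreign key over `S`. -/
def Constraint.WF (S : Schema) : Constraint → Prop
  | .key R As => S.IsAttList R As
  | .fk R As T Bs => S.IsAttList R As ∧ S.IsAttList T Bs ∧ As.length = Bs.length

/-- A set of primary keys and foreign keys over `S`. -/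
structure Constraints (S : Schema) : Type where
  carrier : Finset Constraint
  wf : ∀ c ∈ carrier, c.WF S
  key_unique : ∀ R As Bs, Constraint.key R As ∈ carrier → Constraint.key R Bs ∈ carrier → As = Bs

/-- There are only primary keys in the set. -/
def Constraints.OnlyKeys {S : Schema} (C : Constraints S) : Prop :=
  ∀ c ∈ C.carrier, ∃ R As, c = Constraint.key R As

def Instance.SatKey {S : Schema} (I : Instance S) (R : RelName) (As : List Attr) : Prop :=
  (∀ t ∈ I.rel R, ∀ A ∈ As, t A ≠ none) ∧
    ∀ t₁ ∈ I.rel R, ∀ t₂ ∈ I.rel R, (∀ A ∈ As, t₁ A = t₂ A) → t₁ = t₂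

def Instance.SatC {S : Schema} (I : Instance S) : Constraint → Prop
  | .key R As => I.SatKey R As
  | .fk R As T Bs => I.SatKey T Bs ∧
      ∀ t ∈ I.rel R, (∃ A ∈ As, t A = none) ∨
        ∃ s ∈ I.rel T, List.Forall₂ (fun A B => t A = s B) As Bs

def Instance.Sat {S : Schema} (I : Instance S) (C : Constraints S) : Prop :=
  ∀ c ∈ C.carrier, I.SatC c

/-! ### RDF graphs -/

/-- The reserved vocabulary of RDF, RDFS and OWL 2 (datatypes excluded). -/
inductive Vocab : Type
  | rdfType | rdfFirst | rdfRest | rdfNil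
  | rdfsSubClassOf | rdfsSubPropertyOf | rdfsDomain | rdfsRange
  | rdfsLiteral | rdfsDatatype | rdfsLabel | rdfsComment | rdfsSeeAlso | rdfsIsDefinedBy
  | owlOntology | owlImports | owlVersionInfo
  | owlClass | owlObjectProperty | owlDatatypeProperty | owlAnnotationProperty
  | owlNamedIndividual | owlRestriction
  | owlThing | owlNothing
  | owlTopObjectProperty | owlBottomObjectProperty | owlTopDataProperty | owlBottomDataProperty
  | owlEquivalentClass | owlDisjointWith | owlDisjointUnionOf
  | owlIntersectionOf | owlUnionOf | owlComplementOf | owlOneOf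
  | owlOnProperty | owlSomeValuesFrom | owlAllValuesFrom | owlHasValue | owlHasSelf
  | owlMinCardinality | owlMaxCardinality | owlCardinality
  | owlMinQualifiedCardinality | owlMaxQualifiedCardinality | owlQualifiedCardinality
  | owlOnClass | owlOnDataRange
  | owlEquivalentProperty | owlPropertyDisjointWith | owlInverseOf | owlPropertyChainAxiom
  | owlFunctionalProperty | owlInverseFunctionalProperty | owlReflexiveProperty
  | owlIrreflexiveProperty | owlSymmetricProperty | owlAsymmetricProperty | owlTransitiveProperty
  | owlHasKey | owlSameAs | owlDifferentFrom
  | owlAllDifferent | owlAllDisjointClasses | owlAllDisjointProperties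
  | owlMembers | owlDistinctMembers
  | owlNegativePropertyAssertion | owlSourceIndividual | owlAssertionProperty
  | owlTargetIndividual | owlTargetValue
  deriving DecidableEq

/-- An IRI is a reserved name or any other IRI, given by its string. -/
inductive IRI : Type
  | voc (v : Vocab)
  | str (x : Str)
  deriving DecidableEq

/-- IRIs and blank nodes (a blank node `_:x` is given by its label `x`). -/
inductive Node : Type
  | iri (i : IRI)
  | blank (label : Str)
  deriving DecidableEq

/-- Literals are the data values. -/
abbrev Literal : Type := Value

/-- IRIs, blank nodes and literals. -/
inductive Term : Type
  | node (n : Node)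
  | lit (w : Literal)
  deriving DecidableEq

structure Triple : Type where
  subj : Node
  pred : IRI
  obj : Term
  deriving DecidableEq

/-- RDF graphs are finite sets of RDF triples. -/
abbrev RDFGraph : Type := Finset Triple

/-- The reserved name `v` as a node. -/
def Vocab.node (v : Vocab) : Node := .iri (.voc v)

/-- The reserved name `v` as a term. -/
def Vocab.term (v : Vocab) : Term := .node v.node

/-! ### SPARQL -/

/-- The variable `?x` is given by `x`; in particular `?A` is the variable of the attribute `A`. -/
abbrev Var : Type := Word

/-- Mappings: partial functions from variables to terms. -/
abbrev Mapping : Type := Var → Option Term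

inductive PatTerm : Type
  | iri (i : IRI)
  | lit (w : Literal)
  | var (x : Var)

inductive PatPred : Type
  | iri (i : IRI)
  | var (x : Var)

/-- Constants in built-in conditions. -/
inductive PatConst : Type
  | iri (i : IRI)
  | lit (w : Literal)

def PatConst.term : PatConst → Term
  | .iri i => .node (.iri i)
  | .lit w => .lit w

inductive Cond : Type
  | bound (x : Var)
  | eqConst (x : Var) (c : PatConst)
  | eqVar (x y : Var)
  | not (r : Cond)
  | or (r₁ r₂ : Cond)
  | and (r₁ r₂ : Cond)

/-- Graph patterns; `select ren keep P` is `SELECT {?A₁ AS ?B₁, …, ?Aₘ AS ?Bₘ, ?C₁, …, ?Cₙ} P` with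
`ren` the list of the pairs `(Aᵢ, Bᵢ)` and `keep` the list of the `Cⱼ`. -/
inductive Pattern : Type
  | empty
  | triple (s : PatTerm) (p : PatPred) (o : PatTerm)
  | and (P₁ P₂ : Pattern)
  | opt (P₁ P₂ : Pattern)
  | union (P₁ P₂ : Pattern)
  | minus (P₁ P₂ : Pattern)
  | filter (P : Pattern) (r : Cond)
  | select (ren : List (Var × Var)) (keep : List Var) (P : Pattern)

def PatTerm.vars : PatTerm → Finset Var
  | .iri _ => ∅
  | .lit _ => ∅
  | .var x => {x}

def PatPred.vars : PatPred → Finset Var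
  | .iri _ => ∅
  | .var x => {x}

def Cond.vars : Cond → Finset Var
  | .bound x => {x}
  | .eqConst x _ => {x}
  | .eqVar x y => {x, y}
  | .not r => r.vars
  | .or r₁ r₂ => r₁.vars ∪ r₂.vars
  | .and r₁ r₂ => r₁.vars ∪ r₂.vars

/-- The variables `?Aᵢ`, `?Cⱼ` of a `SELECT` clause. -/
def selectSrc (ren : List (Var × Var)) (keep : List Var) : Finset Var :=
  (ren.map Prod.fst ++ keep).toFinset

/-- The variables `?Aᵢ`, `?Bᵢ`, `?Cⱼ` of a `SELECT` clause. -/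
def selectVars (ren : List (Var × Var)) (keep : List Var) : Finset Var :=
  (ren.map Prod.fst ++ ren.map Prod.snd ++ keep).toFinset

/-- The variables occurring in a pattern. -/
def Pattern.vars : Pattern → Finset Var
  | .empty => ∅
  | .triple s p o => s.vars ∪ p.vars ∪ o.vars
  | .and P₁ P₂ => P₁.vars ∪ P₂.vars
  | .opt P₁ P₂ => P₁.vars ∪ P₂.vars
  | .union P₁ P₂ => P₁.vars ∪ P₂.vars
  | .minus P₁ P₂ => P₁.vars ∪ P₂.vars
  | .filter P r => P.vars ∪ r.vars
  | .select ren keep P => selectVars ren keep ∪ P.vars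

/-- The side condition on `SELECT` holds in every subpattern. -/
def Pattern.WF : Pattern → Prop
  | .empty => True
  | .triple _ _ _ => True
  | .and P₁ P₂ => P₁.WF ∧ P₂.WF
  | .opt P₁ P₂ => P₁.WF ∧ P₂.WF
  | .union P₁ P₂ => P₁.WF ∧ P₂.WF
  | .minus P₁ P₂ => P₁.WF ∧ P₂.WF
  | .filter P _ => P.WF
  | .select ren keep P =>
      (ren.map Prod.fst ++ ren.map Prod.snd ++ keep).Nodup ∧
        (∀ x ∈ ren.map Prod.snd, x ∉ P.vars) ∧ P.WF

/-- The non-parametricity condition for an occurrence of a subpattern of a larger pattern, where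
`out` is the set of the variables that occur in the larger pattern outside that subpattern: no
variable hidden by a `SELECT` occurs outside the `SELECT` subpattern. -/
def Pattern.NonParamIn : Pattern → Finset Var → Prop
  | .empty, _ => True
  | .triple _ _ _, _ => True
  | .and P₁ P₂, out => P₁.NonParamIn (out ∪ P₂.vars) ∧ P₂.NonParamIn (out ∪ P₁.vars)
  | .opt P₁ P₂, out => P₁.NonParamIn (out ∪ P₂.vars) ∧ P₂.NonParamIn (out ∪ P₁.vars)
  | .union P₁ P₂, out => P₁.NonParamIn (out ∪ P₂.vars) ∧ P₂.NonParamIn (out ∪ P₁.vars)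
  | .minus P₁ P₂, out => P₁.NonParamIn (out ∪ P₂.vars) ∧ P₂.NonParamIn (out ∪ P₁.vars)
  | .filter P r, out => P.NonParamIn (out ∪ r.vars)
  | .select ren keep P, out =>
      (∀ x ∈ P.vars \ selectSrc ren keep, x ∉ out) ∧ P.NonParamIn (out ∪ selectVars ren keep)

def Pattern.NonParametric (P : Pattern) : Prop := P.NonParamIn ∅

/-- A SPARQL query of the considered fragment. -/
def Pattern.IsQuery (P : Pattern) : Prop := P.WF ∧ P.NonParametric

def Mapping.dom (μ : Mapping) : Set Var := {x | μ x ≠ none}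

def Mapping.Compatible (μ₁ μ₂ : Mapping) : Prop :=
  ∀ x, x ∈ μ₁.dom → x ∈ μ₂.dom → μ₁ x = μ₂ x

/-- The union of two (compatible) mappings. -/
def Mapping.union (μ₁ μ₂ : Mapping) : Mapping := fun x => (μ₁ x).or (μ₂ x)

/-- Replacement of variables. -/
def PatTerm.inst (μ : Mapping) : PatTerm → Option Term
  | .iri i => some (.node (.iri i))
  | .lit w => some (.lit w)
  | .var x => μ x

def PatPred.inst (μ : Mapping) : PatPred → Option Term
  | .iri i => some (.node (.iri i))
  | .var x => μ x

/-- `μ` satisfies a built-in condition. -/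
def Mapping.Sat (μ : Mapping) : Cond → Prop
  | .bound x => x ∈ μ.dom
  | .eqConst x c => μ x = some c.term
  | .eqVar x y => x ∈ μ.dom ∧ y ∈ μ.dom ∧ μ x = μ y
  | .not r => ¬ μ.Sat r
  | .or r₁ r₂ => μ.Sat r₁ ∨ μ.Sat r₂
  | .and r₁ r₂ => μ.Sat r₁ ∧ μ.Sat r₂

/-- Restriction to the selected variables followed by the renaming of each `?Aᵢ` to `?Bᵢ`. -/
def Mapping.select (ren : List (Var × Var)) (keep : List Var) (μ : Mapping) : Mapping := fun x =>
  match ren.find? (fun ab => ab.2 = x) with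
  | some ab => μ ab.1
  | none => if x ∈ keep then μ x else none

/-- The evaluation of a graph pattern over an RDF graph. -/
def Pattern.eval (G : RDFGraph) : Pattern → Set Mapping
  | .empty => {μ | G.Nonempty ∧ μ.dom = ∅}
  | .triple s p o => {μ | μ.dom = ((Pattern.triple s p o).vars : Set Var) ∧
      ∃ t ∈ G, s.inst μ = some (.node t.subj) ∧ p.inst μ = some (.node (.iri t.pred)) ∧
        o.inst μ = some t.obj}
  | .and P₁ P₂ => {μ | ∃ μ₁ ∈ P₁.eval G, ∃ μ₂ ∈ P₂.eval G,
      μ₁.Compatible μ₂ ∧ μ = μ₁.union μ₂}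
  | .opt P₁ P₂ => {μ | ∃ μ₁ ∈ P₁.eval G, ∃ μ₂ ∈ P₂.eval G,
      μ₁.Compatible μ₂ ∧ μ = μ₁.union μ₂} ∪
      {μ | μ ∈ P₁.eval G ∧ ∀ μ' ∈ P₂.eval G, ¬ μ.Compatible μ'}
  | .union P₁ P₂ => P₁.eval G ∪ P₂.eval G
  | .minus P₁ P₂ => {μ | μ ∈ P₁.eval G ∧
      ∀ μ' ∈ P₂.eval G, ¬ μ.Compatible μ' ∨ μ.dom ∩ μ'.dom = ∅}
  | .filter P r => {μ | μ ∈ P.eval G ∧ μ.Sat r}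
  | .select ren keep P => Mapping.select ren keep '' P.eval G

/-- The translation of tuples into mappings: the attributes with value `NULL` are unbound. -/
def tr (t : Tuple) : Mapping := fun A => (t A).map Term.lit

/-! ### OWL consistency

The model-theoretic (direct) semantics of OWL 2, without datatypes. It is stated on RDF graphs: every
node has an interpretation as an individual, as a class and as a property, and the triples that
stand for an axiom or for a complex class or property expression impose the condition that the
semantics attaches to that axiom or expression. -/

/-- The RDF list at a node. -/
inductive RDFList (G : RDFGraph) : Node → List Term → Prop
  | nil : RDFList G Vocab.rdfNil.node []
  | cons (x r : Node) (y : Term) (ys : List Term) :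
      ⟨x, .voc .rdfFirst, y⟩ ∈ G → ⟨x, .voc .rdfRest, .node r⟩ ∈ G → RDFList G r ys →
      RDFList G x (y :: ys)

/-- An OWL interpretation: a nonempty object domain, a data domain in which distinct literals are
distinct values, and interpretations of individuals, classes, object properties, data properties and
data ranges. -/
structure Interp : Type 1 where
  Obj : Type
  nonempty : Nonempty Obj
  Dat : Type
  lit : Literal → Dat
  lit_injective : Function.Injective lit
  ind : Node → Obj
  cls : Node → Set Obj
  op : Node → Obj → Obj → Prop
  dp : Node → Obj → Dat → Prop
  rng : Node → Set Dat

/-- `p` is a data property in the graph. -/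
def IsDataProp (G : RDFGraph) (p : Node) : Prop :=
  ⟨p, .voc .rdfType, Vocab.owlDatatypeProperty.term⟩ ∈ G ∨
    p = Vocab.owlTopDataProperty.node ∨ p = Vocab.owlBottomDataProperty.node

/-- `p` is read as an object property: it is declared so, or it is not a data property. -/
def IsObjProp (G : RDFGraph) (p : Node) : Prop :=
  ⟨p, .voc .rdfType, Vocab.owlObjectProperty.term⟩ ∈ G ∨ ¬ IsDataProp G p

/-- A node that may denote a class in an assertion: not reserved, or a built-in class. -/
def IsClassNode : Node → Prop
  | .iri (.voc v) => v = .owlThing ∨ v = .owlNothing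
  | _ => True

/-- A predicate of property assertions: not reserved, or a built-in property, and no annotation
property. -/
def IsAssertionPred (G : RDFGraph) (p : IRI) : Prop :=
  (match p with
    | .voc v => v = .owlTopObjectProperty ∨ v = .owlBottomObjectProperty ∨
        v = .owlTopDataProperty ∨ v = .owlBottomDataProperty
    | .str _ => True) ∧
  ⟨.iri p, .voc .rdfType, Vocab.owlAnnotationProperty.term⟩ ∉ G

inductive CardKind : Type
  | min
  | max
  | exact

def CardKind.unqualified : CardKind → Vocab
  | .min => .owlMinCardinality
  | .max => .owlMaxCardinality
  | .exact => .owlCardinality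

def CardKind.qualified : CardKind → Vocab
  | .min => .owlMinQualifiedCardinality
  | .max => .owlMaxQualifiedCardinality
  | .exact => .owlQualifiedCardinality

/-- The set `X` has at least, at most, exactly `n` elements. -/
def CardKind.Holds {α : Type} (n : ℕ) (X : Set α) : CardKind → Prop
  | .min => (n : ℕ∞) ≤ X.encard
  | .max => X.encard ≤ n
  | .exact => X.encard = n

/-- The decimal numeral of `n`. -/
def numeral (n : ℕ) : Literal := (Nat.toDigits 10 n).map Char.toNat

/-- The literal `true`, spelled by code points. -/
def litTrue : Literal := [116, 114, 117, 101]

/-- The relation denoted by a chain of object properties. -/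
def Interp.Chain (M : Interp) : List Term → M.Obj → M.Obj → Prop
  | [], u, v => u = v
  | .node p :: ps, u, v => ∃ w, M.op p u w ∧ M.Chain ps w v
  | .lit _ :: _, _, _ => False

/-- An element denoted by an IRI. -/
def Interp.Named (M : Interp) (u : M.Obj) : Prop := ∃ i : IRI, u = M.ind (.iri i)

/-- The interpretation `M` is a model of the graph `G`. -/
structure Interp.Models (M : Interp) (G : RDFGraph) : Prop where
  -- built-in names
  thing : M.cls Vocab.owlThing.node = Set.univ
  nothing : M.cls Vocab.owlNothing.node = ∅
  topOp : ∀ u v, M.op Vocab.owlTopObjectProperty.node u v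
  bottomOp : ∀ u v, ¬ M.op Vocab.owlBottomObjectProperty.node u v
  topDp : ∀ u v, M.dp Vocab.owlTopDataProperty.node u v
  bottomDp : ∀ u v, ¬ M.dp Vocab.owlBottomDataProperty.node u v
  literal : M.rng Vocab.rdfsLiteral.node = Set.univ
  -- assertions
  classAssertion : ∀ x c, ⟨x, .voc .rdfType, .node c⟩ ∈ G → IsClassNode c → M.ind x ∈ M.cls c
  opAssertion : ∀ x p y, ⟨x, p, .node y⟩ ∈ G → IsAssertionPred G p → IsObjProp G (.iri p) →
    M.op (.iri p) (M.ind x) (M.ind y)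
  dpAssertion : ∀ x p w, ⟨x, p, .lit w⟩ ∈ G → IsAssertionPred G p →
    M.dp (.iri p) (M.ind x) (M.lit w)
  negOpAssertion : ∀ n x p y, ⟨n, .voc .owlSourceIndividual, .node x⟩ ∈ G →
    ⟨n, .voc .owlAssertionProperty, .node p⟩ ∈ G → ⟨n, .voc .owlTargetIndividual, .node y⟩ ∈ G →
    ¬ M.op p (M.ind x) (M.ind y)
  negDpAssertion : ∀ n x p w, ⟨n, .voc .owlSourceIndividual, .node x⟩ ∈ G →
    ⟨n, .voc .owlAssertionProperty, .node p⟩ ∈ G → ⟨n, .voc .owlTargetValue, .lit w⟩ ∈ G →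
    ¬ M.dp p (M.ind x) (M.lit w)
  sameAs : ∀ x y, ⟨x, .voc .owlSameAs, .node y⟩ ∈ G → M.ind x = M.ind y
  differentFrom : ∀ x y, ⟨x, .voc .owlDifferentFrom, .node y⟩ ∈ G → M.ind x ≠ M.ind y
  allDifferent : ∀ n l xs, ⟨n, .voc .rdfType, Vocab.owlAllDifferent.term⟩ ∈ G →
    (⟨n, .voc .owlMembers, .node l⟩ ∈ G ∨ ⟨n, .voc .owlDistinctMembers, .node l⟩ ∈ G) →
    RDFList G l xs →
    xs.Pairwise (fun s t => ∀ x y, s = .node x → t = .node y → M.ind x ≠ M.ind y)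
  -- class expressions
  intersectionOf : ∀ c l xs, ⟨c, .voc .owlIntersectionOf, .node l⟩ ∈ G → RDFList G l xs →
    M.cls c = {u | ∀ d, Term.node d ∈ xs → u ∈ M.cls d}
  unionOf : ∀ c l xs, ⟨c, .voc .owlUnionOf, .node l⟩ ∈ G → RDFList G l xs →
    M.cls c = {u | ∃ d, Term.node d ∈ xs ∧ u ∈ M.cls d}
  complementOf : ∀ c d, ⟨c, .voc .owlComplementOf, .node d⟩ ∈ G → M.cls c = (M.cls d)ᶜ
  oneOf : ∀ c l xs, ⟨c, .voc .owlOneOf, .node l⟩ ∈ G → RDFList G l xs →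
    M.cls c = {u | ∃ x, Term.node x ∈ xs ∧ u = M.ind x}
  someValuesFrom : ∀ c p d, ⟨c, .voc .owlOnProperty, .node p⟩ ∈ G →
    ⟨c, .voc .owlSomeValuesFrom, .node d⟩ ∈ G →
    (IsObjProp G p → M.cls c = {u | ∃ v, M.op p u v ∧ v ∈ M.cls d}) ∧
    (IsDataProp G p → M.cls c = {u | ∃ v, M.dp p u v ∧ v ∈ M.rng d})
  allValuesFrom : ∀ c p d, ⟨c, .voc .owlOnProperty, .node p⟩ ∈ G →
    ⟨c, .voc .owlAllValuesFrom, .node d⟩ ∈ G →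
    (IsObjProp G p → M.cls c = {u | ∀ v, M.op p u v → v ∈ M.cls d}) ∧
    (IsDataProp G p → M.cls c = {u | ∀ v, M.dp p u v → v ∈ M.rng d})
  opHasValue : ∀ c p y, ⟨c, .voc .owlOnProperty, .node p⟩ ∈ G →
    ⟨c, .voc .owlHasValue, .node y⟩ ∈ G → M.cls c = {u | M.op p u (M.ind y)}
  dpHasValue : ∀ c p w, ⟨c, .voc .owlOnProperty, .node p⟩ ∈ G →
    ⟨c, .voc .owlHasValue, .lit w⟩ ∈ G → M.cls c = {u | M.dp p u (M.lit w)}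
  hasSelf : ∀ c p, ⟨c, .voc .owlOnProperty, .node p⟩ ∈ G →
    ⟨c, .voc .owlHasSelf, .lit litTrue⟩ ∈ G → M.cls c = {u | M.op p u u}
  cardinality : ∀ c p (k : CardKind) n, ⟨c, .voc .owlOnProperty, .node p⟩ ∈ G →
    ⟨c, .voc k.unqualified, .lit (numeral n)⟩ ∈ G →
    (IsObjProp G p → M.cls c = {u | k.Holds n {v | M.op p u v}}) ∧
    (IsDataProp G p → M.cls c = {u | k.Holds n {v | M.dp p u v}})
  opQualifiedCardinality : ∀ c p (k : CardKind) n d, ⟨c, .voc .owlOnProperty, .node p⟩ ∈ G →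
    ⟨c, .voc k.qualified, .lit (numeral n)⟩ ∈ G → ⟨c, .voc .owlOnClass, .node d⟩ ∈ G →
    M.cls c = {u | k.Holds n {v | M.op p u v ∧ v ∈ M.cls d}}
  dpQualifiedCardinality : ∀ c p (k : CardKind) n d, ⟨c, .voc .owlOnProperty, .node p⟩ ∈ G →
    ⟨c, .voc k.qualified, .lit (numeral n)⟩ ∈ G → ⟨c, .voc .owlOnDataRange, .node d⟩ ∈ G →
    M.cls c = {u | k.Holds n {v | M.dp p u v ∧ v ∈ M.rng d}}
  -- class axioms
  subClassOf : ∀ c d, ⟨c, .voc .rdfsSubClassOf, .node d⟩ ∈ G → M.cls c ⊆ M.cls d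
  equivalentClass : ∀ c d, ⟨c, .voc .owlEquivalentClass, .node d⟩ ∈ G → M.cls c = M.cls d
  disjointWith : ∀ c d, ⟨c, .voc .owlDisjointWith, .node d⟩ ∈ G → Disjoint (M.cls c) (M.cls d)
  disjointUnionOf : ∀ c l xs, ⟨c, .voc .owlDisjointUnionOf, .node l⟩ ∈ G → RDFList G l xs →
    M.cls c = {u | ∃ d, Term.node d ∈ xs ∧ u ∈ M.cls d} ∧
    xs.Pairwise (fun s t => ∀ d e, s = .node d → t = .node e → Disjoint (M.cls d) (M.cls e))
  allDisjointClasses : ∀ n l xs, ⟨n, .voc .rdfType, Vocab.owlAllDisjointClasses.term⟩ ∈ G →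
    ⟨n, .voc .owlMembers, .node l⟩ ∈ G → RDFList G l xs →
    xs.Pairwise (fun s t => ∀ d e, s = .node d → t = .node e → Disjoint (M.cls d) (M.cls e))
  hasKey : ∀ c l xs, ⟨c, .voc .owlHasKey, .node l⟩ ∈ G → RDFList G l xs →
    ∀ u v, u ∈ M.cls c → v ∈ M.cls c → M.Named u → M.Named v →
    (∀ p, Term.node p ∈ xs →
      (IsObjProp G p → ∃ w, M.Named w ∧ M.op p u w ∧ M.op p v w) ∧
      (IsDataProp G p → ∃ w, M.dp p u w ∧ M.dp p v w)) → u = v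
  -- property axioms
  domain : ∀ p c, ⟨p, .voc .rdfsDomain, .node c⟩ ∈ G →
    (IsObjProp G p → ∀ u v, M.op p u v → u ∈ M.cls c) ∧
    (IsDataProp G p → ∀ u v, M.dp p u v → u ∈ M.cls c)
  range : ∀ p c, ⟨p, .voc .rdfsRange, .node c⟩ ∈ G →
    (IsObjProp G p → ∀ u v, M.op p u v → v ∈ M.cls c) ∧
    (IsDataProp G p → ∀ u v, M.dp p u v → v ∈ M.rng c)
  subPropertyOf : ∀ p q, ⟨p, .voc .rdfsSubPropertyOf, .node q⟩ ∈ G →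
    (IsObjProp G p → ∀ u v, M.op p u v → M.op q u v) ∧
    (IsDataProp G p → ∀ u v, M.dp p u v → M.dp q u v)
  equivalentProperty : ∀ p q, ⟨p, .voc .owlEquivalentProperty, .node q⟩ ∈ G →
    (IsObjProp G p → ∀ u v, M.op p u v ↔ M.op q u v) ∧
    (IsDataProp G p → ∀ u v, M.dp p u v ↔ M.dp q u v)
  propertyDisjointWith : ∀ p q, ⟨p, .voc .owlPropertyDisjointWith, .node q⟩ ∈ G →
    (IsObjProp G p → ∀ u v, ¬ (M.op p u v ∧ M.op q u v)) ∧
    (IsDataProp G p → ∀ u v, ¬ (M.dp p u v ∧ M.dp q u v))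
  allDisjointProperties : ∀ n l xs,
    ⟨n, .voc .rdfType, Vocab.owlAllDisjointProperties.term⟩ ∈ G →
    ⟨n, .voc .owlMembers, .node l⟩ ∈ G → RDFList G l xs →
    xs.Pairwise (fun s t => ∀ p q, s = .node p → t = .node q →
      (IsObjProp G p → ∀ u v, ¬ (M.op p u v ∧ M.op q u v)) ∧
      (IsDataProp G p → ∀ u v, ¬ (M.dp p u v ∧ M.dp q u v)))
  inverseOf : ∀ p q, ⟨p, .voc .owlInverseOf, .node q⟩ ∈ G → ∀ u v, M.op p u v ↔ M.op q v u
  propertyChain : ∀ p l xs, ⟨p, .voc .owlPropertyChainAxiom, .node l⟩ ∈ G → RDFList G l xs →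
    ∀ u v, M.Chain xs u v → M.op p u v
  functional : ∀ p, ⟨p, .voc .rdfType, Vocab.owlFunctionalProperty.term⟩ ∈ G →
    (IsObjProp G p → ∀ u v w, M.op p u v → M.op p u w → v = w) ∧
    (IsDataProp G p → ∀ u v w, M.dp p u v → M.dp p u w → v = w)
  inverseFunctional : ∀ p, ⟨p, .voc .rdfType, Vocab.owlInverseFunctionalProperty.term⟩ ∈ G →
    ∀ u v w, M.op p u w → M.op p v w → u = v
  reflexive : ∀ p, ⟨p, .voc .rdfType, Vocab.owlReflexiveProperty.term⟩ ∈ G → ∀ u, M.op p u u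
  irreflexive : ∀ p, ⟨p, .voc .rdfType, Vocab.owlIrreflexiveProperty.term⟩ ∈ G →
    ∀ u, ¬ M.op p u u
  symmetric : ∀ p, ⟨p, .voc .rdfType, Vocab.owlSymmetricProperty.term⟩ ∈ G →
    ∀ u v, M.op p u v → M.op p v u
  asymmetric : ∀ p, ⟨p, .voc .rdfType, Vocab.owlAsymmetricProperty.term⟩ ∈ G →
    ∀ u v, M.op p u v → ¬ M.op p v u
  transitive : ∀ p, ⟨p, .voc .rdfType, Vocab.owlTransitiveProperty.term⟩ ∈ G →
    ∀ u v w, M.op p u v → M.op p v w → M.op p u w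

/-- The graph is consistent under OWL semantics. -/
def OWLConsistent (G : RDFGraph) : Prop := ∃ M : Interp, M.Models G

/-! ### Direct mappings and their properties -/

/-- Direct mappings: total functions that assign an RDF graph to a schema, a set of primary keys and
foreign keys over it, and an instance of it. -/
abbrev DirectMapping : Type := (S : Schema) → Constraints S → Instance S → RDFGraph

/-- A numbering of the reserved vocabulary. -/
def Vocab.equiv : Vocab ≃ Fin 73 where
  toFun v := ⟨v.ctorIdx, by cases v <;> decide⟩
  invFun i := Vocab.ofNat i.1
  left_inv v := by cases v <;> rfl
  right_inv := by decide

instance : Primcodable Vocab := Primcodable.ofEquiv _ Vocab.equiv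

def Sym.equiv : Sym ≃ Option (Option (Option ℕ)) where
  toFun
    | .hash => none
    | .comma => some none
    | .equals => some (some none)
    | .ch n => some (some (some n))
  invFun
    | none => .hash
    | some none => .comma
    | some (some none) => .equals
    | some (some (some n)) => .ch n
  left_inv x := by cases x <;> rfl
  right_inv x := by rcases x with _ | _ | _ | _ <;> rfl

instance : Primcodable Sym := Primcodable.ofEquiv _ Sym.equiv

def IRI.equiv : IRI ≃ Vocab ⊕ Str where
  toFun
    | .voc v => .inl v
    | .str x => .inr x
  invFun
    | .inl v => .voc v
    | .inr x => .str x
  left_inv x := by cases x <;> rfl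
  right_inv x := by cases x <;> rfl

instance : Primcodable IRI := Primcodable.ofEquiv _ IRI.equiv

def Node.equiv : Node ≃ IRI ⊕ Str where
  toFun
    | .iri i => .inl i
    | .blank x => .inr x
  invFun
    | .inl i => .iri i
    | .inr x => .blank x
  left_inv x := by cases x <;> rfl
  right_inv x := by cases x <;> rfl

instance : Primcodable Node := Primcodable.ofEquiv _ Node.equiv

def Term.equiv : Term ≃ Node ⊕ Literal where
  toFun
    | .node n => .inl n
    | .lit w => .inr w
  invFun
    | .inl n => .node n
    | .inr w => .lit w
  left_inv x := by cases x <;> rfl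
  right_inv x := by cases x <;> rfl

instance : Primcodable Term := Primcodable.ofEquiv _ Term.equiv

def Triple.equiv : Triple ≃ Node × IRI × Term where
  toFun t := (t.subj, t.pred, t.obj)
  invFun x := ⟨x.1, x.2.1, x.2.2⟩
  left_inv _ := rfl
  right_inv _ := rfl

instance : Primcodable Triple := Primcodable.ofEquiv _ Triple.equiv

/-- Finite descriptions of instances: a list of entries, each with a relation name, a list of its
attributes, and a list of its tuples; a tuple is listed by its non-null attributes with their
values. -/
abbrev DBCode : Type := List (RelName × List Attr × List (List (Attr × Value)))

/-- The list describes the tuple. -/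
def TupleCode (l : List (Attr × Value)) (t : Tuple) : Prop := ∀ A v, t A = some v ↔ (A, v) ∈ l

/-- The description `d` describes the instance `D`. -/
structure DBCode.Describes (d : DBCode) (D : DBInstance) : Prop where
  rels : ∀ R, R ∈ D.1.rels ↔ ∃ e ∈ d, e.1 = R
  att : ∀ R A, A ∈ D.1.att R ↔ ∃ e ∈ d, e.1 = R ∧ A ∈ e.2.1
  tuples : ∀ R t, t ∈ D.2.rel R ↔ ∃ e ∈ d, e.1 = R ∧ ∃ l ∈ e.2.2, TupleCode l t

/-- The mapping `N` is computable: an algorithm turns every listing of the triples of a graph `G`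
into a description of `N G`. -/
def ComputableFromGraphs (N : RDFGraph → DBInstance) : Prop :=
  ∃ f : List Triple → DBCode, Computable f ∧
    ∀ (G : RDFGraph) (l : List Triple), (∀ x, x ∈ l ↔ x ∈ G) → (f l).Describes (N G)

def InformationPreserving (M : DirectMapping) : Prop :=
  ∃ N : RDFGraph → DBInstance, ComputableFromGraphs N ∧
    ∀ (S : Schema) (C : Constraints S) (I : Instance S), I.Sat C → N (M S C I) = ⟨S, I⟩

/-- Query preservation, for schemas with at least one relation name. -/
def QueryPreserving (M : DirectMapping) : Prop :=
  ∀ (S : Schema) (C : Constraints S), S.rels.Nonempty → ∀ Q : RA, Q.WF S →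
    ∃ P : Pattern, P.IsQuery ∧
      ∀ I : Instance S, I.Sat C → tr '' Q.eval I = P.eval (M S C I)

def MonotoneMapping (M : DirectMapping) : Prop :=
  ∀ (S : Schema) (C : Constraints S) (I J : Instance S), I.Sub J → M S C I ⊆ M S C J

/-- Semantics preservation if only primary keys are considered. -/
def SemanticsPreservingForKeys (M : DirectMapping) : Prop :=
  ∀ (S : Schema) (C : Constraints S), C.OnlyKeys →
    ∀ I : Instance S, I.Sat C ↔ OWLConsistent (M S C I)

/-! ### The direct mapping, as rules -/

section Rules

variable {S : Schema} (C : Constraints S) (I : Instance S)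

/-- `As` is the primary key of `R`. -/
def PK (As : List Attr) (R : RelName) : Prop := Constraint.key R As ∈ C.carrier

/-- `R[As] ⊆ T[Bs]` is a foreign key. -/
def FK (As : List Attr) (R : RelName) (Bs : List Attr) (T : RelName) : Prop :=
  Constraint.fk R As T Bs ∈ C.carrier

/-- `v` is the value of the attribute `A` in the tuple `t` of `R`. -/
def HasValue (v : Option Value) (A : Attr) (t : Tuple) (R : RelName) : Prop :=
  t ∈ I.rel R ∧ A ∈ S.att R ∧ t A = v

variable (S) in
def ExistThreeAttr (R : RelName) : Prop :=
  ∃ X Y Z, X ∈ S.att R ∧ Y ∈ S.att R ∧ Z ∈ S.att R ∧ X ≠ Y ∧ X ≠ Z ∧ Y ≠ Z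

def TwoFKFrom (X : Attr) (R : RelName) : Prop :=
  (∃ U₁ V₁ U₂ V₂, FK C [X] R [U₁] V₁ ∧ FK C [X] R [U₂] V₂ ∧ U₁ ≠ U₂) ∨
  (∃ U₁ V₁ U₂ V₂, FK C [X] R [U₁] V₁ ∧ FK C [X] R [U₂] V₂ ∧ V₁ ≠ V₂)

def FKFrom (X Y : Attr) (R : RelName) : Prop :=
  (∃ U V W, FK C [X, Y] R [U, V] W) ∨ (∃ U V W, FK C [Y, X] R [U, V] W)

def FKTo (X : RelName) : Prop :=
  (∃ U Y V, FK C [U] Y [V] X) ∨ (∃ U₁ U₂ Y V₁ V₂, FK C [U₁, U₂] Y [V₁, V₂] X)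

/-- `R(A, B)` is a binary relation between `T` and `U`, through their attributes `D` and `E`. -/
structure BinRel (R : RelName) (A B : Attr) (T : RelName) (D : Attr) (U : RelName) (E : Attr) :
    Prop where
  pk : PK C [A, B] R
  notThree : ¬ ExistThreeAttr S R
  fkA : FK C [A] R [D] T
  neT : R ≠ T
  fkB : FK C [B] R [E] U
  neU : R ≠ U
  notTwoA : ¬ TwoFKFrom C A R
  notTwoB : ¬ TwoFKFrom C B R
  notFrom : ¬ FKFrom C A B R
  notTo : ¬ FKTo C R

def IsBinRel (R : RelName) : Prop := ∃ A B T D U E, BinRel C R A B T D U E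

def IsClass (R : RelName) : Prop := R ∈ S.rels ∧ ¬ IsBinRel C R

/-- `Xs`, `Ys` form an object property with domain `T` and range `U`, from a foreign key. -/
def ObjP (Xs Ys : List Attr) (T U : RelName) : Prop := FK C Xs T Ys U ∧ ¬ IsBinRel C T

/-- `A` is a data type property with domain `R`. -/
def DTP (A : Attr) (R : RelName) : Prop := A ∈ S.att R ∧ ¬ IsBinRel C R

def HasPK (R : RelName) : Prop := ∃ As, PK C As R

variable (base : Str)

/-- `base R` -/
def classStr (R : RelName) : Str := base ++ Word.str R

/-- `base R#A` -/
def dtpStr (A : Attr) (R : RelName) : Str := base ++ Word.str R ++ [.hash] ++ Word.str A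

/-- The words of a list, separated by commas. -/
def commaSep (xs : List Str) : Str := [Sym.comma].intercalate xs

/-- `base R#A,B,D,E` -/
def binStr (R : RelName) (A B D E : Attr) : Str :=
  base ++ Word.str R ++ [.hash] ++ commaSep [Word.str A, Word.str B, Word.str D, Word.str E]

/-- `base T,U#X₁,…,Xₙ,Y₁,…,Yₙ` -/
def fkStr (Xs Ys : List Attr) (T U : RelName) : Str :=
  base ++ Word.str T ++ [.comma] ++ Word.str U ++ [.hash] ++ commaSep ((Xs ++ Ys).map Word.str)

/-- `base R#A₁=V₁,…,Aₙ=Vₙ` -/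
def rowStr (Vs : List Value) (As : List Attr) (R : RelName) : Str :=
  base ++ Word.str R ++ [.hash] ++
    commaSep (List.zipWith (fun A V => Word.str A ++ [.equals] ++ Word.str V) As Vs)

def ClassIRI (R : RelName) (x : IRI) : Prop := IsClass C R ∧ x = .str (classStr base R)

def DTPIRI (A : Attr) (R : RelName) (x : IRI) : Prop := DTP C A R ∧ x = .str (dtpStr base A R)

def BinIRI (R : RelName) (A B : Attr) (T : RelName) (D : Attr) (U : RelName) (E : Attr)
    (x : IRI) : Prop :=
  BinRel C R A B T D U E ∧ x = .str (binStr base R A B D E)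

def ObjPIRI (Xs Ys : List Attr) (T U : RelName) (x : IRI) : Prop :=
  ObjP C Xs Ys T U ∧ x = .str (fkStr base Xs Ys T U)

/-- `x` is the IRI of the tuple `t` of `R`; its primary key attributes have the values `Vs`. No IRI is
generated from a `NULL`, which is not a string. -/
def RowIRI (Vs : List Value) (As : List Attr) (t : Tuple) (R : RelName) (x : Node) : Prop :=
  PK C As R ∧ List.Forall₂ (fun A V => HasValue I (some V) A t R) As Vs ∧
    x = .iri (.str (rowStr base Vs As R))

variable (tid : RelName → Tuple → Str)

/-- `x` is the blank node of the tuple `t` of `R`. -/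
def RowBN (t : Tuple) (R : RelName) (x : Node) : Prop :=
  (∃ v A, HasValue I v A t R) ∧ x = .blank (Word.str R ++ tid R t)

/-- `x` is the identifier of the tuple `t` of `R`. -/
def RowId (t : Tuple) (R : RelName) (x : Node) : Prop :=
  (IsClass C R ∧ ∃ As Vs, RowIRI C I base Vs As t R x) ∨
  (IsClass C R ∧ ¬ HasPK C R ∧ RowBN I tid t R x)

/-- The triples generated by the direct mapping `DM`. -/
inductive DMTriple : Triple → Prop
  | classDecl (R : RelName) (u : IRI) :
      ClassIRI C base R u → DMTriple ⟨.iri u, .voc .rdfType, Vocab.owlClass.term⟩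
  | binDecl (R A B T D U E) (u : IRI) : BinIRI C base R A B T D U E u →
      DMTriple ⟨.iri u, .voc .rdfType, Vocab.owlObjectProperty.term⟩
  | opDecl (Xs Ys T U) (u : IRI) : ObjPIRI C base Xs Ys T U u →
      DMTriple ⟨.iri u, .voc .rdfType, Vocab.owlObjectProperty.term⟩
  | binDomain (R A B T D U E) (u w : IRI) : BinIRI C base R A B T D U E u → ClassIRI C base T w →
      DMTriple ⟨.iri u, .voc .rdfsDomain, .node (.iri w)⟩
  | opDomain (Xs Ys T U) (u w : IRI) : ObjPIRI C base Xs Ys T U u → ClassIRI C base T w →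
      DMTriple ⟨.iri u, .voc .rdfsDomain, .node (.iri w)⟩
  | binRange (R A B T D U E) (u w : IRI) : BinIRI C base R A B T D U E u → ClassIRI C base U w →
      DMTriple ⟨.iri u, .voc .rdfsRange, .node (.iri w)⟩
  | opRange (Xs Ys T U) (u w : IRI) : ObjPIRI C base Xs Ys T U u → ClassIRI C base U w →
      DMTriple ⟨.iri u, .voc .rdfsRange, .node (.iri w)⟩
  | dtpDecl (A R) (u : IRI) : DTPIRI C base A R u →
      DMTriple ⟨.iri u, .voc .rdfType, Vocab.owlDatatypeProperty.term⟩
  | dtpDomain (A R) (u w : IRI) : DTPIRI C base A R u → ClassIRI C base R w →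
      DMTriple ⟨.iri u, .voc .rdfsDomain, .node (.iri w)⟩
  | table (v A t R) (u : Node) (w : IRI) : HasValue I v A t R → RowId C I base tid t R u →
      ClassIRI C base R w → DMTriple ⟨u, .voc .rdfType, .node (.iri w)⟩
  | binRef (R A B T D U E) (v₁ v₂ t₁ t₂ t₃) (x y : Node) (p : IRI) :
      HasValue I v₁ A t₁ R → HasValue I v₁ D t₂ T →
      HasValue I v₂ B t₁ R → HasValue I v₂ E t₃ U →
      RowId C I base tid t₂ T x → BinIRI C base R A B T D U E p → RowId C I base tid t₃ U y →
      DMTriple ⟨x, p, .node y⟩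
  | fkRef (Xs Ys T U) (t₁ t₂) (x y : Node) (p : IRI) :
      List.Forall₂ (fun X Y => ∃ v, HasValue I v X t₁ T ∧ HasValue I v Y t₂ U) Xs Ys →
      RowId C I base tid t₁ T x → RowId C I base tid t₂ U y → ObjPIRI C base Xs Ys T U p →
      DMTriple ⟨x, p, .node y⟩
  | literal (A R t) (w : Value) (x : Node) (p : IRI) : HasValue I (some w) A t R →
      RowId C I base tid t R x → DTPIRI C base A R p → DMTriple ⟨x, p, .lit w⟩

variable (a : IRI)

/-- The triples generated by `DM_pk`: those of `DM` and, if a primary key is violated, an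
`owl:differentFrom` triple. -/
inductive DMpkTriple : Triple → Prop
  | dm (x : Triple) : DMTriple C I base tid x → DMpkTriple x
  | repeated (As R t₁ t₂) : PK C As R →
      (∀ A ∈ As, ∃ v, HasValue I v A t₁ R ∧ HasValue I v A t₂ R) → t₁ ≠ t₂ →
      DMpkTriple ⟨.iri a, .voc .owlDifferentFrom, .node (.iri a)⟩
  | null (As R A t) : PK C As R → A ∈ As → HasValue I none A t R →
      DMpkTriple ⟨.iri a, .voc .owlDifferentFrom, .node (.iri a)⟩


end Rules

/-! ### Finiteness of the generated graphs -/

section Finiteness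

variable {S : Schema} (C : Constraints S) (I : Instance S) (base : Str)
  (tid : RelName → Tuple → Str)

/-- The names of classes and of data type properties, and of the object properties, that are
generated from `S` and `C`. -/
def schemaIRIs : Set IRI :=
  {x | (∃ R, ClassIRI C base R x) ∨ (∃ A R, DTPIRI C base A R x) ∨
    (∃ R A B T D U E, BinIRI C base R A B T D U E x) ∨ ∃ Xs Ys T U, ObjPIRI C base Xs Ys T U x}

theorem mem_rels_of_mem_att {R : RelName} {A : Attr} (h : A ∈ S.att R) : R ∈ S.rels := by
  by_contra hR
  rw [S.att_eq_empty R hR] at h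
  simp at h

theorem schemaIRIs_finite : (schemaIRIs C base).Finite := by
  have h1 : {x | ∃ R, ClassIRI C base R x}.Finite := by
    refine (S.rels.finite_toSet.image (fun R => IRI.str (classStr base R))).subset ?_
    rintro x ⟨R, hR, rfl⟩
    exact ⟨R, hR.1, rfl⟩
  have h2 : {x | ∃ A R, DTPIRI C base A R x}.Finite := by
    refine (S.rels.finite_toSet.biUnion (t := fun R =>
      (fun A => IRI.str (dtpStr base A R)) '' (S.att R : Set Attr))
      (fun R _ => (S.att R).finite_toSet.image _)).subset ?_
    rintro x ⟨A, R, hA, rfl⟩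
    exact Set.mem_biUnion (mem_rels_of_mem_att hA.1) ⟨A, hA.1, rfl⟩
  have h3 : {x | ∃ R A B T D U E, BinIRI C base R A B T D U E x}.Finite := by
    have hf : ((C.carrier : Set Constraint) ×ˢ
        ((C.carrier : Set Constraint) ×ˢ (C.carrier : Set Constraint))).Finite :=
      C.carrier.finite_toSet.prod (C.carrier.finite_toSet.prod C.carrier.finite_toSet)
    refine (hf.image (fun c => match c with
      | (.key R [A, B], .fk _ _ _ [D], .fk _ _ _ [E]) => IRI.str (binStr base R A B D E)
      | _ => IRI.str [])).subset ?_
    rintro x ⟨R, A, B, T, D, U, E, h, rfl⟩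
    exact ⟨(.key R [A, B], .fk R [A] T [D], .fk R [B] U [E]), ⟨h.pk, h.fkA, h.fkB⟩, rfl⟩
  have h4 : {x | ∃ Xs Ys T U, ObjPIRI C base Xs Ys T U x}.Finite := by
    refine (C.carrier.finite_toSet.image (fun c => match c with
      | .fk T Xs U Ys => IRI.str (fkStr base Xs Ys T U)
      | _ => IRI.str [])).subset ?_
    rintro x ⟨Xs, Ys, T, U, h, rfl⟩
    exact ⟨.fk T Xs U Ys, h.1, rfl⟩
  exact h1.union (h2.union (h3.union h4))

theorem rows_finite : {x : RelName × Tuple | x.1 ∈ S.rels ∧ x.2 ∈ I.rel x.1}.Finite := by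
  refine (S.rels.finite_toSet.biUnion (t := fun R => (fun t => (R, t)) '' I.rel R)
    (fun R _ => (I.finite R).image _)).subset ?_
  rintro ⟨R, t⟩ h
  exact Set.mem_biUnion h.1 ⟨t, h.2, rfl⟩

theorem rowIds_finite : {x | ∃ t R, RowId C I base tid t R x}.Finite := by
  have h1 : {x | ∃ Vs As t R, RowIRI C I base Vs As t R x}.Finite := by
    refine ((C.carrier.finite_toSet.prod (rows_finite I)).image (fun c => match c.1 with
      | .key R As => Node.iri (.str (rowStr base (As.map fun A => (c.2.2 A).getD []) As R))
      | _ => Node.iri (.str []))).subset ?_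
    rintro x ⟨Vs, As, t, R, hk, hv, rfl⟩
    have hwf := C.wf _ hk
    have hVs : Vs = As.map fun A => (t A).getD [] := by
      clear hk hwf
      induction hv with
      | nil => rfl
      | cons h _ ih => simp [h.2.2, ← ih]
    have ht : t ∈ I.rel R := by
      obtain ⟨A, As', rfl⟩ := List.exists_cons_of_ne_nil hwf.2.1
      cases hv with
      | cons h _ => exact h.1
    exact ⟨(.key R As, (R, t)), ⟨hk, hwf.1, ht⟩, by simp [hVs]⟩
  have h2 : {x | ∃ t R, RowBN I tid t R x}.Finite := by
    refine ((rows_finite I).image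
      (fun c => Node.blank (Word.str c.1 ++ tid c.1 c.2))).subset ?_
    rintro x ⟨t, R, ⟨v, A, h⟩, rfl⟩
    exact ⟨(R, t), ⟨mem_rels_of_mem_att h.2.1, h.1⟩, rfl⟩
  refine (h1.union h2).subset ?_
  rintro x ⟨t, R, ⟨_, As, Vs, h⟩ | ⟨_, _, h⟩⟩
  · exact Or.inl ⟨Vs, As, t, R, h⟩
  · exact Or.inr ⟨t, R, h⟩

theorem values_finite : {v | ∃ A t R, HasValue I v A t R}.Finite := by
  refine ((rows_finite I).biUnion (t := fun c => (fun A => c.2 A) '' (S.att c.1 : Set Attr))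
    (fun c _ => (S.att c.1).finite_toSet.image _)).subset ?_
  rintro v ⟨A, t, R, h⟩
  exact Set.mem_biUnion (x := (R, t)) ⟨mem_rels_of_mem_att h.2.1, h.1⟩ ⟨A, h.2.1, h.2.2⟩

theorem dmpkTriple_finite (a : IRI) : {x | DMpkTriple C I base tid a x}.Finite := by
  have hI := schemaIRIs_finite C base
  have hV : Set.Finite {p : IRI | ∃ v : Vocab, p = .voc v} :=
    (Set.finite_range (fun i => IRI.voc (Vocab.equiv.symm i))).subset (by
      rintro _ ⟨v, rfl⟩
      exact ⟨Vocab.equiv v, by simp⟩)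
  have hN : ({x : Node | (∃ i ∈ schemaIRIs C base, x = .iri i) ∨
      (∃ t R, RowId C I base tid t R x) ∨ (∃ i : IRI, (∃ v : Vocab, i = .voc v) ∧ x = .iri i) ∨
      x = .iri a}).Finite := by
    refine Set.Finite.union ((hI.image Node.iri).subset ?_) ((rowIds_finite C I base tid).union
      (((hV.image Node.iri).subset ?_).union (Set.finite_singleton _)))
    · rintro _ ⟨i, hi, rfl⟩
      exact ⟨i, hi, rfl⟩
    · rintro _ ⟨i, hi, rfl⟩
      exact ⟨i, hi, rfl⟩
  have hO := (hN.image Term.node).union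
    ((values_finite I).image (fun v => Term.lit (v.getD [])))
  refine ((hN.prod ((hI.union hV).prod hO)).image Triple.equiv.symm).subset ?_
  intro x hx
  refine ⟨(x.subj, x.pred, x.obj), ?_, rfl⟩
  have hb : ∀ {R A B T D U E u}, BinIRI C base R A B T D U E u → u ∈ schemaIRIs C base :=
    fun h => Or.inr (Or.inr (Or.inl ⟨_, _, _, _, _, _, _, h⟩))
  have ho : ∀ {Xs Ys T U u}, ObjPIRI C base Xs Ys T U u → u ∈ schemaIRIs C base :=
    fun h => Or.inr (Or.inr (Or.inr ⟨_, _, _, _, h⟩))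
  have hc : ∀ {R u}, ClassIRI C base R u → u ∈ schemaIRIs C base := fun h => Or.inl ⟨_, h⟩
  have hd : ∀ {A R u}, DTPIRI C base A R u → u ∈ schemaIRIs C base :=
    fun h => Or.inr (Or.inl ⟨_, _, h⟩)
  cases hx with
  | dm _ hx =>
    cases hx with
    | classDecl R u h =>
      exact ⟨Or.inl ⟨u, hc h, rfl⟩, Or.inr ⟨_, rfl⟩,
        Or.inl ⟨_, Or.inr (Or.inr (Or.inl ⟨_, ⟨_, rfl⟩, rfl⟩)), rfl⟩⟩
    | binDecl R A B T D U E u h =>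
      exact ⟨Or.inl ⟨u, hb h, rfl⟩, Or.inr ⟨_, rfl⟩,
        Or.inl ⟨_, Or.inr (Or.inr (Or.inl ⟨_, ⟨_, rfl⟩, rfl⟩)), rfl⟩⟩
    | opDecl Xs Ys T U u h =>
      exact ⟨Or.inl ⟨u, ho h, rfl⟩, Or.inr ⟨_, rfl⟩,
        Or.inl ⟨_, Or.inr (Or.inr (Or.inl ⟨_, ⟨_, rfl⟩, rfl⟩)), rfl⟩⟩
    | binDomain R A B T D U E u w h h' =>
      exact ⟨Or.inl ⟨u, hb h, rfl⟩, Or.inr ⟨_, rfl⟩, Or.inl ⟨_, Or.inl ⟨w, hc h', rfl⟩, rfl⟩⟩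
    | opDomain Xs Ys T U u w h h' =>
      exact ⟨Or.inl ⟨u, ho h, rfl⟩, Or.inr ⟨_, rfl⟩, Or.inl ⟨_, Or.inl ⟨w, hc h', rfl⟩, rfl⟩⟩
    | binRange R A B T D U E u w h h' =>
      exact ⟨Or.inl ⟨u, hb h, rfl⟩, Or.inr ⟨_, rfl⟩, Or.inl ⟨_, Or.inl ⟨w, hc h', rfl⟩, rfl⟩⟩
    | opRange Xs Ys T U u w h h' =>
      exact ⟨Or.inl ⟨u, ho h, rfl⟩, Or.inr ⟨_, rfl⟩, Or.inl ⟨_, Or.inl ⟨w, hc h', rfl⟩, rfl⟩⟩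
    | dtpDecl A R u h =>
      exact ⟨Or.inl ⟨u, hd h, rfl⟩, Or.inr ⟨_, rfl⟩,
        Or.inl ⟨_, Or.inr (Or.inr (Or.inl ⟨_, ⟨_, rfl⟩, rfl⟩)), rfl⟩⟩
    | dtpDomain A R u w h h' =>
      exact ⟨Or.inl ⟨u, hd h, rfl⟩, Or.inr ⟨_, rfl⟩, Or.inl ⟨_, Or.inl ⟨w, hc h', rfl⟩, rfl⟩⟩
    | table v A t R u w _ h h' =>
      exact ⟨Or.inr (Or.inl ⟨t, R, h⟩), Or.inr ⟨_, rfl⟩,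
        Or.inl ⟨_, Or.inl ⟨w, hc h', rfl⟩, rfl⟩⟩
    | binRef R A B T D U E v₁ v₂ t₁ t₂ t₃ x y p _ _ _ _ h h' h'' =>
      exact ⟨Or.inr (Or.inl ⟨_, _, h⟩), Or.inl (hb h'),
        Or.inl ⟨_, Or.inr (Or.inl ⟨_, _, h''⟩), rfl⟩⟩
    | fkRef Xs Ys T U t₁ t₂ x y p _ h h' h'' =>
      exact ⟨Or.inr (Or.inl ⟨_, _, h⟩), Or.inl (ho h''),
        Or.inl ⟨_, Or.inr (Or.inl ⟨_, _, h'⟩), rfl⟩⟩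
    | literal A R t w x p hv h h' =>
      exact ⟨Or.inr (Or.inl ⟨_, _, h⟩), Or.inl (hd h'), Or.inr ⟨some w, ⟨_, _, _, hv⟩, rfl⟩⟩
  | repeated As R t₁ t₂ _ _ _ =>
    exact ⟨Or.inr (Or.inr (Or.inr rfl)), Or.inr ⟨_, rfl⟩,
      Or.inl ⟨_, Or.inr (Or.inr (Or.inr rfl)), rfl⟩⟩
  | null As R A t _ _ _ =>
    exact ⟨Or.inr (Or.inr (Or.inr rfl)), Or.inr ⟨_, rfl⟩,
      Or.inl ⟨_, Or.inr (Or.inr (Or.inr rfl)), rfl⟩⟩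

end Finiteness

/-- The direct mapping `DM_pk`, for a base IRI `base`, an assignment `tid` of identifiers to tuples,
and the IRI `a` of the artificial triple. -/
noncomputable def DMpk (base : Str) (tid : RelName → Tuple → Str) (a : IRI) : DirectMapping :=
  fun _ C I => (dmpkTriple_finite C I base tid a).toFinset

/-- Within every relation name, distinct tuples (over finite sets of attributes) have distinct
identifiers. -/
def IsTupleId (tid : RelName → Tuple → Str) : Prop :=
  ∀ R, Set.InjOn (tid R) {t | {A | t A ≠ none}.Finite}

end RDBToRDF

namespace RDBToRDF

/-! ### Separators in generated strings -/

/-! If `I` satisfies `C`, no `owl:differentFrom` triple is generated (`sat_artificial`), so the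
graph consists of the triples of `DM`. Names and values contain no separators. The first hash and
the commas around it therefore separate the three sorts of property IRIs (no comma for `dtpStr`,
commas only after the hash for `binStr`, a comma before it for `fkStr`) and give back the parameters
of the first two. Consequently the triples of each relevant form correspond exactly to facts about
`S`, `C` and `I`; this is the content of the `_mem_iff` lemmas. Moreover every tuple of a class has
a node (`exists_rowId`), and a node belongs to at most one tuple of a given class (`rowId_unique`).

Information preservation. A tuple of a class is read from the literals at its node, a missing
literal meaning `NULL`; the type triple shows the tuple even if all its values are null. A tuple of
a binary relation has no node. Its two values are key values, hence not null, and they reappear at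
the two ends of a reference triple; the domain and range triples tell in which classes to read them
(`graphRow_DMpk`). The decoder `decodeGraph` is primitive recursive, depends only on the set of
triples, and describes some instance on every input, so it defines a total computable inverse.

Query preservation is an induction on the query (`translatable`), with unbound variables in the role
of `NULL`. A class is queried by its type triple with one `OPT` for each attribute, a binary
relation by three joined triples. Two operations need care. Compatibility of mappings ignores
unbound variables, so a join must first require the common attributes to be bound. `MINUS` tests
compatibility and overlap instead of equality, so a difference is split according to the domains of
the mappings and a dummy triple is joined to both sides. Hidden variables are kept fresh throughout
by the notion `Realizable`, which gives non-parametricity.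

Monotonicity holds because the instance occurs only positively in the rules. For primary keys alone,
a satisfying instance yields only declarations, domains, types and literals, which have a one-point
model (`fullInterp_models`), whereas a violation makes `a` different from itself. -/

/-- The part of a string before the first occurrence of `c`. -/
def before (c : Sym) (s : Str) : Str := s.takeWhile (· ≠ c)

/-- The part of a string after the first occurrence of `c`. -/
def after (c : Sym) (s : Str) : Str := (s.dropWhile (· ≠ c)).tail

theorem before_append {c : Sym} {u : Str} (hu : c ∉ u) (v : Str) : before c (u ++ c :: v) = u := by
  induction u with
  | nil => simp [before]
  | cons x u ih =>
    have hx : x ≠ c := fun h => hu (by simp [h])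
    have := ih (fun h => hu (List.mem_cons_of_mem _ h))
    simp only [before] at this ⊢
    rw [List.cons_append, List.takeWhile_cons_of_pos (by simpa using hx), this]

theorem after_append {c : Sym} {u : Str} (hu : c ∉ u) (v : Str) : after c (u ++ c :: v) = v := by
  induction u with
  | nil => simp [after]
  | cons x u ih =>
    have hx : x ≠ c := fun h => hu (by simp [h])
    have := ih (fun h => hu (List.mem_cons_of_mem _ h))
    simp only [after] at this ⊢
    rw [List.cons_append, List.dropWhile_cons_of_pos (by simpa using hx), this]

/-- Cutting at the first `c` inverts the concatenation; all readability of generated strings rests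
on this. -/
theorem append_sep_inj {c : Sym} {u u' v v' : Str} (hu : c ∉ u) (hu' : c ∉ u')
    (h : u ++ c :: v = u' ++ c :: v') : u = u' ∧ v = v' := by
  have h1 := before_append hu v
  have h2 := after_append hu v
  rw [h, before_append hu'] at h1
  rw [h, after_append hu'] at h2
  exact ⟨h1.symm, h2.symm⟩

@[simp] theorem hash_notMem_str (x : Word) : Sym.hash ∉ Word.str x := by simp [Word.str]

@[simp] theorem comma_notMem_str (x : Word) : Sym.comma ∉ Word.str x := by simp [Word.str]

theorem str_injective : Function.Injective Word.str :=
  List.map_injective_iff.mpr fun _ _ h => by simpa using h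

theorem classStr_injective (base : Str) : Function.Injective (classStr base) := by
  intro R R' h
  exact str_injective (List.append_cancel_left h)

theorem dtpStr_eq (base : Str) (A : Attr) (R : RelName) :
    dtpStr base A R = base ++ (Word.str R ++ .hash :: Word.str A) := by
  simp [dtpStr]

theorem binStr_eq (base : Str) (R : RelName) (A B D E : Attr) :
    binStr base R A B D E = base ++ (Word.str R ++ .hash :: (Word.str A ++ .comma ::
      (Word.str B ++ .comma :: (Word.str D ++ .comma :: Word.str E)))) := by
  simp [binStr, commaSep, List.intercalate]

theorem fkStr_eq (base : Str) (Xs Ys : List Attr) (T U : RelName) :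
    fkStr base Xs Ys T U = base ++ ((Word.str T ++ .comma :: Word.str U) ++ .hash ::
      commaSep ((Xs ++ Ys).map Word.str)) := by
  simp [fkStr]

theorem dtpStr_inj {base : Str} {A A' : Attr} {R R' : RelName}
    (h : dtpStr base A R = dtpStr base A' R') : A = A' ∧ R = R' := by
  rw [dtpStr_eq, dtpStr_eq] at h
  have := append_sep_inj (by simp) (by simp) (List.append_cancel_left h)
  exact ⟨str_injective this.2, str_injective this.1⟩

theorem binStr_inj {base : Str} {R R' : RelName} {A A' B B' D D' E E' : Attr}
    (h : binStr base R A B D E = binStr base R' A' B' D' E') :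
    R = R' ∧ A = A' ∧ B = B' ∧ D = D' ∧ E = E' := by
  rw [binStr_eq, binStr_eq] at h
  have h1 := append_sep_inj (by simp) (by simp) (List.append_cancel_left h)
  have h2 := append_sep_inj (by simp) (by simp) h1.2
  have h3 := append_sep_inj (by simp) (by simp) h2.2
  have h4 := append_sep_inj (by simp) (by simp) h3.2
  exact ⟨str_injective h1.1, str_injective h2.1, str_injective h3.1, str_injective h4.1,
    str_injective h4.2⟩

/-- After the first hash, the left string has a comma and the right one is a bare attribute name. -/
theorem binStr_ne_dtpStr {base : Str} {R R' : RelName} {A B D E A' : Attr} :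
    binStr base R A B D E ≠ dtpStr base A' R' := by
  intro h
  rw [binStr_eq, dtpStr_eq] at h
  have h1 := append_sep_inj (by simp) (by simp) (List.append_cancel_left h)
  have := comma_notMem_str A'
  rw [← h1.2] at this
  simp at this

/-- Before the first hash, the right string has a comma and the left one is a bare relation name. -/
theorem binStr_ne_fkStr {base : Str} {R T U : RelName} {A B D E : Attr} {Xs Ys : List Attr} :
    binStr base R A B D E ≠ fkStr base Xs Ys T U := by
  intro h
  rw [binStr_eq, fkStr_eq] at h
  have h1 := append_sep_inj (by simp) (by simp) (List.append_cancel_left h)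
  have := comma_notMem_str R
  rw [h1.1] at this
  simp at this

/-- Nonemptiness matters: the empty list and the list of one empty string are joined to the same
string. -/
theorem commaSep_inj {l l' : List Str} (hl : ∀ x ∈ l, Sym.comma ∉ x)
    (hl' : ∀ x ∈ l', Sym.comma ∉ x) (hne : l ≠ []) (hne' : l' ≠ [])
    (h : commaSep l = commaSep l') : l = l' := by
  rw [← List.splitOn_intercalate Sym.comma hl hne, ← List.splitOn_intercalate Sym.comma hl' hne']
  exact congrArg _ h

/-- Both sides use the same attributes, so each item has a known prefix to cancel; only the commas
have to be located. -/
theorem rowStr_inj {base : Str} {R : RelName} {As : List Attr} {Vs Vs' : List Value}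
    (hne : As ≠ []) (h1 : As.length = Vs.length) (h2 : As.length = Vs'.length)
    (h : rowStr base Vs As R = rowStr base Vs' As R) : Vs = Vs' := by
  have hc : ∀ Vs : List Value, ∀ x ∈ List.zipWith
      (fun A V => Word.str A ++ [.equals] ++ Word.str V) As Vs, Sym.comma ∉ x := by
    intro Vs x hx
    obtain ⟨i, hi, rfl⟩ := List.mem_iff_getElem.mp hx
    simp
  have hn : ∀ Vs : List Value, As.length = Vs.length → List.zipWith
      (fun A V => Word.str A ++ [.equals] ++ Word.str V) As Vs ≠ [] := by
    intro Vs hV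
    cases As with
    | nil => exact absurd rfl hne
    | cons A As =>
      cases Vs with
      | nil => simp at hV
      | cons V Vs => simp
  have hz := commaSep_inj (hc Vs) (hc Vs') (hn _ h1) (hn _ h2) (List.append_cancel_left h)
  refine List.ext_getElem (h1.symm.trans h2) fun i hi hi' => ?_
  have hzi := List.ext_getElem_iff.mp hz |>.2 i (by simp; omega) (by simp; omega)
  simp only [List.getElem_zipWith] at hzi
  exact str_injective (List.append_cancel_left hzi)

/-! ### The triples of the generated graph -/

section Graph

variable {S : Schema} {C : Constraints S} {I : Instance S} {base : Str}
  {tid : RelName → Tuple → Str} {a : IRI}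

theorem mem_DMpk {x : Triple} : x ∈ DMpk base tid a S C I ↔ DMpkTriple C I base tid a x := by
  simp [DMpk]

/-- `T` is the target of a one-attribute foreign key, which `notTo` forbids for a binary relation.
-/
theorem BinRel.isClass_left {R A B T D U E} (h : BinRel C R A B T D U E) : IsClass C T := by
  refine ⟨(C.wf _ h.fkA).2.1.1, ?_⟩
  rintro ⟨A', B', T', D', U', E', h'⟩
  exact h'.notTo (Or.inl ⟨_, _, _, h.fkA⟩)

theorem BinRel.isClass_right {R A B T D U E} (h : BinRel C R A B T D U E) : IsClass C U := by
  refine ⟨(C.wf _ h.fkB).2.1.1, ?_⟩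
  rintro ⟨A', B', T', D', U', E', h'⟩
  exact h'.notTo (Or.inl ⟨_, _, _, h.fkB⟩)

theorem BinRel.mem_left {R A B T D U E} (h : BinRel C R A B T D U E) : D ∈ S.att T :=
  (C.wf _ h.fkA).2.1.2.2.2 _ (by simp)

theorem BinRel.mem_right {R A B T D U E} (h : BinRel C R A B T D U E) : E ∈ S.att U :=
  (C.wf _ h.fkB).2.1.2.2.2 _ (by simp)

theorem BinRel.ne {R A B T D U E} (h : BinRel C R A B T D U E) : A ≠ B := by
  have := (C.wf _ h.pk).2.2.1
  simpa using this

theorem BinRel.att_eq {R A B T D U E} (h : BinRel C R A B T D U E) : S.att R = {A, B} := by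
  have hA : A ∈ S.att R := (C.wf _ h.pk).2.2.2 _ (by simp)
  have hB : B ∈ S.att R := (C.wf _ h.pk).2.2.2 _ (by simp)
  ext X
  simp only [Finset.mem_insert, Finset.mem_singleton]
  constructor
  · intro hX
    by_contra! hne
    exact h.notThree ⟨A, B, X, hA, hB, hX, h.ne, hne.1.symm, hne.2.symm⟩
  · rintro (rfl | rfl) <;> assumption

/-- The primary key is unique and fixes `A` and `B`; each of these carries only one one-attribute
foreign key, which fixes the targets. Without this the tuples linked by a reference triple could not
be located. -/
theorem BinRel.unique {R A B T D U E A' B' T' D' U' E'} (h : BinRel C R A B T D U E)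
    (h' : BinRel C R A' B' T' D' U' E') :
    A = A' ∧ B = B' ∧ T = T' ∧ D = D' ∧ U = U' ∧ E = E' := by
  have hk := C.key_unique _ _ _ h.pk h'.pk
  obtain ⟨rfl, rfl⟩ : A = A' ∧ B = B' := by simpa using hk
  have hA := h.notTwoA
  have hB := h.notTwoB
  simp only [TwoFKFrom, not_or, not_exists, not_and, not_not] at hA hB
  exact ⟨rfl, rfl, hA.2 _ _ _ _ h.fkA h'.fkA, hA.1 _ _ _ _ h.fkA h'.fkA,
    hB.2 _ _ _ _ h.fkB h'.fkB, hB.1 _ _ _ _ h.fkB h'.fkB⟩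

theorem isClass_of_dtp {A : Attr} {R : RelName} (h : DTP C A R) : IsClass C R :=
  ⟨mem_rels_of_mem_att h.1, h.2⟩

theorem IsClass.dtp_iff {A : Attr} {R : RelName} (h : IsClass C R) : DTP C A R ↔ A ∈ S.att R :=
  ⟨fun h' => h'.1, fun h' => ⟨h', h.2⟩⟩

theorem sat_artificial (hI : I.Sat C) {x : Triple} (h : DMpkTriple C I base tid a x) :
    DMTriple C I base tid x := by
  cases h with
  | dm _ h => exact h
  | repeated As R t₁ t₂ hk hv hne =>
    -- Membership of the two tuples in the relation is hidden in `HasValue`, so it has to be read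
    -- off at some attribute of the nonempty key.
    refine absurd ((hI _ hk).2 t₁ ?_ t₂ ?_ ?_) hne
    · obtain ⟨A, hA⟩ := List.exists_mem_of_ne_nil _ (C.wf _ hk).2.1
      exact (hv A hA).choose_spec.1.1
    · obtain ⟨A, hA⟩ := List.exists_mem_of_ne_nil _ (C.wf _ hk).2.1
      exact (hv A hA).choose_spec.2.1
    · intro A hA
      obtain ⟨v, h1, h2⟩ := hv A hA
      exact h1.2.2.trans h2.2.2.symm
  | null As R A t hk hA hv => exact absurd hv.2.2 ((hI _ hk).1 t hv.1 A hA)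

theorem sat_mem_DMpk (hI : I.Sat C) {x : Triple} :
    x ∈ DMpk base tid a S C I ↔ DMTriple C I base tid x := by
  rw [mem_DMpk]
  exact ⟨sat_artificial hI, .dm _⟩

theorem rowId_mem {t : Tuple} {R : RelName} {x : Node} (h : RowId C I base tid t R x) :
    IsClass C R ∧ t ∈ I.rel R := by
  obtain ⟨h, As, Vs, hk, hv, -⟩ | ⟨h, -, ⟨v, A, hv⟩, -⟩ := h
  · refine ⟨h, ?_⟩
    obtain ⟨A, As', rfl⟩ := List.exists_cons_of_ne_nil (C.wf _ hk).2.1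
    cases hv with
    | cons hv _ => exact hv.1
  · exact ⟨h, hv.1⟩

theorem exists_rowId (hI : I.Sat C) {t : Tuple} {R : RelName} (hR : IsClass C R)
    (ht : t ∈ I.rel R) : ∃ x, RowId C I base tid t R x := by
  by_cases hk : HasPK C R
  · obtain ⟨As, hAs⟩ := hk
    -- The default `[]` is never taken: key attributes are not null in a satisfying instance.
    refine ⟨_, Or.inl ⟨hR, As, As.map fun A => (t A).getD [], hAs, ?_, rfl⟩⟩
    rw [List.forall₂_map_right_iff, List.forall₂_same]
    intro A hA
    refine ⟨ht, (C.wf _ hAs).2.2.2 A hA, ?_⟩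
    have := (hI _ hAs).1 t ht A hA
    cases hv : t A with
    | none => exact absurd hv this
    | some v => simp
  · obtain ⟨A, hA⟩ := S.att_nonempty R hR.1
    exact ⟨_, Or.inr ⟨hR, hk, ⟨_, A, ht, hA, rfl⟩, rfl⟩⟩

/-- With a primary key, the IRI spells the key values, and these determine the tuple. Without one,
the label ends in the identifier, which is injective on tuples with finitely many non-null
attributes. The mixed cases contradict each other on `HasPK`. -/
theorem rowId_unique (htid : IsTupleId tid) (hI : I.Sat C) {t t' : Tuple} {R : RelName} {x : Node}
    (h : RowId C I base tid t R x) (h' : RowId C I base tid t' R x) : t = t' := by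
  have ht := (rowId_mem h).2
  have ht' := (rowId_mem h').2
  obtain ⟨-, As, Vs, hk, hv, hx⟩ | ⟨-, hn, -, hx⟩ := h
  · obtain ⟨-, As', Vs', hk', hv', hx'⟩ | ⟨-, hn', -, hx'⟩ := h'
    · obtain rfl := C.key_unique _ _ _ hk hk'
      obtain rfl : Vs = Vs' := by
        rw [hx] at hx'
        exact rowStr_inj (C.wf _ hk).2.1 hv.length_eq hv'.length_eq (by simpa using hx')
      refine (hI _ hk).2 t ht t' ht' fun A hA => ?_
      obtain ⟨i, hi, rfl⟩ := List.mem_iff_getElem.mp hA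
      have h1 := (List.forall₂_iff_get.mp hv).2 i hi (hv.length_eq ▸ hi)
      have h2 := (List.forall₂_iff_get.mp hv').2 i hi (hv.length_eq ▸ hi)
      exact h1.2.2.trans h2.2.2.symm
    · exact absurd ⟨_, hk⟩ hn'
  · obtain ⟨-, As', Vs', hk', -⟩ | ⟨-, -, -, hx'⟩ := h'
    · exact absurd ⟨_, hk'⟩ hn
    · rw [hx] at hx'
      have hfin : ∀ s ∈ I.rel R, {A | s A ≠ none}.Finite := fun s hs =>
        (S.att R).finite_toSet.subset fun A hA => by
          by_contra hn
          exact hA (I.isOver R s hs A hn)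
      exact htid R (hfin t ht) (hfin t' ht') (List.append_cancel_left (Node.blank.inj hx'))

/-- Model for the `_mem_iff` lemmas below: most rules are refuted by their predicate or by a
reserved name, the others by the shape of the generated strings. -/
theorem dtpDecl_mem_iff (hI : I.Sat C) {A : Attr} {R : RelName} :
    (⟨.iri (.str (dtpStr base A R)), .voc .rdfType, Vocab.owlDatatypeProperty.term⟩ : Triple) ∈
      DMpk base tid a S C I ↔ IsClass C R ∧ A ∈ S.att R := by
  rw [sat_mem_DMpk hI]
  constructor
  · generalize hx : (⟨.iri (.str (dtpStr base A R)), .voc .rdfType,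
      Vocab.owlDatatypeProperty.term⟩ : Triple) = x
    intro h
    cases h with
    | dtpDecl A' R' u h =>
      obtain ⟨h, rfl⟩ := h
      simp only [Triple.mk.injEq, Node.iri.injEq, IRI.str.injEq] at hx
      obtain ⟨rfl, rfl⟩ := dtpStr_inj hx.1
      exact ⟨isClass_of_dtp h, h.1⟩
    | table v A' t R' u w _ _ hw =>
      obtain ⟨-, rfl⟩ := hw
      simp [Vocab.term, Vocab.node] at hx
    | binRef R A B T D U E v₁ v₂ t₁ t₂ t₃ x y p _ _ _ _ _ hp =>
      obtain ⟨-, rfl⟩ := hp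
      simp at hx
    | fkRef Xs Ys T U t₁ t₂ x y p _ _ _ hp =>
      obtain ⟨-, rfl⟩ := hp
      simp at hx
    | _ => simp [Vocab.term, Vocab.node] at hx
  · rintro ⟨h, hA⟩
    exact .dtpDecl A R _ ⟨h.dtp_iff.mpr hA, rfl⟩

theorem binDecl_mem_iff (hI : I.Sat C) {R : RelName} {A B D E : Attr} :
    (⟨.iri (.str (binStr base R A B D E)), .voc .rdfType, Vocab.owlObjectProperty.term⟩ : Triple) ∈
      DMpk base tid a S C I ↔ ∃ T U, BinRel C R A B T D U E := by
  rw [sat_mem_DMpk hI]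
  constructor
  · generalize hx : (⟨.iri (.str (binStr base R A B D E)), .voc .rdfType,
      Vocab.owlObjectProperty.term⟩ : Triple) = x
    intro h
    cases h with
    | binDecl R' A' B' T D' U E' u h =>
      obtain ⟨h, rfl⟩ := h
      simp only [Triple.mk.injEq, Node.iri.injEq, IRI.str.injEq] at hx
      obtain ⟨rfl, rfl, rfl, rfl, rfl⟩ := binStr_inj hx.1
      exact ⟨T, U, h⟩
    | opDecl Xs Ys T U u h =>
      obtain ⟨h, rfl⟩ := h
      simp only [Triple.mk.injEq, Node.iri.injEq, IRI.str.injEq] at hx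
      exact absurd hx.1 binStr_ne_fkStr
    | table v A' t R' u w _ _ hw =>
      obtain ⟨-, rfl⟩ := hw
      simp [Vocab.term, Vocab.node] at hx
    | binRef R A B T D U E v₁ v₂ t₁ t₂ t₃ x y p _ _ _ _ _ hp =>
      obtain ⟨-, rfl⟩ := hp
      simp at hx
    | fkRef Xs Ys T U t₁ t₂ x y p _ _ _ hp =>
      obtain ⟨-, rfl⟩ := hp
      simp at hx
    | _ => simp [Vocab.term, Vocab.node] at hx
  · rintro ⟨T, U, h⟩
    exact .binDecl R A B T D U E _ ⟨h, rfl⟩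

theorem type_mem_iff (hI : I.Sat C) {x : Node} {R : RelName} :
    (⟨x, .voc .rdfType, .node (.iri (.str (classStr base R)))⟩ : Triple) ∈
      DMpk base tid a S C I ↔ ∃ t, RowId C I base tid t R x := by
  rw [sat_mem_DMpk hI]
  constructor
  · generalize hx : (⟨x, .voc .rdfType, .node (.iri (.str (classStr base R)))⟩ : Triple) = z
    intro h
    cases h with
    | table v A' t R' u w _ hu hw =>
      obtain ⟨-, rfl⟩ := hw
      simp only [Triple.mk.injEq, Term.node.injEq, Node.iri.injEq, IRI.str.injEq] at hx
      obtain ⟨rfl, -, h⟩ := hx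
      obtain rfl := classStr_injective base h
      exact ⟨t, hu⟩
    | binRef R A B T D U E v₁ v₂ t₁ t₂ t₃ x y p _ _ _ _ _ hp =>
      obtain ⟨-, rfl⟩ := hp
      simp at hx
    | fkRef Xs Ys T U t₁ t₂ x y p _ _ _ hp =>
      obtain ⟨-, rfl⟩ := hp
      simp at hx
    | _ => simp [Vocab.term, Vocab.node] at hx
  · rintro ⟨t, ht⟩
    obtain ⟨hR, hmem⟩ := rowId_mem ht
    -- The rule `table` asks for some attribute, whether its value is null or not.
    obtain ⟨A, hA⟩ := S.att_nonempty R hR.1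
    exact .table _ A t R x _ ⟨hmem, hA, rfl⟩ ht ⟨hR, rfl⟩

theorem literal_mem_iff (hI : I.Sat C) {x : Node} {A : Attr} {R : RelName} {w : Literal} :
    (⟨x, .str (dtpStr base A R), .lit w⟩ : Triple) ∈ DMpk base tid a S C I ↔
      A ∈ S.att R ∧ ∃ t, RowId C I base tid t R x ∧ t A = some w := by
  rw [sat_mem_DMpk hI]
  constructor
  · generalize hx : (⟨x, .str (dtpStr base A R), .lit w⟩ : Triple) = z
    intro h
    cases h with
    | literal A' R' t w' y p hv hy hp =>
      obtain ⟨-, rfl⟩ := hp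
      simp only [Triple.mk.injEq, Term.lit.injEq, IRI.str.injEq] at hx
      obtain ⟨rfl, h, rfl⟩ := hx
      obtain ⟨rfl, rfl⟩ := dtpStr_inj h
      exact ⟨hv.2.1, t, hy, hv.2.2⟩
    | _ => simp [Vocab.term, Vocab.node] at hx
  · rintro ⟨hA, t, ht, hw⟩
    obtain ⟨hR, hmem⟩ := rowId_mem ht
    exact .literal A R t w x _ ⟨hmem, hA, hw⟩ ht ⟨hR.dtp_iff.mpr hA, rfl⟩

/-- The rule equates optional values, so two nulls would match too. The equalities keep that form;
actual values come later from literal triples or from the key of `R`. -/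
theorem binRef_mem_iff (hI : I.Sat C) {R : RelName} {A B D E : Attr} {x y : Node} :
    (⟨x, .str (binStr base R A B D E), .node y⟩ : Triple) ∈ DMpk base tid a S C I ↔
      ∃ T U, BinRel C R A B T D U E ∧ ∃ t ∈ I.rel R, ∃ t₁ t₂, t A = t₁ D ∧ t B = t₂ E ∧
        RowId C I base tid t₁ T x ∧ RowId C I base tid t₂ U y := by
  rw [sat_mem_DMpk hI]
  constructor
  · generalize hx : (⟨x, .str (binStr base R A B D E), .node y⟩ : Triple) = z
    intro h
    cases h with
    | binRef R' A' B' T D' U E' v₁ v₂ t₁ t₂ t₃ x y p h₁ h₂ h₃ h₄ hx' hp hy' =>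
      obtain ⟨h, rfl⟩ := hp
      simp only [Triple.mk.injEq, Term.node.injEq, IRI.str.injEq] at hx
      obtain ⟨rfl, hx, rfl⟩ := hx
      obtain ⟨rfl, rfl, rfl, rfl, rfl⟩ := binStr_inj hx
      exact ⟨T, U, h, t₁, h₁.1, t₂, t₃, h₁.2.2.trans h₂.2.2.symm, h₃.2.2.trans h₄.2.2.symm, hx',
        hy'⟩
    | fkRef Xs Ys T U t₁ t₂ x y p _ _ _ hp =>
      obtain ⟨-, rfl⟩ := hp
      simp only [Triple.mk.injEq, IRI.str.injEq] at hx
      exact absurd hx.2.1 binStr_ne_fkStr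
    | _ => simp [Vocab.term, Vocab.node] at hx
  · rintro ⟨T, U, h, t, ht, t₁, t₂, hA, hB, hx, hy⟩
    have hmem : A ∈ S.att R ∧ B ∈ S.att R := by simp [h.att_eq]
    exact .binRef R A B T D U E (t A) (t B) t t₁ t₂ x y _ ⟨ht, hmem.1, rfl⟩
      ⟨(rowId_mem hx).2, h.mem_left, hA.symm⟩ ⟨ht, hmem.2, rfl⟩
      ⟨(rowId_mem hy).2, h.mem_right, hB.symm⟩ hx ⟨h, rfl⟩ hy

/-- The IRI of a binary relation does not contain `T`; the domain triple is the place from which `T`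
is recovered. -/
theorem binDomain_mem_iff (hI : I.Sat C) {R T : RelName} {A B D E : Attr} :
    (⟨.iri (.str (binStr base R A B D E)), .voc .rdfsDomain,
      .node (.iri (.str (classStr base T)))⟩ : Triple) ∈ DMpk base tid a S C I ↔
      ∃ U, BinRel C R A B T D U E := by
  rw [sat_mem_DMpk hI]
  constructor
  · generalize hx : (⟨.iri (.str (binStr base R A B D E)), .voc .rdfsDomain,
      .node (.iri (.str (classStr base T)))⟩ : Triple) = z
    intro h
    cases h with
    | binDomain R' A' B' T' D' U E' u w hu hw =>
      obtain ⟨h, rfl⟩ := hu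
      obtain ⟨-, rfl⟩ := hw
      simp only [Triple.mk.injEq, Term.node.injEq, Node.iri.injEq, IRI.str.injEq] at hx
      obtain ⟨rfl, rfl, rfl, rfl, rfl⟩ := binStr_inj hx.1
      obtain rfl := classStr_injective base hx.2.2
      exact ⟨U, h⟩
    | opDomain Xs Ys T' U u w hu hw =>
      obtain ⟨-, rfl⟩ := hu
      simp only [Triple.mk.injEq, Node.iri.injEq, IRI.str.injEq] at hx
      exact absurd hx.1 binStr_ne_fkStr
    | dtpDomain A' R' u w hu hw =>
      obtain ⟨-, rfl⟩ := hu
      simp only [Triple.mk.injEq, Node.iri.injEq, IRI.str.injEq] at hx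
      exact absurd hx.1 binStr_ne_dtpStr
    | binRef R A B T D U E v₁ v₂ t₁ t₂ t₃ x y p _ _ _ _ _ hp =>
      obtain ⟨-, rfl⟩ := hp
      simp at hx
    | fkRef Xs Ys T U t₁ t₂ x y p _ _ _ hp =>
      obtain ⟨-, rfl⟩ := hp
      simp at hx
    | _ => simp [Vocab.term, Vocab.node] at hx
  · rintro ⟨U, h⟩
    exact .binDomain R A B T D U E _ _ ⟨h, rfl⟩ ⟨h.isClass_left, rfl⟩

theorem binRange_mem_iff (hI : I.Sat C) {R U : RelName} {A B D E : Attr} :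
    (⟨.iri (.str (binStr base R A B D E)), .voc .rdfsRange,
      .node (.iri (.str (classStr base U)))⟩ : Triple) ∈ DMpk base tid a S C I ↔
      ∃ T, BinRel C R A B T D U E := by
  rw [sat_mem_DMpk hI]
  constructor
  · generalize hx : (⟨.iri (.str (binStr base R A B D E)), .voc .rdfsRange,
      .node (.iri (.str (classStr base U)))⟩ : Triple) = z
    intro h
    cases h with
    | binRange R' A' B' T D' U' E' u w hu hw =>
      obtain ⟨h, rfl⟩ := hu
      obtain ⟨-, rfl⟩ := hw
      simp only [Triple.mk.injEq, Term.node.injEq, Node.iri.injEq, IRI.str.injEq] at hx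
      obtain ⟨rfl, rfl, rfl, rfl, rfl⟩ := binStr_inj hx.1
      obtain rfl := classStr_injective base hx.2.2
      exact ⟨T, h⟩
    | opRange Xs Ys T' U u w hu hw =>
      obtain ⟨-, rfl⟩ := hu
      simp only [Triple.mk.injEq, Node.iri.injEq, IRI.str.injEq] at hx
      exact absurd hx.1 binStr_ne_fkStr
    | binRef R A B T D U E v₁ v₂ t₁ t₂ t₃ x y p _ _ _ _ _ hp =>
      obtain ⟨-, rfl⟩ := hp
      simp at hx
    | fkRef Xs Ys T U t₁ t₂ x y p _ _ _ hp =>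
      obtain ⟨-, rfl⟩ := hp
      simp at hx
    | _ => simp [Vocab.term, Vocab.node] at hx
  · rintro ⟨T, h⟩
    exact .binRange R A B T D U E _ _ ⟨h, rfl⟩ ⟨h.isClass_right, rfl⟩

end Graph

/-! ### Monotonicity -/

section Monotone

variable {S : Schema} {C : Constraints S} {I J : Instance S} {base : Str}
  {tid : RelName → Tuple → Str} {a : IRI}

theorem Instance.Sub.hasValue (h : I.Sub J) {v A t R} (hv : HasValue I v A t R) :
    HasValue J v A t R :=
  ⟨h R (mem_rels_of_mem_att hv.2.1) hv.1, hv.2⟩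

theorem Instance.Sub.rowId (h : I.Sub J) {t R x} (hx : RowId C I base tid t R x) :
    RowId C J base tid t R x := by
  obtain ⟨hR, As, Vs, hk, hv, hx⟩ | ⟨hR, hn, ⟨v, A, hv⟩, hx⟩ := hx
  · exact Or.inl ⟨hR, As, Vs, hk, hv.imp fun _ _ => h.hasValue, hx⟩
  · exact Or.inr ⟨hR, hn, ⟨v, A, h.hasValue hv⟩, hx⟩

/-- The negations in the rules (`¬ IsBinRel`, `¬ HasPK`, the conditions of `BinRel`) concern only
`S` and `C`; the instance enters through `HasValue` alone, which is monotone. -/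
theorem Instance.Sub.dmTriple (h : I.Sub J) {x : Triple} (hx : DMTriple C I base tid x) :
    DMTriple C J base tid x := by
  cases hx with
  | classDecl R u hu => exact .classDecl R u hu
  | binDecl R A B T D U E u hu => exact .binDecl R A B T D U E u hu
  | opDecl Xs Ys T U u hu => exact .opDecl Xs Ys T U u hu
  | binDomain R A B T D U E u w hu hw => exact .binDomain R A B T D U E u w hu hw
  | opDomain Xs Ys T U u w hu hw => exact .opDomain Xs Ys T U u w hu hw
  | binRange R A B T D U E u w hu hw => exact .binRange R A B T D U E u w hu hw
  | opRange Xs Ys T U u w hu hw => exact .opRange Xs Ys T U u w hu hw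
  | dtpDecl A R u hu => exact .dtpDecl A R u hu
  | dtpDomain A R u w hu hw => exact .dtpDomain A R u w hu hw
  | table v A t R u w hv hu hw => exact .table v A t R u w (h.hasValue hv) (h.rowId hu) hw
  | binRef R A B T D U E v₁ v₂ t₁ t₂ t₃ x y p h₁ h₂ h₃ h₄ hx hp hy =>
    exact .binRef R A B T D U E v₁ v₂ t₁ t₂ t₃ x y p (h.hasValue h₁) (h.hasValue h₂)
      (h.hasValue h₃) (h.hasValue h₄) (h.rowId hx) hp (h.rowId hy)
  | fkRef Xs Ys T U t₁ t₂ x y p hv hx hy hp =>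
    exact .fkRef Xs Ys T U t₁ t₂ x y p
      (hv.imp fun _ _ ⟨v, h₁, h₂⟩ => ⟨v, h.hasValue h₁, h.hasValue h₂⟩) (h.rowId hx) (h.rowId hy) hp
  | literal A R t w x p hv hx hp => exact .literal A R t w x p (h.hasValue hv) (h.rowId hx) hp

theorem Instance.Sub.dmpkTriple (h : I.Sub J) {x : Triple} (hx : DMpkTriple C I base tid a x) :
    DMpkTriple C J base tid a x := by
  cases hx with
  | dm _ hx => exact .dm _ (h.dmTriple hx)
  | repeated As R t₁ t₂ hk hv hne =>
    exact .repeated As R t₁ t₂ hk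
      (fun A hA => (hv A hA).imp fun v hv => ⟨h.hasValue hv.1, h.hasValue hv.2⟩) hne
  | null As R A t hk hA hv => exact .null As R A t hk hA (h.hasValue hv)

end Monotone

theorem monotoneMapping_DMpk (base : Str) (tid : RelName → Tuple → Str) (a : IRI) :
    MonotoneMapping (DMpk base tid a) := by
  intro S C I J h x hx
  rw [mem_DMpk] at hx ⊢
  exact h.dmpkTriple hx

/-! ### Consistency -/

/-- The one-point interpretation in which every class but `owl:Nothing` and every property but the
bottom properties is full. -/
def fullInterp : Interp where
  Obj := Unit
  nonempty := ⟨()⟩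
  Dat := Literal
  lit := id
  lit_injective := fun _ _ h => h
  ind _ := ()
  cls n := {_u | n ≠ Vocab.owlNothing.node}
  op n _ _ := n ≠ Vocab.owlBottomObjectProperty.node
  dp n _ _ := n ≠ Vocab.owlBottomDataProperty.node
  rng _ := Set.univ

/-- The triples that the mapping generates if there are only satisfied primary keys: declarations and
domains of data type properties, types, and literals. -/
def IsTableTriple (x : Triple) : Prop :=
  (x.pred = .voc .rdfType ∧ (x.obj = Vocab.owlClass.term ∨
    x.obj = Vocab.owlDatatypeProperty.term ∨ ∃ s, x.obj = .node (.iri (.str s)))) ∨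
  ((∃ s, x.subj = .iri (.str s)) ∧ x.pred = .voc .rdfsDomain ∧ ∃ s, x.obj = .node (.iri (.str s))) ∨
  ((∃ s, x.pred = .str s) ∧ ∃ w, x.obj = .lit w)

/-- Apart from the built-in names, nearly every clause is triggered by a reserved predicate other
than `rdf:type` and `rdfs:domain`, or by a type that does not occur, and is vacuous. What remains
are assertions and domains. Their positive conclusions hold since the generated names are neither
`owl:Nothing` nor bottom properties. -/
theorem fullInterp_models {G : RDFGraph} (hG : ∀ x ∈ G, IsTableTriple x) :
    fullInterp.Models G := by
  have hv : ∀ {n v o}, (⟨n, .voc v, o⟩ : Triple) ∈ G → v ≠ .rdfType → v ≠ .rdfsDomain → False := by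
    intro n v o h h1 h2
    rcases hG _ h with ⟨h, -⟩ | ⟨-, h, -⟩ | ⟨⟨s, h⟩, -⟩ <;> simp_all
  have ht : ∀ {n v}, (⟨n, .voc .rdfType, Vocab.term v⟩ : Triple) ∈ G →
      v ≠ .owlClass → v ≠ .owlDatatypeProperty → False := by
    intro n v h h1 h2
    rcases hG _ h with ⟨-, h | h | ⟨s, h⟩⟩ | ⟨-, h, -⟩ | ⟨⟨s, h⟩, -⟩ <;>
      simp_all [Vocab.term, Vocab.node]
  have hstr : ∀ s, Node.iri (.str s) ≠ Vocab.owlNothing.node := by simp [Vocab.node]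
  refine
    { thing := by simp [fullInterp, Vocab.node]
      nothing := Set.eq_empty_of_forall_notMem fun _ hu => hu rfl
      topOp := by simp [fullInterp, Vocab.node]
      bottomOp := by simp [fullInterp]
      topDp := by simp [fullInterp, Vocab.node]
      bottomDp := by simp [fullInterp]
      literal := rfl
      classAssertion := ?_
      opAssertion := ?_
      dpAssertion := ?_
      negOpAssertion := fun _ _ _ _ h => (hv h (by simp) (by simp)).elim
      negDpAssertion := fun _ _ _ _ h => (hv h (by simp) (by simp)).elim
      sameAs := fun _ _ h => (hv h (by simp) (by simp)).elim
      differentFrom := fun _ _ h => (hv h (by simp) (by simp)).elim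
      allDifferent := fun _ _ _ h => (ht h (by simp) (by simp)).elim
      intersectionOf := fun _ _ _ h => (hv h (by simp) (by simp)).elim
      unionOf := fun _ _ _ h => (hv h (by simp) (by simp)).elim
      complementOf := fun _ _ h => (hv h (by simp) (by simp)).elim
      oneOf := fun _ _ _ h => (hv h (by simp) (by simp)).elim
      someValuesFrom := fun _ _ _ h => (hv h (by simp) (by simp)).elim
      allValuesFrom := fun _ _ _ h => (hv h (by simp) (by simp)).elim
      opHasValue := fun _ _ _ h => (hv h (by simp) (by simp)).elim
      dpHasValue := fun _ _ _ h => (hv h (by simp) (by simp)).elim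
      hasSelf := fun _ _ h => (hv h (by simp) (by simp)).elim
      cardinality := fun _ _ _ _ h => (hv h (by simp) (by simp)).elim
      opQualifiedCardinality := fun _ _ _ _ _ h => (hv h (by simp) (by simp)).elim
      dpQualifiedCardinality := fun _ _ _ _ _ h => (hv h (by simp) (by simp)).elim
      subClassOf := fun _ _ h => (hv h (by simp) (by simp)).elim
      equivalentClass := fun _ _ h => (hv h (by simp) (by simp)).elim
      disjointWith := fun _ _ h => (hv h (by simp) (by simp)).elim
      disjointUnionOf := fun _ _ _ h => (hv h (by simp) (by simp)).elim
      allDisjointClasses := fun _ _ _ h => (ht h (by simp) (by simp)).elim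
      hasKey := fun _ _ _ h => (hv h (by simp) (by simp)).elim
      domain := ?_
      range := fun _ _ h => (hv h (by simp) (by simp)).elim
      subPropertyOf := fun _ _ h => (hv h (by simp) (by simp)).elim
      equivalentProperty := fun _ _ h => (hv h (by simp) (by simp)).elim
      propertyDisjointWith := fun _ _ h => (hv h (by simp) (by simp)).elim
      allDisjointProperties := fun _ _ _ h => (ht h (by simp) (by simp)).elim
      inverseOf := fun _ _ h => (hv h (by simp) (by simp)).elim
      propertyChain := fun _ _ _ h => (hv h (by simp) (by simp)).elim
      functional := fun _ h => (ht h (by simp) (by simp)).elim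
      inverseFunctional := fun _ h => (ht h (by simp) (by simp)).elim
      reflexive := fun _ h => (ht h (by simp) (by simp)).elim
      irreflexive := fun _ h => (ht h (by simp) (by simp)).elim
      symmetric := fun _ h => (ht h (by simp) (by simp)).elim
      asymmetric := fun _ h => (ht h (by simp) (by simp)).elim
      transitive := fun _ h => (ht h (by simp) (by simp)).elim }
  · intro x c h hc
    rcases hG _ h with ⟨-, h | h | ⟨s, h⟩⟩ | ⟨-, h, -⟩ | ⟨⟨s, h⟩, -⟩
    · obtain rfl : c = Vocab.owlClass.node := by simpa [Vocab.term] using h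
      simp [IsClassNode, Vocab.node] at hc
    · obtain rfl : c = Vocab.owlDatatypeProperty.node := by simpa [Vocab.term] using h
      simp [IsClassNode, Vocab.node] at hc
    · obtain rfl : c = .iri (.str s) := by simpa using h
      exact hstr s
    · simp at h
    · simp at h
  · intro x p y h hp _
    rcases hG _ h with ⟨h, -⟩ | ⟨-, h, -⟩ | ⟨-, w, h⟩
    · obtain rfl : p = .voc .rdfType := h
      simp [IsAssertionPred] at hp
    · obtain rfl : p = .voc .rdfsDomain := h
      simp [IsAssertionPred] at hp
    · simp at h
  · intro x p y h hp
    rcases hG _ h with ⟨h, -⟩ | ⟨-, h, -⟩ | ⟨⟨s, h⟩, w, -⟩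
    · obtain rfl : p = .voc .rdfType := h
      simp [IsAssertionPred] at hp
    · obtain rfl : p = .voc .rdfsDomain := h
      simp [IsAssertionPred] at hp
    · obtain rfl : p = .str s := h
      simp [fullInterp, Vocab.node]
  · intro p c h
    rcases hG _ h with ⟨h, -⟩ | ⟨-, -, s, h⟩ | ⟨⟨s, h⟩, -⟩
    · simp at h
    · obtain rfl : c = .iri (.str s) := by simpa using h
      exact ⟨fun _ _ _ _ => hstr s, fun _ _ _ _ => hstr s⟩
    · simp at h

/-! ### The generated graph when there are only primary keys. -/

section Keys

variable {S : Schema} {C : Constraints S} {I : Instance S} {base : Str}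
  {tid : RelName → Tuple → Str} {a : IRI}

theorem Constraints.OnlyKeys.not_fk (hC : C.OnlyKeys) {As R Bs T} : ¬ FK C As R Bs T := by
  intro h
  obtain ⟨R', As', h⟩ := hC _ h
  simp at h

/-- Both sorts of object properties, including binary relations, need a foreign key, so every rule
that mentions one is void. -/
theorem Constraints.OnlyKeys.isTableTriple (hC : C.OnlyKeys) {x : Triple}
    (h : DMTriple C I base tid x) : IsTableTriple x := by
  have hb : ∀ {R A B T D U E p}, ¬ BinIRI C base R A B T D U E p := fun h => hC.not_fk h.1.fkA
  have ho : ∀ {Xs Ys T U p}, ¬ ObjPIRI C base Xs Ys T U p := fun h => hC.not_fk h.1.1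
  cases h with
  | classDecl R u hu => exact Or.inl ⟨rfl, Or.inl rfl⟩
  | binDecl R A B T D U E u hu => exact (hb hu).elim
  | opDecl Xs Ys T U u hu => exact (ho hu).elim
  | binDomain R A B T D U E u w hu hw => exact (hb hu).elim
  | opDomain Xs Ys T U u w hu hw => exact (ho hu).elim
  | binRange R A B T D U E u w hu hw => exact (hb hu).elim
  | opRange Xs Ys T U u w hu hw => exact (ho hu).elim
  | dtpDecl A R u hu => exact Or.inl ⟨rfl, Or.inr (Or.inl rfl)⟩
  | dtpDomain A R u w hu hw =>
    obtain ⟨-, rfl⟩ := hu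
    obtain ⟨-, rfl⟩ := hw
    exact Or.inr (Or.inl ⟨⟨_, rfl⟩, rfl, _, rfl⟩)
  | table v A t R u w hv hu hw =>
    obtain ⟨-, rfl⟩ := hw
    exact Or.inl ⟨rfl, Or.inr (Or.inr ⟨_, rfl⟩)⟩
  | binRef R A B T D U E v₁ v₂ t₁ t₂ t₃ x y p h₁ h₂ h₃ h₄ hx hp hy => exact (hb hp).elim
  | fkRef Xs Ys T U t₁ t₂ x y p hv hx hy hp => exact (ho hp).elim
  | literal A R t w x p hv hx hp =>
    obtain ⟨-, rfl⟩ := hp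
    exact Or.inr (Or.inr ⟨⟨_, rfl⟩, _, rfl⟩)

theorem Constraints.OnlyKeys.differentFrom_mem (hC : C.OnlyKeys) (h : ¬ I.Sat C) :
    (⟨.iri a, .voc .owlDifferentFrom, .node (.iri a)⟩ : Triple) ∈ DMpk base tid a S C I := by
  rw [mem_DMpk]
  simp only [Instance.Sat, not_forall] at h
  obtain ⟨c, hc, h⟩ := h
  obtain ⟨R, As, rfl⟩ := hC c hc
  have hatt := (C.wf _ hc).2.2.2
  by_cases hn : ∀ t ∈ I.rel R, ∀ A ∈ As, t A ≠ none
  · have h' : ¬ ∀ t₁ ∈ I.rel R, ∀ t₂ ∈ I.rel R, (∀ A ∈ As, t₁ A = t₂ A) → t₁ = t₂ :=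
      fun h' => h ⟨hn, h'⟩
    push Not at h'
    obtain ⟨t₁, h₁, t₂, h₂, heq, hne⟩ := h'
    exact .repeated As R t₁ t₂ hc
      (fun A hA => ⟨_, ⟨h₁, hatt A hA, rfl⟩, ⟨h₂, hatt A hA, (heq A hA).symm⟩⟩) hne
  · push Not at hn
    obtain ⟨t, ht, A, hA, hv⟩ := hn
    exact .null As R A t hc hA ⟨ht, hatt A hA, hv⟩

end Keys

theorem semanticsPreservingForKeys_DMpk (base : Str) (tid : RelName → Tuple → Str) (a : IRI) :
    SemanticsPreservingForKeys (DMpk base tid a) := by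
  intro S C hC I
  constructor
  · intro hI
    exact ⟨fullInterp, fullInterp_models fun x hx => hC.isTableTriple ((sat_mem_DMpk hI).mp hx)⟩
  · rintro ⟨M, hM⟩
    by_contra h
    exact hM.differentFrom _ _ (hC.differentFrom_mem h) rfl

/-! ### Descriptions of instances -/

theorem TupleCode.unique {l : List (Attr × Value)} {t t' : Tuple} (h : TupleCode l t)
    (h' : TupleCode l t') : t = t' := by
  funext A
  refine Option.ext fun v => ?_
  exact (h A v).trans (h' A v).symm

theorem Schema.ext' {S S' : Schema} (h₁ : S.rels = S'.rels) (h₂ : S.att = S'.att) : S = S' := by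
  cases S
  cases S'
  subst h₁ h₂
  rfl

/-- To compare the decoded instance with the original one it is thus enough that a single code
describes both. -/
theorem DBCode.Describes.unique {d : DBCode} {D D' : DBInstance} (h : d.Describes D)
    (h' : d.Describes D') : D = D' := by
  obtain ⟨S, I⟩ := D
  obtain ⟨S', I'⟩ := D'
  obtain rfl : S = S' := by
    refine Schema.ext' (Finset.ext fun R => (h.rels R).trans (h'.rels R).symm) ?_
    exact funext fun R => Finset.ext fun A => (h.att R A).trans (h'.att R A).symm
  have hI : I.rel = I'.rel :=
    funext fun R => Set.ext fun t => (h.tuples R t).trans (h'.tuples R t).symm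
  cases I
  cases I'
  subst hI
  rfl

/-- The decoder must give an instance on arbitrary graphs as well. The two hypotheses supply
nonempty attribute sets and tuples that stay within their attributes; finiteness comes from the
finite list of codes. -/
theorem DBCode.exists_describes (d : DBCode) (hne : ∀ e ∈ d, e.2.1 ≠ [])
    (hover : ∀ R A, ∀ t : Tuple, (∃ e ∈ d, e.1 = R ∧ ∃ l ∈ e.2.2, TupleCode l t) → t A ≠ none →
      ∃ e ∈ d, e.1 = R ∧ A ∈ e.2.1) : ∃ D, d.Describes D := by
  have hatt : ∀ R A, A ∈ ((d.filter (·.1 = R)).flatMap (·.2.1)).toFinset ↔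
      ∃ e ∈ d, e.1 = R ∧ A ∈ e.2.1 := by
    intro R A
    simp [and_assoc]
  have hrels : ∀ R, R ∈ (d.map Prod.fst).toFinset ↔ ∃ e ∈ d, e.1 = R := by
    intro R
    simp
  let S : Schema :=
    { rels := (d.map Prod.fst).toFinset
      att := fun R => ((d.filter (·.1 = R)).flatMap (·.2.1)).toFinset
      att_nonempty := by
        intro R hR
        obtain ⟨e, he, heR⟩ := (hrels R).mp hR
        obtain ⟨A, hA⟩ := List.exists_mem_of_ne_nil _ (hne e he)
        exact ⟨A, (hatt R A).mpr ⟨e, he, heR, hA⟩⟩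
      att_eq_empty := by
        intro R hR
        refine Finset.eq_empty_of_forall_notMem fun A hA => hR ?_
        obtain ⟨e, he, heR, -⟩ := (hatt R A).mp hA
        exact (hrels R).mpr ⟨e, he, heR⟩ }
  let I : Instance S :=
    { rel := fun R => {t | ∃ e ∈ d, e.1 = R ∧ ∃ l ∈ e.2.2, TupleCode l t}
      finite := by
        intro R
        -- Each code describes at most one tuple.
        have : (⋃ l ∈ (d.flatMap (·.2.2)).toFinset, {t | TupleCode l t}).Finite :=
          (Finset.finite_toSet _).biUnion fun l _ =>
            Set.Subsingleton.finite fun t ht t' ht' => TupleCode.unique ht ht'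
        refine this.subset ?_
        rintro t ⟨e, he, -, l, hl, ht⟩
        refine Set.mem_biUnion (x := l) ?_ ht
        simp only [List.coe_toFinset, List.mem_flatMap, Set.mem_ofPred_eq]
        exact ⟨e, he, hl⟩
      isOver := by
        intro R t ht A hA
        by_contra hn
        exact hA ((hatt R A).mpr (hover R A t ht hn))
      rel_eq_empty := by
        intro R hR
        refine Set.eq_empty_of_forall_notMem ?_
        rintro t ⟨e, he, heR, -⟩
        exact hR ((hrels R).mpr ⟨e, he, heR⟩) }
  exact ⟨⟨S, I⟩, hrels, hatt, fun _ _ => Iff.rfl⟩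

/-! ### Reading an instance off a graph -/

/-- The word of the ordinary characters of a string. -/
def unstr (s : Str) : Word := s.flatMap fun
  | .ch n => [n]
  | _ => []

@[simp] theorem unstr_str (x : Word) : unstr (Word.str x) = x := by
  induction x with
  | nil => rfl
  | cons n x ih =>
    simp only [unstr, Word.str, List.map_cons, List.flatMap_cons] at ih ⊢
    rw [ih]
    rfl

/-- The default values of this reader and the next two are harmless: what is read is kept only if
the triple rebuilt from it is the given one. -/
def Node.iriStr : Node → Str
  | .iri (.str s) => s
  | _ => []

def Term.toNode : Term → Node
  | .node n => n
  | .lit _ => .blank []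

def Term.toLit : Term → Literal
  | .node _ => []
  | .lit w => w

section Decode

variable (base : Str)

def dtpDeclTriple (A : Attr) (R : RelName) : Triple :=
  ⟨.iri (.str (dtpStr base A R)), .voc .rdfType, Vocab.owlDatatypeProperty.term⟩

def binDeclTriple (R : RelName) (A B D E : Attr) : Triple :=
  ⟨.iri (.str (binStr base R A B D E)), .voc .rdfType, Vocab.owlObjectProperty.term⟩

def typeTriple (x : Node) (R : RelName) : Triple :=
  ⟨x, .voc .rdfType, .node (.iri (.str (classStr base R)))⟩

def valueTriple (x : Node) (A : Attr) (R : RelName) (w : Literal) : Triple :=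
  ⟨x, .str (dtpStr base A R), .lit w⟩

def refTriple (x y : Node) (R : RelName) (A B D E : Attr) : Triple :=
  ⟨x, .str (binStr base R A B D E), .node y⟩

def domainTriple (R : RelName) (A B D E : Attr) (T : RelName) : Triple :=
  ⟨.iri (.str (binStr base R A B D E)), .voc .rdfsDomain, .node (.iri (.str (classStr base T)))⟩

def rangeTriple (R : RelName) (A B D E : Attr) (U : RelName) : Triple :=
  ⟨.iri (.str (binStr base R A B D E)), .voc .rdfsRange, .node (.iri (.str (classStr base U)))⟩

/-- The relation name and the attribute in the IRI of a data type property. -/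
def parseDtp (s : Str) : RelName × Attr :=
  (unstr (before .hash (s.drop base.length)), unstr (after .hash (s.drop base.length)))

/-- The relation name and the attributes in the IRI of a binary relation. -/
def parseBin (s : Str) : RelName × Attr × Attr × Attr × Attr :=
  let s₀ := s.drop base.length
  let s₁ := after .hash s₀
  let s₂ := after .comma s₁
  let s₃ := after .comma s₂
  (unstr (before .hash s₀), unstr (before .comma s₁), unstr (before .comma s₂),
    unstr (before .comma s₃), unstr (after .comma s₃))

theorem parseDtp_dtpStr (A : Attr) (R : RelName) : parseDtp base (dtpStr base A R) = (R, A) := by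
  simp [parseDtp, dtpStr_eq, before_append, after_append]

theorem parseBin_binStr (R : RelName) (A B D E : Attr) :
    parseBin base (binStr base R A B D E) = (R, A, B, D, E) := by
  simp [parseBin, binStr_eq, before_append, after_append]

/-- The elements `g x` for the elements `x` of `l` with `u x = v x`. -/
def gather {α β γ : Type} [DecidableEq γ] (u v : α → γ) (g : α → β) (l : List α) : List β :=
  l.flatMap fun x => if u x = v x then [g x] else []

theorem mem_gather {α β γ : Type} [DecidableEq γ] {u v : α → γ} {g : α → β} {l : List α} {y : β} :
    y ∈ gather u v g l ↔ ∃ x ∈ l, u x = v x ∧ g x = y := by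
  simp only [gather, List.mem_flatMap]
  refine exists_congr fun x => and_congr_right fun _ => ?_
  split_ifs with h <;> simp [h, eq_comm]

/-- The declared attributes of classes. -/
def attDecls (l : List Triple) : List (RelName × Attr) :=
  gather id (fun x => dtpDeclTriple base (parseDtp base x.subj.iriStr).2
    (parseDtp base x.subj.iriStr).1) (fun x => parseDtp base x.subj.iriStr) l

/-- The declared binary relations. -/
def binDecls (l : List Triple) : List (RelName × Attr × Attr × Attr × Attr) :=
  gather id (fun x =>
    let q := parseBin base x.subj.iriStr
    binDeclTriple base q.1 q.2.1 q.2.2.1 q.2.2.2.1 q.2.2.2.2)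
    (fun x => parseBin base x.subj.iriStr) l

/-- The values of the declared attributes at the nodes. -/
def nodeValues (l : List Triple) : List ((RelName × Attr) × (Node × Literal)) :=
  gather Prod.snd (fun p => valueTriple base p.2.subj p.1.2 p.1.1 p.2.obj.toLit)
    (fun p => (p.1, (p.2.subj, p.2.obj.toLit))) ((attDecls base l).product l)

/-- The nodes of the tuples of the classes, with a declared attribute. -/
def nodeRows (l : List Triple) : List ((RelName × Attr) × Node) :=
  gather Prod.snd (fun p => typeTriple base p.2.subj p.1.1) (fun p => (p.1, p.2.subj))
    ((attDecls base l).product l)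

/-- The code of the tuple of `r.1.1` at the node `r.2`. -/
def rowCode (l : List Triple) (r : (RelName × Attr) × Node) : List (Attr × Value) :=
  gather (fun v => (v.1.1, v.2.1)) (fun _ => (r.1.1, r.2)) (fun v => (v.1.2, v.2.2))
    (nodeValues base l)

/-- The tuples of binary relations. -/
def binRows (l : List Triple) : DBCode :=
  gather
    (fun p => ((p.1.1.2, p.1.2.1, p.1.2.2), (p.2.1.1.2, p.2.1.2.1), (p.2.2.1.2, p.2.2.2.1)))
    (fun p =>
      let q := p.1.1.1
      ((refTriple base p.1.1.2.subj p.1.1.2.obj.toNode q.1 q.2.1 q.2.2.1 q.2.2.2.1 q.2.2.2.2,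
        domainTriple base q.1 q.2.1 q.2.2.1 q.2.2.2.1 q.2.2.2.2 p.2.1.1.1,
        rangeTriple base q.1 q.2.1 q.2.2.1 q.2.2.2.1 q.2.2.2.2 p.2.2.1.1),
        (q.2.2.2.1, p.1.1.2.subj), (q.2.2.2.2, p.1.1.2.obj.toNode)))
    (fun p =>
      let q := p.1.1.1
      (q.1, [q.2.1, q.2.2.1], [[(q.2.1, p.2.1.2.2), (q.2.2.1, p.2.2.2.2)]]))
    ((((binDecls base l).product l).product (l.product l)).product
      ((nodeValues base l).product (nodeValues base l)))

/-- The description of the instance read off the list of the triples of a graph. -/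
def decodeGraph (l : List Triple) : DBCode :=
  (attDecls base l).map (fun q => (q.1, [q.2], [])) ++
    ((nodeRows base l).map (fun r => (r.1.1, [r.1.2], [rowCode base l r])) ++
      ((binDecls base l).map (fun q => (q.1, [q.2.1, q.2.2.1], [])) ++ binRows base l))

variable {base}

/-- Parse, rebuild, compare: the comparison makes every accepted entry genuine, and
`parseDtp_dtpStr` makes every genuine declaration accepted. -/
theorem mem_attDecls {l : List Triple} {R : RelName} {A : Attr} :
    (R, A) ∈ attDecls base l ↔ dtpDeclTriple base A R ∈ l := by
  rw [attDecls, mem_gather]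
  constructor
  · rintro ⟨x, hx, h, hq⟩
    rw [hq] at h
    exact h ▸ hx
  · intro h
    refine ⟨_, h, ?_, ?_⟩ <;> simp [dtpDeclTriple, Node.iriStr, parseDtp_dtpStr]

theorem mem_binDecls {l : List Triple} {R : RelName} {A B D E : Attr} :
    (R, A, B, D, E) ∈ binDecls base l ↔ binDeclTriple base R A B D E ∈ l := by
  rw [binDecls, mem_gather]
  constructor
  · rintro ⟨x, hx, h, hq⟩
    simp only [hq] at h
    exact h ▸ hx
  · intro h
    refine ⟨_, h, ?_, ?_⟩ <;> simp [binDeclTriple, Node.iriStr, parseBin_binStr]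

theorem mem_nodeValues {l : List Triple} {R : RelName} {A : Attr} {x : Node} {w : Literal} :
    ((R, A), (x, w)) ∈ nodeValues base l ↔
      dtpDeclTriple base A R ∈ l ∧ valueTriple base x A R w ∈ l := by
  rw [nodeValues, mem_gather]
  constructor
  · rintro ⟨⟨q, y⟩, hm, h, hq⟩
    simp only [Prod.mk.injEq] at hq h
    obtain ⟨rfl, rfl, rfl⟩ := hq
    rw [List.pair_mem_product, mem_attDecls] at hm
    exact ⟨hm.1, h ▸ hm.2⟩
  · rintro ⟨h₁, h₂⟩
    exact ⟨((R, A), valueTriple base x A R w),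
      List.pair_mem_product.mpr ⟨mem_attDecls.mpr h₁, h₂⟩, rfl, rfl⟩

theorem mem_nodeRows {l : List Triple} {R : RelName} {A : Attr} {x : Node} :
    ((R, A), x) ∈ nodeRows base l ↔ dtpDeclTriple base A R ∈ l ∧ typeTriple base x R ∈ l := by
  rw [nodeRows, mem_gather]
  constructor
  · rintro ⟨⟨q, y⟩, hm, h, hq⟩
    simp only [Prod.mk.injEq] at hq h
    obtain ⟨rfl, rfl⟩ := hq
    rw [List.pair_mem_product, mem_attDecls] at hm
    exact ⟨hm.1, h ▸ hm.2⟩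
  · rintro ⟨h₁, h₂⟩
    exact ⟨((R, A), typeTriple base x R),
      List.pair_mem_product.mpr ⟨mem_attDecls.mpr h₁, h₂⟩, rfl, rfl⟩

theorem mem_rowCode {l : List Triple} {R : RelName} {A B : Attr} {x : Node} {w : Value} :
    (B, w) ∈ rowCode base l ((R, A), x) ↔
      dtpDeclTriple base B R ∈ l ∧ valueTriple base x B R w ∈ l := by
  rw [rowCode, mem_gather]
  constructor
  · rintro ⟨⟨⟨R', B'⟩, x', w'⟩, hm, h, hq⟩
    simp only [Prod.mk.injEq] at hq h
    obtain ⟨rfl, rfl⟩ := hq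
    obtain ⟨rfl, rfl⟩ := h
    exact mem_nodeValues.mp hm
  · intro h
    exact ⟨((R, B), (x, w)), mem_nodeValues.mpr h, rfl, rfl⟩

theorem mem_binRows {l : List Triple} {e : RelName × List Attr × List (List (Attr × Value))} :
    e ∈ binRows base l ↔ ∃ R A B D E T U x y v w, binDeclTriple base R A B D E ∈ l ∧
      refTriple base x y R A B D E ∈ l ∧ domainTriple base R A B D E T ∈ l ∧
      rangeTriple base R A B D E U ∈ l ∧
      (dtpDeclTriple base D T ∈ l ∧ valueTriple base x D T v ∈ l) ∧
      (dtpDeclTriple base E U ∈ l ∧ valueTriple base y E U w ∈ l) ∧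
      e = (R, [A, B], [[(A, v), (B, w)]]) := by
  rw [binRows, mem_gather]
  constructor
  · rintro ⟨⟨⟨⟨⟨R, A, B, D, E⟩, t⟩, dm, rg⟩, ⟨⟨T, D'⟩, x, v⟩, ⟨⟨U, E'⟩, y, w⟩⟩, hm, h, rfl⟩
    simp only [Prod.mk.injEq] at h
    obtain ⟨⟨ht, rfl, rfl⟩, ⟨rfl, rfl⟩, rfl, rfl⟩ := h
    simp only [List.pair_mem_product, mem_binDecls, mem_nodeValues] at hm
    exact ⟨R, A, B, _, _, T, U, _, _, v, w, hm.1.1.1, ht ▸ hm.1.1.2, hm.1.2.1, hm.1.2.2, hm.2.1,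
      hm.2.2, rfl⟩
  · rintro ⟨R, A, B, D, E, T, U, x, y, v, w, h₁, h₂, h₃, h₄, h₅, h₆, rfl⟩
    refine ⟨((((R, A, B, D, E), refTriple base x y R A B D E), domainTriple base R A B D E T,
      rangeTriple base R A B D E U), ((T, D), x, v), ((U, E), y, w)), ?_, rfl, rfl⟩
    simp only [List.pair_mem_product, mem_binDecls, mem_nodeValues]
    exact ⟨⟨⟨h₁, h₂⟩, h₃, h₄⟩, h₅, h₆⟩

theorem mem_decodeGraph {l : List Triple} {e : RelName × List Attr × List (List (Attr × Value))} :
    e ∈ decodeGraph base l ↔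
      (∃ R A, dtpDeclTriple base A R ∈ l ∧ e = (R, [A], [])) ∨
      (∃ R A x, (dtpDeclTriple base A R ∈ l ∧ typeTriple base x R ∈ l) ∧
        e = (R, [A], [rowCode base l ((R, A), x)])) ∨
      (∃ R A B D E, binDeclTriple base R A B D E ∈ l ∧ e = (R, [A, B], [])) ∨
      e ∈ binRows base l := by
  simp only [decodeGraph, List.mem_append, List.mem_map, Prod.exists, mem_attDecls, mem_nodeRows,
    mem_binDecls, eq_comm (a := e)]

/-- The attributes of `R` in a set of triples. -/
def GraphAtt (base : Str) (P : Triple → Prop) (R : RelName) (A : Attr) : Prop :=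
  P (dtpDeclTriple base A R) ∨
    ∃ A' B D E, P (binDeclTriple base R A' B D E) ∧ (A = A' ∨ A = B)

/-- The tuples of `R` in a set of triples. -/
def GraphRow (base : Str) (P : Triple → Prop) (R : RelName) (t : Tuple) : Prop :=
  (∃ A x, P (dtpDeclTriple base A R) ∧ P (typeTriple base x R) ∧ ∀ B w, t B = some w ↔
    P (dtpDeclTriple base B R) ∧ P (valueTriple base x B R w)) ∨
  ∃ A B D E T U x y v w, P (binDeclTriple base R A B D E) ∧ P (refTriple base x y R A B D E) ∧
    P (domainTriple base R A B D E T) ∧ P (rangeTriple base R A B D E U) ∧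
    (P (dtpDeclTriple base D T) ∧ P (valueTriple base x D T v)) ∧
    (P (dtpDeclTriple base E U) ∧ P (valueTriple base y E U w)) ∧
    TupleCode [(A, v), (B, w)] t

theorem decodeGraph_att {l : List Triple} {R : RelName} {A : Attr} :
    (∃ e ∈ decodeGraph base l, e.1 = R ∧ A ∈ e.2.1) ↔ GraphAtt base (· ∈ l) R A := by
  constructor
  · rintro ⟨e, he, rfl, hA⟩
    rw [mem_decodeGraph, mem_binRows] at he
    obtain ⟨R, A', h, rfl⟩ | ⟨R, A', x, h, rfl⟩ | ⟨R, A', B, D, E, h, rfl⟩ |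
      ⟨R, A', B, D, E, T, U, x, y, v, w, h, -, -, -, -, -, rfl⟩ := he
    · obtain rfl : A = A' := by simpa using hA
      exact Or.inl h
    · obtain rfl : A = A' := by simpa using hA
      exact Or.inl h.1
    · exact Or.inr ⟨A', B, D, E, h, by simpa using hA⟩
    · exact Or.inr ⟨A', B, D, E, h, by simpa using hA⟩
  · rintro (h | ⟨A', B, D, E, h, hA⟩)
    · exact ⟨(R, [A], []), mem_decodeGraph.mpr (Or.inl ⟨R, A, h, rfl⟩), rfl, by simp⟩
    · exact ⟨(R, [A', B], []),
        mem_decodeGraph.mpr (Or.inr (Or.inr (Or.inl ⟨R, A', B, D, E, h, rfl⟩))), rfl,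
        by simpa using hA⟩

theorem decodeGraph_ne_nil {l : List Triple} : ∀ e ∈ decodeGraph base l, e.2.1 ≠ [] := by
  intro e he
  rw [mem_decodeGraph, mem_binRows] at he
  obtain ⟨R, A', h, rfl⟩ | ⟨R, A', x, h, rfl⟩ | ⟨R, A', B, D, E, h, rfl⟩ |
    ⟨R, A', B, D, E, T, U, x, y, v, w, h, -, -, -, -, -, rfl⟩ := he <;> simp

theorem decodeGraph_rels {l : List Triple} {R : RelName} :
    (∃ e ∈ decodeGraph base l, e.1 = R) ↔ ∃ A, GraphAtt base (· ∈ l) R A := by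
  simp only [← decodeGraph_att]
  constructor
  · rintro ⟨e, he, hR⟩
    obtain ⟨A, hA⟩ := List.exists_mem_of_ne_nil _ (decodeGraph_ne_nil e he)
    exact ⟨A, e, he, hR, hA⟩
  · rintro ⟨A, e, he, hR, -⟩
    exact ⟨e, he, hR⟩

theorem decodeGraph_row {l : List Triple} {R : RelName} {t : Tuple} :
    (∃ e ∈ decodeGraph base l, e.1 = R ∧ ∃ c ∈ e.2.2, TupleCode c t) ↔
      GraphRow base (· ∈ l) R t := by
  constructor
  · rintro ⟨e, he, rfl, c, hc, ht⟩
    rw [mem_decodeGraph, mem_binRows] at he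
    obtain ⟨R, A, h, rfl⟩ | ⟨R, A, x, h, rfl⟩ | ⟨R, A, B, D, E, h, rfl⟩ |
      ⟨R, A, B, D, E, T, U, x, y, v, w, h₁, h₂, h₃, h₄, h₅, h₆, rfl⟩ := he
    · simp at hc
    · obtain rfl : c = rowCode base l ((R, A), x) := by simpa using hc
      exact Or.inl ⟨A, x, h.1, h.2, fun B w => (ht B w).trans mem_rowCode⟩
    · simp at hc
    · obtain rfl : c = [(A, v), (B, w)] := by simpa using hc
      exact Or.inr ⟨A, B, D, E, T, U, x, y, v, w, h₁, h₂, h₃, h₄, h₅, h₆, ht⟩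
  · rintro (⟨A, x, h₁, h₂, ht⟩ | ⟨A, B, D, E, T, U, x, y, v, w, h₁, h₂, h₃, h₄, h₅, h₆, ht⟩)
    · exact ⟨_, mem_decodeGraph.mpr (Or.inr (Or.inl ⟨R, A, x, ⟨h₁, h₂⟩, rfl⟩)), rfl, _,
        List.mem_singleton_self _, fun B w => (ht B w).trans mem_rowCode.symm⟩
    · exact ⟨_, mem_decodeGraph.mpr (Or.inr (Or.inr (Or.inr (mem_binRows.mpr
        ⟨R, A, B, D, E, T, U, x, y, v, w, h₁, h₂, h₃, h₄, h₅, h₆, rfl⟩)))), rfl, _,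
        List.mem_singleton_self _, ht⟩

/-- Holds for lists that come from no instance, since a row code records only declared attributes
and a row of a binary relation only its two declared ones. -/
theorem exists_describes_decodeGraph (base : Str) (l : List Triple) :
    ∃ D, (decodeGraph base l).Describes D := by
  refine DBCode.exists_describes _ decodeGraph_ne_nil fun R A t h hA => ?_
  rw [decodeGraph_att]
  rw [decodeGraph_row] at h
  obtain ⟨w, hw⟩ := Option.ne_none_iff_exists'.mp hA
  obtain ⟨B, x, -, -, ht⟩ | ⟨B, B', D, E, T, U, x, y, v, w, h, -, -, -, -, -, ht⟩ := h
  · exact Or.inl ((ht A w).mp hw).1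
  · refine Or.inr ⟨B, B', D, E, h, ?_⟩
    have := (ht A _).mp hw
    simp only [List.mem_cons, Prod.mk.injEq, List.not_mem_nil, or_false] at this
    exact this.imp And.left And.left

/-- `GraphAtt` and `GraphRow` see only which triples are present, so order and repetitions in the
listing do not matter, although the code itself may change. -/
theorem decodeGraph_describes_congr {l l' : List Triple} (h : ∀ x, x ∈ l ↔ x ∈ l') {D : DBInstance}
    (hD : (decodeGraph base l).Describes D) : (decodeGraph base l').Describes D := by
  have h' : (fun x => x ∈ l) = fun x => x ∈ l' := funext fun x => propext (h x)
  constructor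
  · intro R
    rw [hD.rels, decodeGraph_rels, decodeGraph_rels, h']
  · intro R A
    rw [hD.att, decodeGraph_att, decodeGraph_att, h']
  · intro R t
    rw [hD.tuples, decodeGraph_row, decodeGraph_row, h']

end Decode

/-! ### Decoding the graph of an instance that satisfies its constraints. -/

section Decode

variable {S : Schema} {C : Constraints S} {I : Instance S} {base : Str}
  {tid : RelName → Tuple → Str} {a : IRI}

theorem Instance.mem_att_of_eq_some {t : Tuple} {R : RelName} (ht : t ∈ I.rel R) {A : Attr}
    {w : Value} (h : t A = some w) : A ∈ S.att R := by
  by_contra hn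
  rw [I.isOver R t ht A hn] at h
  simp at h

theorem Instance.mem_rels_of_mem_rel {t : Tuple} {R : RelName} (ht : t ∈ I.rel R) :
    R ∈ S.rels := by
  by_contra hn
  rw [I.rel_eq_empty R hn] at ht
  exact ht

theorem graphAtt_DMpk (hI : I.Sat C) {R : RelName} {A : Attr} :
    GraphAtt base (· ∈ DMpk base tid a S C I) R A ↔ A ∈ S.att R := by
  simp only [GraphAtt, dtpDeclTriple, binDeclTriple, dtpDecl_mem_iff hI, binDecl_mem_iff hI]
  constructor
  · rintro (h | ⟨A', B, D, E, ⟨T, U, h⟩, hA⟩)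
    · exact h.2
    · simpa [h.att_eq] using hA
  · intro hA
    by_cases hR : IsBinRel C R
    · obtain ⟨A', B, T, D, U, E, h⟩ := hR
      refine Or.inr ⟨A', B, D, E, ⟨T, U, h⟩, ?_⟩
      simpa [h.att_eq] using hA
    · exact Or.inl ⟨⟨mem_rels_of_mem_att hA, hR⟩, hA⟩

theorem BinRel.tupleCode {R A B T D U E} (h : BinRel C R A B T D U E) {t : Tuple}
    (ht : t ∈ I.rel R) {v w : Value} (hv : t A = some v) (hw : t B = some w) :
    TupleCode [(A, v), (B, w)] t := by
  intro X z
  simp only [List.mem_cons, Prod.mk.injEq, List.not_mem_nil, or_false]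
  constructor
  · intro hX
    have hmem := Instance.mem_att_of_eq_some ht hX
    simp only [h.att_eq, Finset.mem_insert, Finset.mem_singleton] at hmem
    obtain rfl | rfl := hmem
    · exact Or.inl ⟨rfl, Option.some.inj (hX.symm.trans hv)⟩
    · exact Or.inr ⟨rfl, Option.some.inj (hX.symm.trans hw)⟩
  · rintro (⟨rfl, rfl⟩ | ⟨rfl, rfl⟩) <;> assumption

/-- A tuple of a binary relation and the two tuples that it references. -/
theorem BinRel.exists_refs (hI : I.Sat C) {R A B T D U E} (h : BinRel C R A B T D U E) {t : Tuple}
    (ht : t ∈ I.rel R) : ∃ v w t₁ t₂ x y, t A = some v ∧ t B = some w ∧ t₁ D = some v ∧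
      t₂ E = some w ∧ RowId C I base tid t₁ T x ∧ RowId C I base tid t₂ U y := by
  have hkey := (hI _ h.pk).1 t ht
  obtain ⟨v, hv⟩ := Option.ne_none_iff_exists'.mp (hkey A (by simp))
  obtain ⟨w, hw⟩ := Option.ne_none_iff_exists'.mp (hkey B (by simp))
  -- Both values are non-null, being key values, so each foreign key leaves only the alternative of
  -- a referenced tuple.
  have h₁ := (hI _ h.fkA).2 t ht
  have h₂ := (hI _ h.fkB).2 t ht
  simp only [List.mem_singleton, exists_eq_left, hv, hw, reduceCtorEq, false_or,
    List.forall₂_cons, List.forall₂_same, List.not_mem_nil, IsEmpty.forall_iff, implies_true,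
    and_true] at h₁ h₂
  obtain ⟨t₁, ht₁, hv₁⟩ := h₁
  obtain ⟨t₂, ht₂, hw₂⟩ := h₂
  obtain ⟨x, hx⟩ := exists_rowId (base := base) (tid := tid) hI h.isClass_left ht₁
  obtain ⟨y, hy⟩ := exists_rowId (base := base) (tid := tid) hI h.isClass_right ht₂
  exact ⟨v, w, t₁, t₂, x, y, hv, hw, hv₁.symm, hw₂.symm, hx, hy⟩

/-- A node belongs to only one tuple of `R`, so a class tuple is null exactly where its node has no
literal. In a binary relation nothing is null, and the two values are found at the ends of the
reference triple. -/
theorem graphRow_DMpk (htid : IsTupleId tid) (hI : I.Sat C) {R : RelName} {t : Tuple} :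
    GraphRow base (· ∈ DMpk base tid a S C I) R t ↔ t ∈ I.rel R := by
  simp only [GraphRow, dtpDeclTriple, binDeclTriple, typeTriple, valueTriple, refTriple,
    domainTriple, rangeTriple, dtpDecl_mem_iff hI, binDecl_mem_iff hI, type_mem_iff hI,
    literal_mem_iff hI, binRef_mem_iff hI, binDomain_mem_iff hI, binRange_mem_iff hI]
  constructor
  · rintro (⟨A, x, -, ⟨t', ht'⟩, ht⟩ | ⟨A, B, D, E, T, U, x, y, v, w, -,
      ⟨T', U', h, t₀, ht₀, t₁, t₂, hA, hB, hx, hy⟩, ⟨_, hT⟩, ⟨_, hU⟩, ⟨-, -, t₁', hx', hv⟩,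
      ⟨-, -, t₂', hy', hw⟩, ht⟩)
    · have hmem := rowId_mem ht'
      suffices t = t' by rw [this]; exact hmem.2
      funext B
      refine Option.ext fun w => (ht B w).trans ?_
      constructor
      · rintro ⟨-, -, t'', ht'', hw⟩
        rwa [rowId_unique htid hI ht' ht'']
      · intro hw
        have hB := Instance.mem_att_of_eq_some hmem.2 hw
        exact ⟨⟨hmem.1, hB⟩, hB, t', ht', hw⟩
    -- The values were read in the relations named by the domain and range triples; uniqueness
    -- identifies these with the relations of the referenced tuples.
    · obtain ⟨-, -, rfl, -, -⟩ := h.unique hT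
      obtain ⟨-, -, -, -, rfl, -⟩ := h.unique hU
      obtain rfl := rowId_unique htid hI hx hx'
      obtain rfl := rowId_unique htid hI hy hy'
      rw [ht.unique (h.tupleCode ht₀ (hA.trans hv) (hB.trans hw))]
      exact ht₀
  · intro ht
    by_cases hR : IsBinRel C R
    · obtain ⟨A, B, T, D, U, E, h⟩ := hR
      obtain ⟨v, w, t₁, t₂, x, y, hv, hw, hv₁, hw₂, hx, hy⟩ :=
        h.exists_refs (base := base) (tid := tid) hI ht
      exact Or.inr ⟨A, B, D, E, T, U, x, y, v, w, ⟨T, U, h⟩,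
        ⟨T, U, h, t, ht, t₁, t₂, hv.trans hv₁.symm, hw.trans hw₂.symm, hx, hy⟩, ⟨U, h⟩, ⟨T, h⟩,
        ⟨⟨h.isClass_left, h.mem_left⟩, h.mem_left, t₁, hx, hv₁⟩,
        ⟨⟨h.isClass_right, h.mem_right⟩, h.mem_right, t₂, hy, hw₂⟩, h.tupleCode ht hv hw⟩
    · have hC : IsClass C R := ⟨Instance.mem_rels_of_mem_rel ht, hR⟩
      obtain ⟨x, hx⟩ := exists_rowId (base := base) (tid := tid) hI hC ht
      obtain ⟨A, hA⟩ := S.att_nonempty R hC.1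
      refine Or.inl ⟨A, x, ⟨hC, hA⟩, ⟨t, hx⟩, fun B w => ?_⟩
      constructor
      · intro hw
        have hB := Instance.mem_att_of_eq_some ht hw
        exact ⟨⟨hC, hB⟩, hB, t, hx, hw⟩
      · rintro ⟨-, -, t', hx', hw⟩
        rwa [rowId_unique htid hI hx hx']

theorem decodeGraph_DMpk (htid : IsTupleId tid) (hI : I.Sat C) {l : List Triple}
    (hl : ∀ x, x ∈ l ↔ x ∈ DMpk base tid a S C I) : (decodeGraph base l).Describes ⟨S, I⟩ := by
  have h' : (fun x => x ∈ l) = fun x => x ∈ DMpk base tid a S C I :=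
    funext fun x => propext (hl x)
  constructor
  · intro R
    rw [decodeGraph_rels, h']
    simp only [graphAtt_DMpk hI]
    exact ⟨S.att_nonempty R, fun ⟨A, hA⟩ => mem_rels_of_mem_att hA⟩
  · intro R A
    rw [decodeGraph_att, h', graphAtt_DMpk hI]
  · intro R t
    rw [decodeGraph_row, h', graphRow_DMpk htid hI]

end Decode

/-! ### Computability -/

section Computability

open Primrec

theorem primrec_ch : Primrec Sym.ch :=
  (Primrec.of_equiv_symm (e := Sym.equiv)).comp (option_some.comp (option_some.comp option_some))

theorem primrec_unstr : Primrec unstr := by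
  refine list_flatMap .id (Primrec₂.mk ?_)
  -- `Sym.equiv` places ordinary characters under three `some`s, hence three nested case
  -- distinctions.
  have h : Primrec fun p : Str × Sym => Sym.equiv p.2 :=
    (Primrec.of_equiv (e := Sym.equiv)).comp snd
  refine (option_casesOn (g := fun _ o => Option.casesOn o [] fun o => Option.casesOn o []
    fun n => [n]) h (Primrec.const []) (Primrec₂.mk (option_casesOn snd (Primrec.const [])
      (Primrec₂.mk (option_casesOn snd (Primrec.const [])
        (Primrec₂.mk (list_cons.comp snd (Primrec.const [])))))))).of_eq ?_
  rintro ⟨_, _ | _ | _ | n⟩ <;> rfl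

theorem primrec_str : Primrec Word.str :=
  list_map .id (Primrec₂.mk (primrec_ch.comp snd))

theorem primrec_before (c : Sym) : Primrec (before c) :=
  list_takeWhile (Primrec.not.comp (PrimrecPred.decide (Primrec.eq.comp .id (.const c))) |>.of_eq
    fun x => by simp)

theorem primrec_after (c : Sym) : Primrec (after c) :=
  list_tail.comp (list_dropWhile
    (Primrec.not.comp (PrimrecPred.decide (Primrec.eq.comp .id (.const c))) |>.of_eq
      fun x => by simp))

theorem primrec_triple_mk {α : Type} [Primcodable α] {f : α → Node} {g : α → IRI} {h : α → Term}
    (hf : Primrec f) (hg : Primrec g) (hh : Primrec h) :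
    Primrec fun x => (⟨f x, g x, h x⟩ : Triple) :=
  (Primrec.of_equiv_symm (e := Triple.equiv)).comp (hf.pair (hg.pair hh))

theorem primrec_subj : Primrec Triple.subj :=
  fst.comp (Primrec.of_equiv (e := Triple.equiv))

theorem primrec_obj : Primrec Triple.obj :=
  snd.comp (snd.comp (Primrec.of_equiv (e := Triple.equiv)))

theorem primrec_iri_str : Primrec IRI.str :=
  (Primrec.of_equiv_symm (e := IRI.equiv)).comp sumInr

theorem primrec_node_iri : Primrec Node.iri :=
  (Primrec.of_equiv_symm (e := Node.equiv)).comp sumInl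

theorem primrec_term_node : Primrec Term.node :=
  (Primrec.of_equiv_symm (e := Term.equiv)).comp sumInl

theorem primrec_term_lit : Primrec Term.lit :=
  (Primrec.of_equiv_symm (e := Term.equiv)).comp sumInr

theorem primrec_iriStr : Primrec Node.iriStr := by
  have h : Primrec fun i : IRI => Sum.casesOn (motive := fun _ => Str) (IRI.equiv i)
      (fun _ => []) id :=
    sumCasesOn (Primrec.of_equiv (e := IRI.equiv)) (Primrec₂.const []) Primrec₂.right
  refine (sumCasesOn (g := fun _ i => Sum.casesOn (motive := fun _ => Str) (IRI.equiv i)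
    (fun _ => []) id) (Primrec.of_equiv (e := Node.equiv)) (Primrec₂.mk (h.comp snd))
    (Primrec₂.const [])).of_eq ?_
  rintro ((_ | _) | _) <;> rfl

theorem primrec_toNode : Primrec Term.toNode := by
  refine (sumCasesOn (Primrec.of_equiv (e := Term.equiv)) Primrec₂.right
    (Primrec₂.const (.blank []))).of_eq ?_
  rintro (_ | _) <;> rfl

theorem primrec_toLit : Primrec Term.toLit := by
  refine (sumCasesOn (Primrec.of_equiv (e := Term.equiv)) (Primrec₂.const [])
    Primrec₂.right).of_eq ?_
  rintro (_ | _) <;> rfl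

/-- The decoder is assembled from `gather` over products of lists, so its primitive recursiveness
reduces to that of the functions being compared and collected. -/
theorem primrec_gather {α β γ σ : Type} [Primcodable α] [Primcodable β] [Primcodable γ]
    [Primcodable σ] [DecidableEq γ] {u v : σ → α → γ} {g : σ → α → β} {l : σ → List α}
    (hu : Primrec₂ u) (hv : Primrec₂ v) (hg : Primrec₂ g) (hl : Primrec l) :
    Primrec fun s => gather (u s) (v s) (g s) (l s) :=
  list_flatMap hl (Primrec₂.mk (Primrec.ite (Primrec.eq.comp hu hv)
    (list_cons.comp hg (Primrec.const [])) (Primrec.const [])))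

theorem primrec_product {α β σ : Type} [Primcodable α] [Primcodable β] [Primcodable σ]
    {f : σ → List α} {g : σ → List β} (hf : Primrec f) (hg : Primrec g) :
    Primrec fun s => (f s).product (g s) :=
  list_flatMap hf (Primrec₂.mk (list_map (hg.comp fst)
    (Primrec₂.mk ((snd.comp fst).pair snd))))

/-! ### Primitive recursiveness of the string builders, the parsers and the decoder. -/

variable {α : Type} [Primcodable α] (base : Str)

theorem primrec_classStr {R : α → RelName} (hR : Primrec R) :
    Primrec fun x => classStr base (R x) :=
  list_append.comp (.const base) (primrec_str.comp hR)

theorem primrec_dtpStr {A : α → Attr} {R : α → RelName} (hA : Primrec A) (hR : Primrec R) :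
    Primrec fun x => dtpStr base (A x) (R x) :=
  list_append.comp (list_append.comp (primrec_classStr base hR) (.const _)) (primrec_str.comp hA)

theorem primrec_binStr {q : α → RelName × Attr × Attr × Attr × Attr} (hq : Primrec q) :
    Primrec fun x => binStr base (q x).1 (q x).2.1 (q x).2.2.1 (q x).2.2.2.1 (q x).2.2.2.2 := by
  have h : ∀ {f g : α → Str}, Primrec f → Primrec g → ∀ c, Primrec fun x => f x ++ c :: g x :=
    fun hf hg c => list_append.comp hf (list_cons.comp (.const c) hg)
  simp only [binStr_eq]
  exact list_append.comp (.const base) (h (primrec_str.comp (fst.comp hq))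
    (h (primrec_str.comp (fst.comp (snd.comp hq)))
      (h (primrec_str.comp (fst.comp (snd.comp (snd.comp hq))))
        (h (primrec_str.comp (fst.comp (snd.comp (snd.comp (snd.comp hq)))))
          (primrec_str.comp (snd.comp (snd.comp (snd.comp (snd.comp hq))))) _) _) _) _)

theorem primrec_parseDtp : Primrec (parseDtp base) := by
  have h : Primrec fun s : Str => s.drop base.length := list_drop.comp (.const _) .id
  exact (primrec_unstr.comp ((primrec_before _).comp h)).pair
    (primrec_unstr.comp ((primrec_after _).comp h))

theorem primrec_parseBin : Primrec (parseBin base) := by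
  have h₀ : Primrec fun s : Str => s.drop base.length := list_drop.comp (.const _) .id
  have h₁ := (primrec_after .hash).comp h₀
  have h₂ := (primrec_after .comma).comp h₁
  have h₃ := (primrec_after .comma).comp h₂
  exact (primrec_unstr.comp ((primrec_before _).comp h₀)).pair
    ((primrec_unstr.comp ((primrec_before _).comp h₁)).pair
      ((primrec_unstr.comp ((primrec_before _).comp h₂)).pair
        ((primrec_unstr.comp ((primrec_before _).comp h₃)).pair
          (primrec_unstr.comp ((primrec_after _).comp h₃)))))

theorem primrec_typed {f : α → Str} (hf : Primrec f) (p : IRI) (o : Term) :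
    Primrec fun x => (⟨.iri (.str (f x)), p, o⟩ : Triple) :=
  primrec_triple_mk (primrec_node_iri.comp (primrec_iri_str.comp hf)) (.const p) (.const o)

theorem primrec_classTerm {R : α → RelName} (hR : Primrec R) :
    Primrec fun x => Term.node (.iri (.str (classStr base (R x)))) :=
  primrec_term_node.comp (primrec_node_iri.comp (primrec_iri_str.comp (primrec_classStr base hR)))

theorem primrec_attDecls : Primrec (attDecls base) := by
  have hp : Primrec fun p : List Triple × Triple => parseDtp base p.2.subj.iriStr :=
    (primrec_parseDtp base).comp (primrec_iriStr.comp (primrec_subj.comp snd))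
  exact primrec_gather Primrec₂.right
    (Primrec₂.mk (primrec_typed (primrec_dtpStr base (snd.comp hp) (fst.comp hp)) _ _))
    (Primrec₂.mk hp) .id

theorem primrec_binDecls : Primrec (binDecls base) := by
  have hp : Primrec fun p : List Triple × Triple => parseBin base p.2.subj.iriStr :=
    (primrec_parseBin base).comp (primrec_iriStr.comp (primrec_subj.comp snd))
  exact primrec_gather Primrec₂.right (Primrec₂.mk (primrec_typed (primrec_binStr base hp) _ _))
    (Primrec₂.mk hp) .id

theorem primrec_nodeValues : Primrec (nodeValues base) := by
  refine primrec_gather (Primrec₂.mk (snd.comp snd)) (Primrec₂.mk ?_) (Primrec₂.mk ?_)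
    (primrec_product (primrec_attDecls base) .id)
  · have h : Primrec fun p : List Triple × ((RelName × Attr) × Triple) => p.2 := snd
    exact primrec_triple_mk (primrec_subj.comp (snd.comp h))
      (primrec_iri_str.comp (primrec_dtpStr base (snd.comp (fst.comp h)) (fst.comp (fst.comp h))))
      (primrec_term_lit.comp (primrec_toLit.comp (primrec_obj.comp (snd.comp h))))
  · have h : Primrec fun p : List Triple × ((RelName × Attr) × Triple) => p.2 := snd
    exact (fst.comp h).pair ((primrec_subj.comp (snd.comp h)).pair
      (primrec_toLit.comp (primrec_obj.comp (snd.comp h))))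

theorem primrec_nodeRows : Primrec (nodeRows base) := by
  have h : Primrec fun p : List Triple × ((RelName × Attr) × Triple) => p.2 := snd
  exact primrec_gather (Primrec₂.mk (snd.comp snd))
    (Primrec₂.mk (primrec_triple_mk (primrec_subj.comp (snd.comp h)) (.const _)
      (primrec_classTerm base (fst.comp (fst.comp h)))))
    (Primrec₂.mk ((fst.comp h).pair (primrec_subj.comp (snd.comp h))))
    (primrec_product (primrec_attDecls base) .id)

theorem primrec_rowCode : Primrec₂ (rowCode base) := by
  have h : Primrec fun p : (List Triple × ((RelName × Attr) × Node)) ×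
      ((RelName × Attr) × (Node × Literal)) => p.2 := snd
  have h' : Primrec fun p : (List Triple × ((RelName × Attr) × Node)) ×
      ((RelName × Attr) × (Node × Literal)) => p.1.2 := snd.comp fst
  exact Primrec₂.mk (primrec_gather
    (Primrec₂.mk ((fst.comp (fst.comp h)).pair (fst.comp (snd.comp h))))
    (Primrec₂.mk ((fst.comp (fst.comp h')).pair (snd.comp h')))
    (Primrec₂.mk ((snd.comp (fst.comp h)).pair (snd.comp (snd.comp h))))
    ((primrec_nodeValues base).comp fst))

theorem primrec_binRows : Primrec (binRows base) := by
  have h : Primrec fun p : List Triple × ((((RelName × Attr × Attr × Attr × Attr) × Triple) ×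
      (Triple × Triple)) × (((RelName × Attr) × (Node × Literal)) ×
      ((RelName × Attr) × (Node × Literal)))) => p.2 := snd
  have hq := fst.comp (fst.comp (fst.comp h))
  have he := snd.comp (fst.comp (fst.comp h))
  have hdm := fst.comp (snd.comp (fst.comp h))
  have hrg := snd.comp (snd.comp (fst.comp h))
  have hv := fst.comp (snd.comp h)
  have hw := snd.comp (snd.comp h)
  have hA := fst.comp (snd.comp hq)
  have hB := fst.comp (snd.comp (snd.comp hq))
  have hD := fst.comp (snd.comp (snd.comp (snd.comp hq)))
  have hE := snd.comp (snd.comp (snd.comp (snd.comp hq)))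
  have hs := primrec_iri_str.comp (primrec_binStr base hq)
  have hn := primrec_node_iri.comp hs
  have hx := primrec_subj.comp he
  have hy := primrec_toNode.comp (primrec_obj.comp he)
  have hnil : Primrec fun _ : List Triple × ((((RelName × Attr × Attr × Attr × Attr) × Triple) ×
      (Triple × Triple)) × (((RelName × Attr) × (Node × Literal)) ×
      ((RelName × Attr) × (Node × Literal)))) => ([] : List Attr) := .const []
  refine primrec_gather (Primrec₂.mk ?_) (Primrec₂.mk ?_) (Primrec₂.mk ?_)
    (primrec_product (primrec_product (primrec_product (primrec_binDecls base) .id)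
      (primrec_product .id .id))
      (primrec_product (primrec_nodeValues base) (primrec_nodeValues base)))
  · exact (he.pair (hdm.pair hrg)).pair
      (((snd.comp (fst.comp hv)).pair (fst.comp (snd.comp hv))).pair
        ((snd.comp (fst.comp hw)).pair (fst.comp (snd.comp hw))))
  · exact ((primrec_triple_mk hx hs (primrec_term_node.comp hy)).pair
      ((primrec_triple_mk hn (.const _) (primrec_classTerm base (fst.comp (fst.comp hv)))).pair
        (primrec_triple_mk hn (.const _) (primrec_classTerm base (fst.comp (fst.comp hw)))))).pair
      ((hD.pair hx).pair (hE.pair hy))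
  · exact (fst.comp hq).pair ((list_cons.comp hA (list_cons.comp hB hnil)).pair
      (list_cons.comp (list_cons.comp (hA.pair (snd.comp (snd.comp hv)))
        (list_cons.comp (hB.pair (snd.comp (snd.comp hw))) (.const []))) (.const [])))

theorem primrec_decodeGraph : Primrec (decodeGraph base) := by
  have h₁ : Primrec fun l => (attDecls base l).map fun q =>
      ((q.1, [q.2], []) : RelName × List Attr × List (List (Attr × Value))) :=
    list_map (primrec_attDecls base) (Primrec₂.mk ((fst.comp snd).pair
      ((list_cons.comp (snd.comp snd) (.const [])).pair (.const []))))
  have h₂ : Primrec fun l => (nodeRows base l).map fun r =>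
      ((r.1.1, [r.1.2], [rowCode base l r]) : RelName × List Attr × List (List (Attr × Value))) :=
    list_map (primrec_nodeRows base) (Primrec₂.mk ((fst.comp (fst.comp snd)).pair
      ((list_cons.comp (snd.comp (fst.comp snd)) (.const [])).pair
        (list_cons.comp ((primrec_rowCode base).comp fst snd) (.const [])))))
  have h₃ : Primrec fun l => (binDecls base l).map fun q =>
      ((q.1, [q.2.1, q.2.2.1], []) : RelName × List Attr × List (List (Attr × Value))) :=
    list_map (primrec_binDecls base) (Primrec₂.mk ((fst.comp snd).pair
      ((list_cons.comp (fst.comp (snd.comp snd)) (list_cons.comp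
        (fst.comp (snd.comp (snd.comp snd))) (.const []))).pair (.const []))))
  exact list_append.comp h₁ (list_append.comp h₂ (list_append.comp h₃ (primrec_binRows base)))

end Computability

theorem informationPreserving_DMpk (base : Str) {tid : RelName → Tuple → Str}
    (htid : IsTupleId tid) (a : IRI) : InformationPreserving (DMpk base tid a) := by
  -- `N G` is the instance described by the decoding of one chosen listing of `G`; any other listing
  -- describes the same instance.
  choose N hN using fun G : RDFGraph => exists_describes_decodeGraph base G.toList
  refine ⟨N, ⟨decodeGraph base, (primrec_decodeGraph base).to_comp, fun G l hl => ?_⟩, ?_⟩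
  · exact decodeGraph_describes_congr (fun x => by simp [hl]) (hN G)
  · intro S C I hI
    exact (hN _).unique (decodeGraph_DMpk (a := a) htid hI fun x => by simp)

/-! ### Patterns with a prescribed evaluation -/

section Realizable

variable {ι : Type} {G : ι → RDFGraph} {W W₁ W₂ : Finset Var} {F F₁ F₂ : ι → Set Mapping}

/-- The sets of mappings `F i` are the evaluations over the graphs `G i` of a pattern whose variables
outside `W` are hidden and can be chosen outside any given finite set. -/
def Realizable (G : ι → RDFGraph) (W : Finset Var) (F : ι → Set Mapping) : Prop :=
  ∀ X : Finset Var, W ⊆ X → ∃ P : Pattern, P.WF ∧ (∀ x ∈ P.vars, x ∈ X → x ∈ W) ∧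
    (∀ out : Finset Var, (∀ x ∈ out, x ∈ P.vars → x ∈ W) → P.NonParamIn out) ∧
    ∀ i, P.eval (G i) = F i

theorem Realizable.exists_isQuery (h : Realizable G W F) :
    ∃ P : Pattern, P.IsQuery ∧ ∀ i, P.eval (G i) = F i := by
  obtain ⟨P, h₁, -, h₂, h₃⟩ := h W subset_rfl
  exact ⟨P, ⟨h₁, h₂ ∅ (by simp)⟩, h₃⟩

theorem Realizable.congr (h : Realizable G W F₁) (hF : ∀ i, F₁ i = F₂ i) : Realizable G W F₂ :=
  (funext hF : F₁ = F₂) ▸ h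

theorem Realizable.mono (h : Realizable G W₁ F) (hW : W₁ ⊆ W) : Realizable G W F := by
  intro X hX
  obtain ⟨P, h₁, h₂, h₃, h₄⟩ := h X (hW.trans hX)
  exact ⟨P, h₁, fun x hx hx' => hW (h₂ x hx hx'),
    fun out ho => h₃ out fun x hx hx' => h₂ x hx' (hX (ho x hx hx')), h₄⟩

/-- `P₁` hides only variables outside `X`; then `P₂` is chosen to hide only variables outside `X`
and outside `P₁`. Neither pattern meets a hidden variable of the other, which is what
non-parametricity of any binary operator requires. -/
theorem Realizable.pair (hF₁ : Realizable G W₁ F₁) (hF₂ : Realizable G W₂ F₂) {X : Finset Var}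
    (hX : W₁ ∪ W₂ ⊆ X) : ∃ P₁ P₂ : Pattern, (P₁.WF ∧ P₂.WF) ∧
      (∀ x ∈ P₁.vars ∪ P₂.vars, x ∈ X → x ∈ W₁ ∪ W₂) ∧
      (∀ out : Finset Var, (∀ x ∈ out, x ∈ P₁.vars ∪ P₂.vars → x ∈ W₁ ∪ W₂) →
        P₁.NonParamIn (out ∪ P₂.vars) ∧ P₂.NonParamIn (out ∪ P₁.vars)) ∧
      ∀ i, P₁.eval (G i) = F₁ i ∧ P₂.eval (G i) = F₂ i := by
  have hX₁ : W₁ ⊆ X := Finset.subset_union_left.trans hX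
  have hX₂ : W₂ ⊆ X := Finset.subset_union_right.trans hX
  obtain ⟨P₁, hw₁, hv₁, hn₁, he₁⟩ := hF₁ X hX₁
  obtain ⟨P₂, hw₂, hv₂, hn₂, he₂⟩ := hF₂ (X ∪ P₁.vars) (hX₂.trans Finset.subset_union_left)
  refine ⟨P₁, P₂, ⟨hw₁, hw₂⟩, ?_, ?_, fun i => ⟨he₁ i, he₂ i⟩⟩
  · intro x hx hxX
    rw [Finset.mem_union] at hx ⊢
    exact hx.imp (fun h => hv₁ x h hxX) fun h => hv₂ x h (Finset.mem_union_left _ hxX)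
  · intro out ho
    constructor
    · refine hn₁ _ fun x hx hx₁ => hv₁ x hx₁ ?_
      rcases Finset.mem_union.mp hx with hx | hx
      · exact hX (ho x hx (Finset.mem_union_left _ hx₁))
      · exact hX₂ (hv₂ x hx (Finset.mem_union_right _ hx₁))
    · refine hn₂ _ fun x hx hx₂ => ?_
      rcases Finset.mem_union.mp hx with hx | hx
      · exact hv₂ x hx₂ (Finset.mem_union_left _ (hX (ho x hx (Finset.mem_union_right _ hx₂))))
      · exact hv₂ x hx₂ (Finset.mem_union_right _ hx)

/-- The join of two sets of mappings. -/
def joinMappings (Ω₁ Ω₂ : Set Mapping) : Set Mapping :=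
  {μ | ∃ μ₁ ∈ Ω₁, ∃ μ₂ ∈ Ω₂, μ₁.Compatible μ₂ ∧ μ = μ₁.union μ₂}

theorem Realizable.and (hF₁ : Realizable G W₁ F₁) (hF₂ : Realizable G W₂ F₂) :
    Realizable G (W₁ ∪ W₂) fun i => joinMappings (F₁ i) (F₂ i) := by
  intro X hX
  obtain ⟨P₁, P₂, hw, hv, hn, he⟩ := hF₁.pair hF₂ hX
  exact ⟨.and P₁ P₂, hw, hv, hn, fun i => by simp only [Pattern.eval, (he i).1, (he i).2]; rfl⟩

theorem Realizable.opt (hF₁ : Realizable G W₁ F₁) (hF₂ : Realizable G W₂ F₂) :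
    Realizable G (W₁ ∪ W₂) fun i => joinMappings (F₁ i) (F₂ i) ∪
      {μ | μ ∈ F₁ i ∧ ∀ μ' ∈ F₂ i, ¬ μ.Compatible μ'} := by
  intro X hX
  obtain ⟨P₁, P₂, hw, hv, hn, he⟩ := hF₁.pair hF₂ hX
  exact ⟨.opt P₁ P₂, hw, hv, hn, fun i => by simp only [Pattern.eval, (he i).1, (he i).2]; rfl⟩

theorem Realizable.union (hF₁ : Realizable G W₁ F₁) (hF₂ : Realizable G W₂ F₂) :
    Realizable G (W₁ ∪ W₂) fun i => F₁ i ∪ F₂ i := by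
  intro X hX
  obtain ⟨P₁, P₂, hw, hv, hn, he⟩ := hF₁.pair hF₂ hX
  exact ⟨.union P₁ P₂, hw, hv, hn, fun i => by simp only [Pattern.eval, (he i).1, (he i).2]⟩

theorem Realizable.minus (hF₁ : Realizable G W₁ F₁) (hF₂ : Realizable G W₂ F₂) :
    Realizable G (W₁ ∪ W₂) fun i =>
      {μ | μ ∈ F₁ i ∧ ∀ μ' ∈ F₂ i, ¬ μ.Compatible μ' ∨ μ.dom ∩ μ'.dom = ∅} := by
  intro X hX
  obtain ⟨P₁, P₂, hw, hv, hn, he⟩ := hF₁.pair hF₂ hX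
  exact ⟨.minus P₁ P₂, hw, hv, hn, fun i => by simp only [Pattern.eval, (he i).1, (he i).2]⟩

theorem Realizable.filter (hF : Realizable G W F) {r : Cond} (hr : r.vars ⊆ W) :
    Realizable G W fun i => {μ | μ ∈ F i ∧ μ.Sat r} := by
  intro X hX
  obtain ⟨P, hw, hv, hn, he⟩ := hF X hX
  refine ⟨.filter P r, hw, ?_, ?_, fun i => by simp only [Pattern.eval, he i]⟩
  · intro x hx hxX
    rcases Finset.mem_union.mp hx with hx | hx
    · exact hv x hx hxX
    · exact hr hx
  · intro out ho
    refine hn _ fun x hx hxP => ?_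
    rcases Finset.mem_union.mp hx with hx | hx
    · exact ho x hx (Finset.mem_union_left _ hxP)
    · exact hr hx

/-- The auxiliary variables in `W` may depend on `X`, so they can be picked fresh; a `SELECT`
without renaming then hides them. -/
theorem Realizable.hide {V : Finset Var} (h : ∀ X : Finset Var, V ⊆ X → ∃ (W : Finset Var)
    (F' : ι → Set Mapping), V ⊆ W ∧ (∀ x ∈ W, x ∈ X → x ∈ V) ∧ Realizable G W F' ∧
      ∀ i, Mapping.select [] V.toList '' F' i = F i) : Realizable G V F := by
  intro X hX
  obtain ⟨W, F', hVW, hWX, hF', hF⟩ := h X hX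
  obtain ⟨P, hw, hv, hn, he⟩ := hF' (X ∪ W) Finset.subset_union_right
  have hvars : ∀ x, x ∈ (Pattern.select [] V.toList P).vars ↔ x ∈ V ∨ x ∈ P.vars := by
    simp [Pattern.vars, selectVars]
  refine ⟨.select [] V.toList P, ⟨by simp [Finset.nodup_toList], by simp, hw⟩, ?_, ?_, ?_⟩
  · intro x hx hxX
    rcases (hvars x).mp hx with hx | hx
    · exact hx
    · exact hWX x (hv x hx (Finset.mem_union_left _ hxX)) hxX
  · intro out ho
    refine ⟨?_, hn _ ?_⟩
    -- `out` meets the pattern only in `V`, and the `SELECT` hides nothing in `V`.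
    · intro x hx hxo
      simp only [selectSrc, List.map_nil, List.nil_append, Finset.toList_toFinset,
        Finset.mem_sdiff] at hx
      exact hx.2 (ho x hxo ((hvars x).mpr (Or.inr hx.1)))
    · intro x hx hxP
      simp only [selectVars, List.map_nil, List.nil_append, Finset.toList_toFinset,
        Finset.mem_union] at hx
      rcases hx with hx | hx
      · exact hVW (ho x hx ((hvars x).mpr (Or.inr hxP)))
      · exact hVW hx
  · intro i
    simp only [Pattern.eval, he i, hF i]

theorem Realizable.triple (s : PatTerm) (p : PatPred) (o : PatTerm) :
    Realizable G (Pattern.triple s p o).vars fun i => (Pattern.triple s p o).eval (G i) :=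
  fun _ _ => ⟨.triple s p o, trivial, fun _ h _ => h, fun _ _ => trivial, fun _ => rfl⟩

/-- `n` exceeds the length of every word in `X`. The prefix gives a whole injective family of fresh
variables, one for each word. -/
theorem exists_fresh (X : Finset Var) : ∃ n, ∀ x : Var, List.replicate n 0 ++ x ∉ X := by
  obtain ⟨n, hn⟩ := (X.image List.length).exists_nat_subset_range
  refine ⟨n, fun x hx => ?_⟩
  have := Finset.mem_range.mp (hn (Finset.mem_image_of_mem _ hx))
  simp at this

/-- The empty pattern has a solution only over a nonempty graph; this is where query preservation
needs a nonempty schema. -/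
theorem Realizable.emptyMapping (hG : ∀ i, (G i).Nonempty) :
    Realizable G ∅ fun _ => {μ | μ.dom = ∅} :=
  fun _ _ => ⟨.empty, trivial, fun _ h _ => h, fun _ _ => trivial, fun i => by
    simp [Pattern.eval, hG i]⟩

/-- A contradictory filter. Its variable has to be fresh, as no variable may be visible here. -/
theorem Realizable.empty : Realizable G ∅ fun _ => ∅ := by
  intro X _
  obtain ⟨n, hn⟩ := exists_fresh X
  let z : Var := List.replicate n 0 ++ []
  refine ⟨.filter .empty (.and (.bound z) (.not (.bound z))), trivial, ?_, fun _ _ => trivial, ?_⟩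
  · intro x hx hxX
    obtain rfl : x = z := by simpa [Pattern.vars, Cond.vars] using hx
    exact absurd hxX (hn [])
  · intro i
    simp [Pattern.eval, Mapping.Sat]

/-- One filter `bound` or `not bound` for each variable of `Y`. It serves to fix the domain of the
mappings in differences and to exclude nulls in joins. -/
theorem Realizable.filterDom (hF : Realizable G W F) (p : Var → Prop) {Y : Finset Var}
    (hY : Y ⊆ W) : Realizable G W fun i => {μ | μ ∈ F i ∧ ∀ x ∈ Y, x ∈ μ.dom ↔ p x} := by
  induction Y using Finset.induction with
  | empty => simpa using hF
  | insert y Y hy ih =>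
    have ih := ih ((Finset.subset_insert y Y).trans hY)
    have hyW := hY (Finset.mem_insert_self y Y)
    by_cases hp : p y
    · refine (ih.filter (r := .bound y) (by simpa [Cond.vars])).congr fun i => ?_
      ext μ
      simp only [Set.mem_ofPred_eq, Mapping.Sat, Finset.forall_mem_insert, hp, iff_true]
      tauto
    · refine (ih.filter (r := .not (.bound y)) (by simpa [Cond.vars])).congr fun i => ?_
      ext μ
      simp only [Set.mem_ofPred_eq, Mapping.Sat, Finset.forall_mem_insert, hp, iff_false]
      tauto

theorem Realizable.biUnion {κ : Type} [DecidableEq κ] (s : Finset κ) {F : κ → ι → Set Mapping}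
    (hF : ∀ k ∈ s, Realizable G W (F k)) : Realizable G W fun i => ⋃ k ∈ s, F k i := by
  induction s using Finset.induction with
  | empty => simpa using Realizable.empty.mono (Finset.empty_subset W)
  | insert k s hk ih =>
    have := (hF k (Finset.mem_insert_self k s)).union
      (ih fun j hj => hF j (Finset.mem_insert_of_mem hj))
    rw [Finset.union_idempotent] at this
    exact this.congr fun i => by simp

/-! ### Operations on mappings -/

theorem Mapping.mem_dom {μ : Mapping} {x : Var} : x ∈ μ.dom ↔ μ x ≠ none := Iff.rfl

theorem Mapping.notMem_dom {μ : Mapping} {x : Var} : x ∉ μ.dom ↔ μ x = none := by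
  simp [Mapping.dom]

theorem Mapping.select_keep (V : Finset Var) (μ : Mapping) (x : Var) :
    Mapping.select [] V.toList μ x = if x ∈ V then μ x else none := by
  simp [Mapping.select]

theorem Mapping.select_eq_iff {V : Finset Var} {μ ν : Mapping} :
    Mapping.select [] V.toList μ = ν ↔ (∀ x ∈ V, μ x = ν x) ∧ ∀ x ∉ V, ν x = none := by
  simp only [funext_iff, Mapping.select_keep]
  constructor
  · intro h
    exact ⟨fun x hx => by simpa [hx] using h x, fun x hx => by simpa [hx, eq_comm] using h x⟩
  · rintro ⟨h₁, h₂⟩ x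
    split_ifs with hx
    · exact h₁ x hx
    · exact (h₂ x hx).symm

theorem Mapping.union_of_notMem_left {μ ν : Mapping} {x : Var} (h : x ∉ μ.dom) :
    μ.union ν x = ν x := by
  simp [Mapping.union, Mapping.notMem_dom.mp h]

theorem Mapping.union_of_notMem_right {μ ν : Mapping} {x : Var} (h : x ∉ ν.dom) :
    μ.union ν x = μ x := by
  simp [Mapping.union, Mapping.notMem_dom.mp h]

theorem Mapping.union_of_mem_left {μ ν : Mapping} {x : Var} (h : x ∈ μ.dom) :
    μ.union ν x = μ x := by
  obtain ⟨v, hv⟩ := Option.ne_none_iff_exists'.mp h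
  simp [Mapping.union, hv]

theorem Mapping.Compatible.union_of_mem_right {μ ν : Mapping} (hc : μ.Compatible ν) {x : Var}
    (h : x ∈ ν.dom) : μ.union ν x = ν x := by
  by_cases hx : x ∈ μ.dom
  · rw [Mapping.union_of_mem_left hx, hc x hx h]
  · exact Mapping.union_of_notMem_left hx

theorem Mapping.Compatible.refl (μ : Mapping) : μ.Compatible μ := fun _ _ _ => rfl

theorem Mapping.Compatible.of_disjoint {μ ν : Mapping} (h : ∀ x ∈ μ.dom, x ∉ ν.dom) :
    μ.Compatible ν := fun x hx hx' => absurd hx' (h x hx)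

/-- `μ` is a restriction of `ν`. -/
def Mapping.Agrees (μ ν : Mapping) : Prop := ∀ x ∈ μ.dom, μ x = ν x

theorem Mapping.Agrees.compatible {μ μ' ν : Mapping} (h : μ.Agrees ν) (h' : μ'.Agrees ν) :
    μ.Compatible μ' :=
  fun x hx hx' => (h x hx).trans (h' x hx').symm

theorem Mapping.Agrees.union {μ μ' ν : Mapping} (h : μ.Agrees ν) (h' : μ'.Agrees ν) :
    (μ.union μ').Agrees ν := by
  intro x hx
  by_cases hμ : x ∈ μ.dom
  · rw [Mapping.union_of_mem_left hμ, h x hμ]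
  · rw [Mapping.mem_dom, Mapping.union_of_notMem_left hμ] at hx
    rw [Mapping.union_of_notMem_left hμ, h' x hx]

/-- The difference of two sets of mappings. Compatibility is equality between mappings with the same
domain, and a common variable that is always bound makes `MINUS` remove the empty mapping as well. -/
theorem Realizable.diff (hG : ∀ i, (G i).Nonempty) (hF₁ : Realizable G W F₁)
    (hF₂ : Realizable G W F₂) (hd₁ : ∀ i, ∀ μ ∈ F₁ i, ∀ x ∈ μ.dom, x ∈ W)
    (hd₂ : ∀ i, ∀ μ ∈ F₂ i, ∀ x ∈ μ.dom, x ∈ W) : Realizable G W fun i => F₁ i \ F₂ i := by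
  -- One difference for each of the finitely many possible domains `Y`.
  have hY : ∀ Y ∈ W.powerset, Realizable G W fun i =>
      {μ | μ ∈ F₁ i ∧ ∀ x ∈ W, x ∈ μ.dom ↔ x ∈ Y} \ {μ | μ ∈ F₂ i ∧ ∀ x ∈ W, x ∈ μ.dom ↔ x ∈ Y} := by
    intro Y _
    refine Realizable.hide fun X hX => ?_
    obtain ⟨n, hn⟩ := exists_fresh X
    let z : ℕ → Var := fun k => List.replicate n 0 ++ [k]
    have hzX : ∀ k, z k ∉ X := fun k => hn [k]
    have hzW : ∀ k, z k ∉ W := fun k h => hzX k (hX h)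
    -- Distinct fresh variables match any triple, so `T` has a solution over every nonempty graph,
    -- and it binds `z 0` on both sides of `MINUS`.
    let T : Pattern := .triple (.var (z 0)) (.var (z 1)) (.var (z 2))
    have hT : ∀ x ∈ T.vars, x = z 0 ∨ x = z 1 ∨ x = z 2 := by
      intro x hx
      simpa [T, Pattern.vars, PatTerm.vars, PatPred.vars, or_assoc] using hx
    have hTW : ∀ x ∈ T.vars, x ∉ W := by
      intro x hx
      rcases hT x hx with rfl | rfl | rfl <;> exact hzW _
    have hTX : ∀ x ∈ T.vars, x ∉ X := by
      intro x hx
      rcases hT x hx with rfl | rfl | rfl <;> exact hzX _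
    have hz : z 0 ∈ T.vars := by simp [T, Pattern.vars, PatTerm.vars]
    have hne : ∀ i, (T.eval (G i)).Nonempty := by
      intro i
      obtain ⟨t, ht⟩ := hG i
      have h01 : z 0 ≠ z 1 := by simp [z]
      have h02 : z 0 ≠ z 2 := by simp [z]
      have h12 : z 1 ≠ z 2 := by simp [z]
      refine ⟨fun x => if x = z 0 then some (.node t.subj) else if x = z 1 then
        some (.node (.iri t.pred)) else if x = z 2 then some t.obj else none, ?_, t, ht, ?_⟩
      · ext x
        simp only [Mapping.dom, Set.mem_ofPred_eq, Pattern.vars, PatTerm.vars, PatPred.vars,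
          Finset.coe_union, Finset.coe_singleton, Set.mem_union, Set.mem_singleton_iff]
        split_ifs <;> simp_all
      · simp [PatTerm.inst, PatPred.inst, h01.symm, h02.symm, h12.symm]
    have hdom : ∀ i, ∀ m ∈ T.eval (G i), m.dom = (T.vars : Set Var) := fun i m hm => hm.1
    have h₁ := (hF₁.filterDom (· ∈ Y) subset_rfl).and (Realizable.triple (G := G) (.var (z 0))
      (.var (z 1)) (.var (z 2)))
    have h₂ := (hF₂.filterDom (· ∈ Y) subset_rfl).and (Realizable.triple (G := G) (.var (z 0))
      (.var (z 1)) (.var (z 2)))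
    have hm := h₁.minus h₂
    rw [Finset.union_idempotent] at hm
    refine ⟨W ∪ T.vars, _, Finset.subset_union_left, ?_, hm, fun i => ?_⟩
    · intro x hx hxX
      rcases Finset.mem_union.mp hx with hx | hx
      · exact hx
      · exact absurd hxX (hTX x hx)
    have hc : ∀ μ : Mapping, (∀ x ∈ μ.dom, x ∈ W) → ∀ m ∈ T.eval (G i), μ.Compatible m := by
      intro μ hμ m hm
      refine Mapping.Compatible.of_disjoint fun x hx hx' => ?_
      rw [hdom i m hm] at hx'
      exact hTW x hx' (hμ x hx)
    have hres : ∀ μ : Mapping, ∀ m ∈ T.eval (G i), ∀ x ∈ W, μ.union m x = μ x := by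
      intro μ m hm x hx
      refine Mapping.union_of_notMem_right ?_
      rw [hdom i m hm]
      exact fun h => hTW x h hx
    have hsel : ∀ μ : Mapping, (∀ x ∈ μ.dom, x ∈ W) → ∀ m ∈ T.eval (G i),
        Mapping.select [] W.toList (μ.union m) = μ := by
      intro μ hμ m hm
      exact Mapping.select_eq_iff.mpr ⟨hres μ m hm,
        fun x hx => Mapping.notMem_dom.mp fun h => hx (hμ x h)⟩
    ext μ
    constructor
    · rintro ⟨_, ⟨⟨μ₁, hμ₁, m, hm, -, rfl⟩, hmin⟩, rfl⟩
      rw [hsel μ₁ (hd₁ i μ₁ hμ₁.1) m hm]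
      refine ⟨hμ₁, fun hμ₂ => ?_⟩
      -- If `μ₁` were also in the second set, `MINUS` would compare `μ₁.union m` with itself: it is
      -- compatible, and the domains share `z 0`.
      rcases hmin (μ₁.union m) ⟨μ₁, hμ₂, m, hm, hc μ₁ (hd₁ i μ₁ hμ₁.1) m hm, rfl⟩ with h | h
      · exact h (Mapping.Compatible.refl _)
      · have hzd : z 0 ∈ (μ₁.union m).dom := by
          have hzm : z 0 ∈ m.dom := by rw [hdom i m hm]; exact hz
          rw [Mapping.mem_dom, (hc μ₁ (hd₁ i μ₁ hμ₁.1) m hm).union_of_mem_right hzm]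
          exact hzm
        rw [Set.inter_self] at h
        rw [h] at hzd
        exact hzd
    · rintro ⟨hμ₁, hμ₂⟩
      obtain ⟨m, hm⟩ := hne i
      have hμd := hd₁ i μ hμ₁.1
      refine ⟨μ.union m, ⟨⟨μ, hμ₁, m, hm, hc μ hμd m hm, rfl⟩, ?_⟩, hsel μ hμd m hm⟩
      rintro _ ⟨μ', hμ', m', hm', -, rfl⟩
      refine Or.inl fun hcomp => hμ₂ ?_
      -- Both mappings have domain `Y`, and the dummy parts bind nothing in `W`, so compatibility
      -- forces equality.
      suffices μ = μ' by rw [this]; exact hμ'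
      funext x
      by_cases hx : x ∈ W
      · by_cases hxY : x ∈ Y
        · have hx₁ := (hμ₁.2 x hx).mpr hxY
          have hx₂ := (hμ'.2 x hx).mpr hxY
          have := hcomp x (by rwa [Mapping.mem_dom, hres μ m hm x hx])
            (by rwa [Mapping.mem_dom, hres μ' m' hm' x hx])
          rwa [hres μ m hm x hx, hres μ' m' hm' x hx] at this
        · rw [Mapping.notMem_dom.mp fun h => hxY ((hμ₁.2 x hx).mp h),
            Mapping.notMem_dom.mp fun h => hxY ((hμ'.2 x hx).mp h)]
      · rw [Mapping.notMem_dom.mp fun h => hx (hμd x h),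
          Mapping.notMem_dom.mp fun h => hx (hd₂ i μ' hμ'.1 x h)]
  refine (Realizable.biUnion W.powerset hY).congr fun i => ?_
  ext μ
  simp only [Set.mem_iUnion, Set.mem_sdiff, Set.mem_ofPred_eq, Finset.mem_powerset]
  constructor
  · rintro ⟨Y, -, ⟨h₁, hY⟩, h₂⟩
    exact ⟨h₁, fun h => h₂ ⟨h, hY⟩⟩
  · rintro ⟨h₁, h₂⟩
    classical
    exact ⟨W.filter (· ∈ μ.dom), Finset.filter_subset _ _, ⟨h₁, fun x hx => by simp [hx]⟩,
      fun h => h₂ h.1⟩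

end Realizable

/-! ### Tuples as mappings, with the variables renamed -/

section TrOn

variable {σ : Attr → Var} {U U₁ U₂ : Finset Attr} {t t₁ t₂ : Tuple}

open Classical in
/-- The mapping of the variable `σ A` to the value of `t` in `A`, for the attributes `A` in `U`. -/
noncomputable def trOn (σ : Attr → Var) (U : Finset Attr) (t : Tuple) : Mapping := fun x =>
  if h : ∃ A ∈ U, σ A = x then (t h.choose).map Term.lit else none

theorem trOn_apply (hσ : Set.InjOn σ U) {A : Attr} (hA : A ∈ U) :
    trOn σ U t (σ A) = (t A).map Term.lit := by
  have h : ∃ B ∈ U, σ B = σ A := ⟨A, hA, rfl⟩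
  have h' : h.choose = A := hσ h.choose_spec.1 hA h.choose_spec.2
  simp only [trOn, dif_pos h, h']

theorem trOn_of_notMem {x : Var} (hx : x ∉ U.image σ) : trOn σ U t x = none := by
  have h : ¬ ∃ A ∈ U, σ A = x := by simpa using hx
  simp only [trOn, dif_neg h]

theorem eq_trOn_iff (hσ : Set.InjOn σ U) {μ : Mapping} :
    μ = trOn σ U t ↔ (∀ A ∈ U, μ (σ A) = (t A).map Term.lit) ∧ ∀ x ∉ U.image σ, μ x = none := by
  constructor
  · rintro rfl
    exact ⟨fun A hA => trOn_apply hσ hA, fun x hx => trOn_of_notMem hx⟩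
  · rintro ⟨h₁, h₂⟩
    funext x
    by_cases hx : x ∈ U.image σ
    · obtain ⟨A, hA, rfl⟩ := Finset.mem_image.mp hx
      rw [h₁ A hA, trOn_apply hσ hA]
    · rw [h₂ x hx, trOn_of_notMem hx]

theorem mem_image_of_mem_dom_trOn {x : Var} (hx : x ∈ (trOn σ U t).dom) : x ∈ U.image σ := by
  by_contra h
  exact hx (trOn_of_notMem h)

theorem mem_dom_trOn (hσ : Set.InjOn σ U) {A : Attr} (hA : A ∈ U) :
    σ A ∈ (trOn σ U t).dom ↔ t A ≠ none := by
  rw [Mapping.mem_dom, trOn_apply hσ hA]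
  simp

theorem lit_injective : Function.Injective Term.lit := fun _ _ h => Term.lit.inj h

theorem trOn_inj (hσ : Set.InjOn σ U) (h₁ : t₁.Over U) (h₂ : t₂.Over U)
    (h : trOn σ U t₁ = trOn σ U t₂) : t₁ = t₂ := by
  funext A
  by_cases hA : A ∈ U
  · have := congrFun h (σ A)
    rw [trOn_apply hσ hA, trOn_apply hσ hA] at this
    exact Option.map_injective lit_injective this
  · rw [h₁ A hA, h₂ A hA]

theorem trOn_id (h : t.Over U) : trOn id U t = tr t := by
  symm
  rw [eq_trOn_iff (Set.injOn_id _)]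
  refine ⟨fun A _ => rfl, fun x hx => ?_⟩
  simp [tr, h x (by simpa using hx)]

/-- If a common attribute were null in `t₁`, the union would take its value from `t₂`; hence the
last hypothesis. -/
theorem trOn_union (hσ : Set.InjOn σ (U₁ ∪ U₂ : Finset Attr)) (h₁ : ∀ A ∈ U₁, t A = t₁ A)
    (h₂ : ∀ A ∈ U₂ \ U₁, t A = t₂ A) (hn : ∀ A ∈ U₁ ∩ U₂, t₁ A ≠ none) :
    trOn σ (U₁ ∪ U₂) t = (trOn σ U₁ t₁).union (trOn σ U₂ t₂) := by
  have hs₁ : (U₁ : Set Attr) ⊆ (U₁ ∪ U₂ : Finset Attr) := by simp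
  have hs₂ : (U₂ : Set Attr) ⊆ (U₁ ∪ U₂ : Finset Attr) := by simp
  symm
  rw [eq_trOn_iff hσ]
  constructor
  · intro A hA
    by_cases hA₁ : A ∈ U₁
    · rw [h₁ A hA₁]
      by_cases hA₂ : A ∈ U₂
      · rw [Mapping.union_of_mem_left, trOn_apply (hσ.mono hs₁) hA₁]
        exact (mem_dom_trOn (hσ.mono hs₁) hA₁).mpr (hn A (Finset.mem_inter.mpr ⟨hA₁, hA₂⟩))
      · rw [Mapping.union_of_notMem_right, trOn_apply (hσ.mono hs₁) hA₁]
        intro h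
        obtain ⟨B, hB, hBA⟩ := Finset.mem_image.mp (mem_image_of_mem_dom_trOn h)
        rw [hσ (hs₂ hB) hA hBA] at hB
        exact hA₂ hB
    · have hA₂ : A ∈ U₂ := (Finset.mem_union.mp hA).resolve_left hA₁
      rw [h₂ A (Finset.mem_sdiff.mpr ⟨hA₂, hA₁⟩), Mapping.union_of_notMem_left,
        trOn_apply (hσ.mono hs₂) hA₂]
      intro h
      obtain ⟨B, hB, hBA⟩ := Finset.mem_image.mp (mem_image_of_mem_dom_trOn h)
      rw [hσ (hs₁ hB) hA hBA] at hB
      exact hA₁ hB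
  · intro x hx
    rw [Finset.image_union, Finset.mem_union, not_or] at hx
    rw [Mapping.union_of_notMem_left fun h => hx.1 (mem_image_of_mem_dom_trOn h),
      trOn_of_notMem hx.2]

end TrOn

theorem RA.over_of_mem_eval {S : Schema} {I : Instance S} {Q : RA} (hQ : Q.WF S) {t : Tuple}
    (ht : t ∈ Q.eval I) : t.Over (Q.att S) := by
  induction Q with
  | rel R => exact I.isOver R t ht
  | null A => exact fun B _ => ht B
  | selEq A c Q ih => exact ih hQ.2 ht.1
  | selNe A c Q ih => exact ih hQ.2 ht.1
  | selNull A Q ih => exact ih hQ.2 ht.1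
  | selNotNull A Q ih => exact ih hQ.2 ht.1
  | proj U Q ih => exact ht.1
  | rename A B Q ih => exact ht.1
  | join Q₁ Q₂ ih₁ ih₂ => exact ht.1
  | union Q₁ Q₂ ih₁ ih₂ =>
    rcases ht with ht | ht
    · exact ih₁ hQ.2.1 ht
    · have := ih₂ hQ.2.2 ht
      rwa [← hQ.1] at this
  | diff Q₁ Q₂ ih₁ ih₂ => exact ih₁ hQ.2.1 ht.1

/-! ### The algebraic operations -/

section Operations

variable {S : Schema} {ι : Type} {G : ι → RDFGraph} {I : ι → Instance S}

/-- The query `Q` is translated to SPARQL, for every naming of the variables. -/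
def Translatable (G : ι → RDFGraph) (I : ι → Instance S) (Q : RA) : Prop :=
  ∀ σ : Attr → Var, Set.InjOn σ (Q.att S) →
    Realizable G ((Q.att S).image σ) fun i => trOn σ (Q.att S) '' Q.eval (I i)

theorem translatable_null (hG : ∀ i, (G i).Nonempty) (A : Attr) :
    Translatable G I (.null A) := by
  intro σ hσ
  refine ((Realizable.emptyMapping hG).mono (Finset.empty_subset _)).congr fun i => ?_
  ext μ
  constructor
  · intro hμ
    have hμ' : ∀ x, μ x = none := fun x => Mapping.notMem_dom.mp fun h => by
      rw [show μ.dom = ∅ from hμ] at h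
      exact h
    exact ⟨fun _ => none, fun _ => rfl,
      ((eq_trOn_iff hσ).mpr ⟨fun A _ => hμ' _, fun x _ => hμ' x⟩).symm⟩
  · rintro ⟨t, ht, rfl⟩
    refine Set.eq_empty_of_forall_notMem fun x hx => ?_
    obtain ⟨B, hB, rfl⟩ := Finset.mem_image.mp (mem_image_of_mem_dom_trOn hx)
    exact (mem_dom_trOn hσ hB).mp hx (ht B)

/-- A selection on the value of one attribute. -/
theorem Translatable.filter {Q Q' : RA} (hQ : Translatable G I Q) (hatt : Q'.att S = Q.att S)
    {A : Attr} (hA : A ∈ Q.att S) (r : Var → Cond) (hr : ∀ x, (r x).vars = {x})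
    (p : Option Value → Prop)
    (hp : ∀ (μ : Mapping) x v, μ x = v.map Term.lit → (μ.Sat (r x) ↔ p v))
    (heval : ∀ i t, t ∈ Q'.eval (I i) ↔ t ∈ Q.eval (I i) ∧ p (t A)) : Translatable G I Q' := by
  intro σ hσ
  rw [hatt] at hσ ⊢
  refine ((hQ σ hσ).filter (r := r (σ A)) ?_).congr fun i => ?_
  · rw [hr, Finset.singleton_subset_iff]
    exact Finset.mem_image_of_mem σ hA
  · ext μ
    constructor
    · rintro ⟨⟨t, ht, rfl⟩, hs⟩
      exact ⟨t, (heval i t).mpr ⟨ht, (hp _ _ _ (trOn_apply hσ hA)).mp hs⟩, rfl⟩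
    · rintro ⟨t, ht, rfl⟩
      have ht := (heval i t).mp ht
      exact ⟨⟨t, ht.1, rfl⟩, (hp _ _ _ (trOn_apply hσ hA)).mpr ht.2⟩

theorem Translatable.selEq {Q : RA} (hQ : Translatable G I Q) {A : Attr} (hA : A ∈ Q.att S)
    (c : Value) : Translatable G I (.selEq A c Q) :=
  hQ.filter rfl hA (fun x => .eqConst x (.lit c)) (fun _ => rfl) (· = some c)
    (fun μ x v h => by simp [Mapping.Sat, PatConst.term, h]) fun _ _ => Iff.rfl

theorem Translatable.selNe {Q : RA} (hQ : Translatable G I Q) {A : Attr} (hA : A ∈ Q.att S)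
    (c : Value) : Translatable G I (.selNe A c Q) :=
  -- The negated equality alone would also accept an unbound variable, that is, a null.
  hQ.filter rfl hA (fun x => .and (.bound x) (.not (.eqConst x (.lit c))))
    (fun _ => by simp [Cond.vars]) (fun v => v ≠ none ∧ v ≠ some c)
    (fun μ x v h => by simp [Mapping.Sat, Mapping.mem_dom, PatConst.term, h]) fun _ _ => Iff.rfl

theorem Translatable.selNull {Q : RA} (hQ : Translatable G I Q) {A : Attr} (hA : A ∈ Q.att S) :
    Translatable G I (.selNull A Q) :=
  hQ.filter rfl hA (fun x => .not (.bound x)) (fun _ => rfl) (· = none)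
    (fun μ x v h => by simp [Mapping.Sat, Mapping.mem_dom, h]) fun _ _ => Iff.rfl

theorem Translatable.selNotNull {Q : RA} (hQ : Translatable G I Q) {A : Attr} (hA : A ∈ Q.att S) :
    Translatable G I (.selNotNull A Q) :=
  hQ.filter rfl hA .bound (fun _ => rfl) (· ≠ none)
    (fun μ x v h => by simp [Mapping.Sat, Mapping.mem_dom, h]) fun _ _ => Iff.rfl

/-- The induction hypothesis is applied to a naming that sends the dropped attributes to fresh
variables, which the `SELECT` then hides. -/
theorem Translatable.proj {Q : RA} (hQ : Translatable G I Q) {U : Finset Attr}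
    (hU : U ⊆ Q.att S) : Translatable G I (.proj U Q) := by
  intro σ hσ
  change Realizable G (U.image σ) fun i => trOn σ U '' _
  change Set.InjOn σ U at hσ
  refine Realizable.hide fun X hX => ?_
  obtain ⟨n, hn⟩ := exists_fresh X
  -- The fixed prefix keeps `σ'` injective on the dropped attributes and their variables outside
  -- `X`.
  let σ' : Attr → Var := fun A => if A ∈ U then σ A else List.replicate n 0 ++ A
  have h₁ : ∀ A ∈ U, σ' A = σ A := fun A hA => if_pos hA
  have h₂ : ∀ A ∉ U, σ' A = List.replicate n 0 ++ A := fun A hA => if_neg hA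
  have hσX : ∀ A ∈ U, σ A ∈ X := fun A hA => hX (Finset.mem_image_of_mem σ hA)
  have hσ' : Set.InjOn σ' (Q.att S) := by
    intro A _ B _ h
    by_cases hA : A ∈ U <;> by_cases hB : B ∈ U
    · exact hσ hA hB (by rwa [h₁ A hA, h₁ B hB] at h)
    · rw [h₁ A hA, h₂ B hB] at h
      exact absurd (h ▸ hσX A hA) (hn B)
    · rw [h₂ A hA, h₁ B hB] at h
      exact absurd (h ▸ hσX B hB) (hn A)
    · rw [h₂ A hA, h₂ B hB] at h
      exact List.append_cancel_left h
  refine ⟨_, _, ?_, ?_, hQ σ' hσ', fun i => ?_⟩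
  · intro x hx
    obtain ⟨A, hA, rfl⟩ := Finset.mem_image.mp hx
    exact Finset.mem_image.mpr ⟨A, hU hA, h₁ A hA⟩
  · intro x hx hxX
    obtain ⟨A, hA, rfl⟩ := Finset.mem_image.mp hx
    by_cases hAU : A ∈ U
    · rw [h₁ A hAU]
      exact Finset.mem_image_of_mem σ hAU
    · rw [h₂ A hAU] at hxX
      exact absurd hxX (hn A)
  · have key : ∀ t t' : Tuple, (∀ A ∈ U, t A = t' A) →
        Mapping.select [] (U.image σ).toList (trOn σ' (Q.att S) t') = trOn σ U t := by
      intro t t' h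
      rw [Mapping.select_eq_iff]
      refine ⟨fun x hx => ?_, fun x hx => trOn_of_notMem hx⟩
      obtain ⟨A, hA, rfl⟩ := Finset.mem_image.mp hx
      rw [trOn_apply hσ hA, ← h₁ A hA, trOn_apply hσ' (hU hA), h A hA]
    ext μ
    constructor
    · rintro ⟨_, ⟨t', ht', rfl⟩, rfl⟩
      have h : ∀ A ∈ U, (fun A => if A ∈ U then t' A else none : Tuple) A = t' A :=
        fun A hA => if_pos hA
      exact ⟨_, ⟨fun A hA => if_neg hA, t', ht', h⟩, (key _ _ h).symm⟩
    · rintro ⟨t, ⟨-, t', ht', h⟩, rfl⟩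
      exact ⟨_, ⟨t', ht', rfl⟩, key _ _ h⟩

/-- No pattern is added: the query below is translated with the variable of `B` in the place of that
of `A`. This is a reason for `Translatable` to quantify over namings. -/
theorem Translatable.rename {Q : RA} (hQ : Translatable G I Q) {A B : Attr} (hA : A ∈ Q.att S)
    (hB : B ∉ Q.att S) : Translatable G I (.rename A B Q) := by
  intro σ hσ
  have hatt : ∀ D, D ∈ (RA.rename A B Q).att S ↔ D = B ∨ D ≠ A ∧ D ∈ Q.att S := by
    simp [RA.att]
  have hne : ∀ D ∈ Q.att S, D ≠ B := fun D hD h => hB (h ▸ hD)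
  have hmem : ∀ D ∈ Q.att S, D ≠ A → D ∈ (RA.rename A B Q).att S :=
    fun D hD h => (hatt D).mpr (Or.inr ⟨h, hD⟩)
  have hmemB : B ∈ (RA.rename A B Q).att S := (hatt B).mpr (Or.inl rfl)
  let σ' : Attr → Var := Function.update σ A (σ B)
  have h₁ : σ' A = σ B := Function.update_self ..
  have h₂ : ∀ D, D ≠ A → σ' D = σ D := fun D hD => Function.update_of_ne hD ..
  have hσ' : Set.InjOn σ' (Q.att S) := by
    intro D hD E hE h
    by_cases hDA : D = A <;> by_cases hEA : E = A
    · rw [hDA, hEA]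
    · rw [hDA, h₁, h₂ E hEA] at h
      exact absurd (hσ hmemB (hmem E hE hEA) h).symm (hne E hE)
    · rw [hEA, h₁, h₂ D hDA] at h
      exact absurd (hσ (hmem D hD hDA) hmemB h) (hne D hD)
    · rw [h₂ D hDA, h₂ E hEA] at h
      exact hσ (hmem D hD hDA) (hmem E hE hEA) h
  have himage : (Q.att S).image σ' = ((RA.rename A B Q).att S).image σ := by
    ext x
    simp only [Finset.mem_image]
    constructor
    · rintro ⟨D, hD, rfl⟩
      by_cases hDA : D = A
      · exact ⟨B, hmemB, by rw [hDA, h₁]⟩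
      · exact ⟨D, hmem D hD hDA, (h₂ D hDA).symm⟩
    · rintro ⟨D, hD, rfl⟩
      rcases (hatt D).mp hD with rfl | ⟨hDA, hD⟩
      · exact ⟨A, hA, h₁⟩
      · exact ⟨D, hD, h₂ D hDA⟩
  have key : ∀ t t' : Tuple, t B = t' A →
      (∀ D ∈ (RA.rename A B Q).att S, D ≠ B → t D = t' D) →
      trOn σ' (Q.att S) t' = trOn σ ((RA.rename A B Q).att S) t := by
    intro t t' hAB h
    rw [eq_trOn_iff hσ]
    refine ⟨fun D hD => ?_, fun x hx => trOn_of_notMem (himage ▸ hx)⟩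
    by_cases hDB : D = B
    · rw [hDB, hAB, ← h₁, trOn_apply hσ' hA]
    · obtain ⟨hDA, hDQ⟩ := ((hatt D).mp hD).resolve_left hDB
      rw [h D hD hDB, ← h₂ D hDA, trOn_apply hσ' hDQ]
  rw [← himage]
  refine (hQ σ' hσ').congr fun i => ?_
  ext μ
  constructor
  · rintro ⟨t', ht', rfl⟩
    let t : Tuple := fun D =>
      if D ∈ (RA.rename A B Q).att S then (if D = B then t' A else t' D) else none
    have hAB : t B = t' A := by simp [t, hmemB]
    have h : ∀ D ∈ (RA.rename A B Q).att S, D ≠ B → t D = t' D := by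
      intro D hD hDB
      simp [t, hD, hDB]
    exact ⟨t, ⟨fun D hD => if_neg hD, t', ht', hAB, h⟩, (key t t' hAB h).symm⟩
  · rintro ⟨t, ⟨-, t', ht', hAB, h⟩, rfl⟩
    exact ⟨t', ht', key t t' hAB h⟩

/-- The algebra joins on equal non-null values, whereas compatibility accepts an unbound variable
against anything. Both sides are therefore first filtered to bind all common attributes. -/
theorem Translatable.join {Q₁ Q₂ : RA} (hQ₁ : Translatable G I Q₁) (hQ₂ : Translatable G I Q₂) :
    Translatable G I (.join Q₁ Q₂) := by
  intro σ hσ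
  change Set.InjOn σ (Q₁.att S ∪ Q₂.att S : Finset Attr) at hσ
  change Realizable G ((Q₁.att S ∪ Q₂.att S).image σ) fun i => trOn σ (Q₁.att S ∪ Q₂.att S) '' _
  have hs₁ : (Q₁.att S : Set Attr) ⊆ (Q₁.att S ∪ Q₂.att S : Finset Attr) := by simp
  have hs₂ : (Q₂.att S : Set Attr) ⊆ (Q₁.att S ∪ Q₂.att S : Finset Attr) := by simp
  have hσ₁ := hσ.mono hs₁
  have hσ₂ := hσ.mono hs₂
  have h₁ := (hQ₁ σ hσ₁).filterDom (fun _ => True) (Y := (Q₁.att S ∩ Q₂.att S).image σ)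
    (Finset.image_subset_image Finset.inter_subset_left)
  have h₂ := (hQ₂ σ hσ₂).filterDom (fun _ => True) (Y := (Q₁.att S ∩ Q₂.att S).image σ)
    (Finset.image_subset_image Finset.inter_subset_right)
  rw [Finset.image_union]
  refine (h₁.and h₂).congr fun i => ?_
  ext μ
  constructor
  · rintro ⟨_, ⟨⟨t₁, ht₁, rfl⟩, hd₁⟩, _, ⟨⟨t₂, ht₂, rfl⟩, hd₂⟩, hc, rfl⟩
    have hn₁ : ∀ A ∈ Q₁.att S ∩ Q₂.att S, t₁ A ≠ none := fun A hA =>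
      (mem_dom_trOn hσ₁ (Finset.mem_inter.mp hA).1).mp
        ((hd₁ _ (Finset.mem_image_of_mem σ hA)).mpr trivial)
    have heq : ∀ A ∈ Q₁.att S ∩ Q₂.att S, t₁ A = t₂ A := by
      intro A hA
      have := hc (σ A) ((hd₁ _ (Finset.mem_image_of_mem σ hA)).mpr trivial)
        ((hd₂ _ (Finset.mem_image_of_mem σ hA)).mpr trivial)
      rw [trOn_apply hσ₁ (Finset.mem_inter.mp hA).1,
        trOn_apply hσ₂ (Finset.mem_inter.mp hA).2] at this
      exact Option.map_injective lit_injective this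
    let t : Tuple := fun A =>
      if A ∈ Q₁.att S then t₁ A else if A ∈ Q₂.att S then t₂ A else none
    have hA₁ : ∀ A ∈ Q₁.att S, t A = t₁ A := fun A hA => if_pos hA
    have hA₂ : ∀ A ∈ Q₂.att S \ Q₁.att S, t A = t₂ A := by
      intro A hA
      rw [Finset.mem_sdiff] at hA
      simp [t, hA]
    refine ⟨t, ⟨?_, t₁, ht₁, t₂, ht₂, ?_, ?_, hA₂⟩, trOn_union hσ hA₁ hA₂ hn₁⟩
    · intro A hA
      simp only [RA.att, Finset.mem_union, not_or] at hA
      simp [t, hA]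
    · intro A hA
      have hA' := hA₁ A (Finset.mem_inter.mp hA).1
      exact ⟨hA', heq A hA, hA'.trans_ne (hn₁ A hA)⟩
    · exact fun A hA => hA₁ A (Finset.mem_sdiff.mp hA).1
  · rintro ⟨t, ⟨-, t₁, ht₁, t₂, ht₂, h₁₂, ha₁, ha₂⟩, rfl⟩
    have hA₁ : ∀ A ∈ Q₁.att S, t A = t₁ A := by
      intro A hA
      by_cases hA₂ : A ∈ Q₂.att S
      · exact (h₁₂ A (Finset.mem_inter.mpr ⟨hA, hA₂⟩)).1
      · exact ha₁ A (Finset.mem_sdiff.mpr ⟨hA, hA₂⟩)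
    have hn₁ : ∀ A ∈ Q₁.att S ∩ Q₂.att S, t₁ A ≠ none := fun A hA =>
      (h₁₂ A hA).1 ▸ (h₁₂ A hA).2.2
    have hn₂ : ∀ A ∈ Q₁.att S ∩ Q₂.att S, t₂ A ≠ none := fun A hA =>
      (h₁₂ A hA).2.1 ▸ hn₁ A hA
    refine ⟨trOn σ _ t₁, ⟨⟨t₁, ht₁, rfl⟩, ?_⟩, trOn σ _ t₂, ⟨⟨t₂, ht₂, rfl⟩, ?_⟩, ?_,
      trOn_union hσ hA₁ ha₂ hn₁⟩
    · intro x hx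
      obtain ⟨A, hA, rfl⟩ := Finset.mem_image.mp hx
      exact iff_true_intro ((mem_dom_trOn hσ₁ (Finset.mem_inter.mp hA).1).mpr (hn₁ A hA))
    · intro x hx
      obtain ⟨A, hA, rfl⟩ := Finset.mem_image.mp hx
      exact iff_true_intro ((mem_dom_trOn hσ₂ (Finset.mem_inter.mp hA).2).mpr (hn₂ A hA))
    · intro x hx₁ hx₂
      obtain ⟨A, hA, rfl⟩ := Finset.mem_image.mp (mem_image_of_mem_dom_trOn hx₁)
      obtain ⟨B, hB, hBA⟩ := Finset.mem_image.mp (mem_image_of_mem_dom_trOn hx₂)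
      obtain rfl := hσ (hs₂ hB) (hs₁ hA) hBA
      rw [trOn_apply hσ₁ hA, trOn_apply hσ₂ hB, (h₁₂ B (Finset.mem_inter.mpr ⟨hA, hB⟩)).2.1]

theorem Translatable.union {Q₁ Q₂ : RA} (hQ₁ : Translatable G I Q₁) (hQ₂ : Translatable G I Q₂)
    (hatt : Q₁.att S = Q₂.att S) : Translatable G I (.union Q₁ Q₂) := by
  intro σ hσ
  change Set.InjOn σ (Q₁.att S) at hσ
  change Realizable G ((Q₁.att S).image σ) fun i => trOn σ (Q₁.att S) '' _
  have h₂ := hQ₂ σ (hatt ▸ hσ)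
  rw [← hatt] at h₂
  have := (hQ₁ σ hσ).union h₂
  rw [Finset.union_idempotent] at this
  exact this.congr fun i => (Set.image_union _ _ _).symm

/-- Taking images commutes with the difference because `trOn` is injective on tuples over the common
attribute set. -/
theorem Translatable.diff (hG : ∀ i, (G i).Nonempty) {Q₁ Q₂ : RA} (hQ₁ : Translatable G I Q₁)
    (hQ₂ : Translatable G I Q₂) (hatt : Q₁.att S = Q₂.att S) (hw₁ : Q₁.WF S) (hw₂ : Q₂.WF S) :
    Translatable G I (.diff Q₁ Q₂) := by
  intro σ hσ
  change Set.InjOn σ (Q₁.att S) at hσ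
  change Realizable G ((Q₁.att S).image σ) fun i => trOn σ (Q₁.att S) '' _
  have h₂ := hQ₂ σ (hatt ▸ hσ)
  rw [← hatt] at h₂
  refine (Realizable.diff hG (hQ₁ σ hσ) h₂ ?_ ?_).congr fun i => ?_
  · rintro i _ ⟨t, -, rfl⟩ x hx
    exact mem_image_of_mem_dom_trOn hx
  · rintro i _ ⟨t, -, rfl⟩ x hx
    exact mem_image_of_mem_dom_trOn hx
  · ext μ
    constructor
    · rintro ⟨⟨t, ht, rfl⟩, hn⟩
      exact ⟨t, ⟨ht, fun h => hn ⟨t, h, rfl⟩⟩, rfl⟩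
    · rintro ⟨t, ⟨ht, hn⟩, rfl⟩
      refine ⟨⟨t, ht, rfl⟩, ?_⟩
      rintro ⟨t', ht', h⟩
      have := trOn_inj hσ (hatt ▸ RA.over_of_mem_eval hw₂ ht') (RA.over_of_mem_eval hw₁ ht) h
      exact hn (this ▸ ht')

end Operations

/-! ### Base relations -/

section Base

variable {S : Schema} {C : Constraints S} {base : Str} {tid : RelName → Tuple → Str} {a : IRI}

/-- Any relation name is declared, either as a class or as an object property, independently of the
data. -/
theorem DMpk_nonempty (hS : S.rels.Nonempty) (I : Instance S) :
    (DMpk base tid a S C I).Nonempty := by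
  obtain ⟨R, hR⟩ := hS
  by_cases h : IsBinRel C R
  · obtain ⟨A, B, T, D, U, E, h⟩ := h
    exact ⟨_, mem_DMpk.mpr (.dm _ (.binDecl R A B T D U E _ ⟨h, rfl⟩))⟩
  · exact ⟨_, mem_DMpk.mpr (.dm _ (.classDecl R _ ⟨⟨hR, h⟩, rfl⟩))⟩

theorem dtpStr_ne_fkStr {R T U : RelName} {A : Attr} {Xs Ys : List Attr} :
    dtpStr base A R ≠ fkStr base Xs Ys T U := by
  intro h
  rw [dtpStr_eq, fkStr_eq] at h
  have h1 := append_sep_inj (by simp) (by simp) (List.append_cancel_left h)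
  have := comma_notMem_str R
  rw [h1.1] at this
  simp at this

/-- A variable in object position could match a node as well; the shape of the property IRI excludes
the rules for references. -/
theorem exists_lit_of_dtp_mem {I : Instance S} (hI : I.Sat C) {x : Node} {A : Attr} {R : RelName}
    {o : Term} (h : (⟨x, .str (dtpStr base A R), o⟩ : Triple) ∈ DMpk base tid a S C I) :
    ∃ w, o = .lit w := by
  rw [sat_mem_DMpk hI] at h
  revert h
  generalize hx : (⟨x, .str (dtpStr base A R), o⟩ : Triple) = z
  intro h
  cases h with
  | literal A' R' t w' y p hv hy hp =>
    simp only [Triple.mk.injEq] at hx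
    exact ⟨w', hx.2.2⟩
  | binRef R' A' B' T D' U E' v₁ v₂ t₁ t₂ t₃ x y p _ _ _ _ _ hp _ =>
    obtain ⟨-, rfl⟩ := hp
    simp only [Triple.mk.injEq, IRI.str.injEq] at hx
    exact absurd hx.2.1.symm binStr_ne_dtpStr
  | fkRef Xs Ys T U t₁ t₂ x y p _ _ _ hp =>
    obtain ⟨-, rfl⟩ := hp
    simp only [Triple.mk.injEq, IRI.str.injEq] at hx
    exact absurd hx.2.1 dtpStr_ne_fkStr
  | _ => simp at hx

theorem exists_node_of_binStr_mem {I : Instance S} (hI : I.Sat C) {x : Node} {R : RelName}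
    {A B D E : Attr} {o : Term}
    (h : (⟨x, .str (binStr base R A B D E), o⟩ : Triple) ∈ DMpk base tid a S C I) :
    ∃ y, o = .node y := by
  rw [sat_mem_DMpk hI] at h
  revert h
  generalize hx : (⟨x, .str (binStr base R A B D E), o⟩ : Triple) = z
  intro h
  cases h with
  | literal A' R' t w' y p hv hy hp =>
    obtain ⟨-, rfl⟩ := hp
    simp only [Triple.mk.injEq, IRI.str.injEq] at hx
    exact absurd hx.2.1 binStr_ne_dtpStr
  | binRef R' A' B' T D' U E' v₁ v₂ t₁ t₂ t₃ x y p _ _ _ _ _ hp _ =>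
    simp only [Triple.mk.injEq] at hx
    exact ⟨y, hx.2.2⟩
  | fkRef Xs Ys T U t₁ t₂ x y p _ _ _ hp =>
    simp only [Triple.mk.injEq] at hx
    exact ⟨y, hx.2.2⟩
  | _ => simp at hx

theorem mem_eval_triple_const {G : RDFGraph} {v : Var} {p i : IRI} {μ : Mapping} :
    μ ∈ (Pattern.triple (.var v) (.iri p) (.iri i)).eval G ↔
      ∃ x, ⟨x, p, .node (.iri i)⟩ ∈ G ∧ μ v = some (.node x) ∧ ∀ y, y ≠ v → μ y = none := by
  simp only [Pattern.eval, Pattern.vars, PatTerm.vars, PatPred.vars, PatTerm.inst, PatPred.inst,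
    Set.mem_ofPred_eq, Finset.union_empty, Finset.coe_singleton]
  constructor
  · rintro ⟨hd, ⟨x, q, o⟩, ht, hv, hp, ho⟩
    obtain rfl : p = q := by simpa using hp
    obtain rfl : Term.node (.iri i) = o := by simpa using ho
    exact ⟨x, ht, hv, fun y hy => Mapping.notMem_dom.mp fun h => hy (by rwa [hd] at h)⟩
  · rintro ⟨x, ht, hv, hn⟩
    refine ⟨?_, _, ht, hv, rfl, rfl⟩
    ext y
    by_cases hy : y = v
    · simp [hy, Mapping.mem_dom, hv]
    · simp [hy, Mapping.mem_dom, hn y hy]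

theorem mem_eval_triple_var {G : RDFGraph} {v z : Var} {p : IRI} {μ : Mapping} :
    μ ∈ (Pattern.triple (.var v) (.iri p) (.var z)).eval G ↔
      ∃ x o, ⟨x, p, o⟩ ∈ G ∧ μ v = some (.node x) ∧ μ z = some o ∧
        ∀ y, y ≠ v → y ≠ z → μ y = none := by
  simp only [Pattern.eval, Pattern.vars, PatTerm.vars, PatPred.vars, PatTerm.inst, PatPred.inst,
    Set.mem_ofPred_eq, Finset.union_empty, Finset.coe_singleton, Finset.coe_union]
  constructor
  · rintro ⟨hd, ⟨x, q, o⟩, ht, hv, hp, ho⟩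
    obtain rfl : p = q := by simpa using hp
    refine ⟨x, o, ht, hv, ho, fun y hy hy' => Mapping.notMem_dom.mp fun h => ?_⟩
    rw [hd] at h
    exact h.elim hy hy'
  · rintro ⟨x, o, ht, hv, hz, hn⟩
    refine ⟨?_, _, ht, hv, rfl, hz⟩
    ext y
    by_cases hy : y = v
    · simp [hy, Mapping.mem_dom, hv]
    · by_cases hy' : y = z
      · simp [hy', Mapping.mem_dom, hz]
      · simp [hy, hy', Mapping.mem_dom, hn y hy hy']

/-! ### Patterns for classes and for binary relations. -/

variable {ι : Type} {I : ι → Instance S}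

/-- The mappings of the variable `v` to the nodes of the tuples of the class `R` and of the variables
`σ A` to the values in the attributes `A ∈ U`. -/
def rowMappings (C : Constraints S) (J : Instance S) (base : Str) (tid : RelName → Tuple → Str)
    (R : RelName) (σ : Attr → Var) (v : Var) (U : Finset Attr) : Set Mapping :=
  {μ | ∃ t x, RowId C J base tid t R x ∧ μ v = some (.node x) ∧
    (∀ A ∈ U, μ (σ A) = (t A).map Term.lit) ∧ ∀ y, y ≠ v → y ∉ U.image σ → μ y = none}

/-- One `OPT` adds one attribute. Since the node determines the tuple, the literal triples at it
give its value and no other; if the value is null, nothing is compatible and the mapping is kept as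
it is. -/
theorem rowMappings_insert (htid : IsTupleId tid) {J : Instance S} (hJ : J.Sat C) {R : RelName}
    {σ : Attr → Var} {v : Var} {U : Finset Attr} {A : Attr} (hA : A ∈ S.att R) (hAU : A ∉ U)
    (hσ : Set.InjOn σ (insert A U : Finset Attr)) (hv : v ∉ (insert A U).image σ) :
    joinMappings (rowMappings C J base tid R σ v U)
      ((Pattern.triple (.var v) (.iri (.str (dtpStr base A R))) (.var (σ A))).eval
        (DMpk base tid a S C J)) ∪
      {μ | μ ∈ rowMappings C J base tid R σ v U ∧
        ∀ μ' ∈ (Pattern.triple (.var v) (.iri (.str (dtpStr base A R))) (.var (σ A))).eval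
          (DMpk base tid a S C J), ¬ μ.Compatible μ'} =
      rowMappings C J base tid R σ v (insert A U) := by
  have hvA : σ A ≠ v := fun h => hv (h ▸ Finset.mem_image_of_mem σ (Finset.mem_insert_self A U))
  have hvU : ∀ B ∈ U, σ B ≠ v := fun B hB h =>
    hv (h ▸ Finset.mem_image_of_mem σ (Finset.mem_insert_of_mem hB))
  have hAim : σ A ∉ U.image σ := by
    intro h
    obtain ⟨B, hB, h⟩ := Finset.mem_image.mp h
    rw [hσ (by simp [hB]) (by simp) h] at hB
    exact hAU hB
  have hBA : ∀ B ∈ U, σ B ≠ σ A := fun B hB h => hAim (h ▸ Finset.mem_image_of_mem σ hB)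
  have him : ∀ y, y ∈ (insert A U).image σ ↔ y = σ A ∨ y ∈ U.image σ := by simp
  have htr : ∀ μ : Mapping, μ ∈ (Pattern.triple (.var v) (.iri (.str (dtpStr base A R)))
      (.var (σ A))).eval (DMpk base tid a S C J) ↔ ∃ t x w, RowId C J base tid t R x ∧
        t A = some w ∧ μ v = some (.node x) ∧ μ (σ A) = some (.lit w) ∧
        ∀ y, y ≠ v → y ≠ σ A → μ y = none := by
    intro μ
    rw [mem_eval_triple_var]
    constructor
    · rintro ⟨x, o, h, h₁, h₂, h₃⟩
      obtain ⟨w, rfl⟩ := exists_lit_of_dtp_mem hJ h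
      obtain ⟨-, t, ht, hw⟩ := (literal_mem_iff hJ).mp h
      exact ⟨t, x, w, ht, hw, h₁, h₂, h₃⟩
    · rintro ⟨t, x, w, ht, hw, h₁, h₂, h₃⟩
      exact ⟨x, _, (literal_mem_iff hJ).mpr ⟨hA, t, ht, hw⟩, h₁, h₂, h₃⟩
  ext μ
  constructor
  · rintro (⟨μ₁, ⟨t, x, ht, hx, hval, hnone⟩, μ₂, hμ₂, hc, rfl⟩ |
      ⟨⟨t, x, ht, hx, hval, hnone⟩, hc⟩)
    · obtain ⟨t', x', w, ht', hw, hx', hval', hnone'⟩ := (htr μ₂).mp hμ₂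
      have hv₁ : v ∈ μ₁.dom := by simp [Mapping.mem_dom, hx]
      have hxx := hc v hv₁ (by simp [Mapping.mem_dom, hx'])
      rw [hx, hx'] at hxx
      obtain rfl : x = x' := by simpa using hxx
      obtain rfl := rowId_unique htid hJ ht ht'
      refine ⟨t, x, ht, (Mapping.union_of_mem_left hv₁).trans hx, ?_, ?_⟩
      · intro B hB
        rcases Finset.mem_insert.mp hB with rfl | hB
        · rw [hw, Mapping.union_of_notMem_left, hval']
          · rfl
          · exact fun h => h (hnone _ hvA hAim)
        · rw [Mapping.union_of_notMem_right, hval B hB]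
          exact fun h => h (hnone' _ (hvU B hB) (hBA B hB))
      · intro y hy hyU
        rw [him, not_or] at hyU
        rw [Mapping.union_of_notMem_left, hnone' y hy hyU.1]
        exact fun h => h (hnone y hy hyU.2)
    · have hAn : t A = none := by
        by_contra hn
        obtain ⟨w, hw⟩ := Option.ne_none_iff_exists'.mp hn
        -- A value `w` would yield a literal triple at `x`; its mapping is compatible with `μ`,
        -- which leaves `σ A` unbound.
        refine hc (fun y => if y = v then some (.node x) else if y = σ A then some (.lit w)
          else none) ((htr _).mpr ⟨t, x, w, ht, hw, by simp, by simp [hvA], ?_⟩) ?_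
        · intro y hy hy'
          simp [hy, hy']
        · intro y hy hy'
          by_cases hyv : y = v
          · simp [hyv, hx]
          · by_cases hyA : y = σ A
            · rw [hyA] at hy
              exact absurd (hnone _ hvA hAim) hy
            · simp [Mapping.mem_dom, hyv, hyA] at hy'
      refine ⟨t, x, ht, hx, ?_, ?_⟩
      · intro B hB
        rcases Finset.mem_insert.mp hB with rfl | hB
        · rw [hAn, hnone _ hvA hAim]
          rfl
        · exact hval B hB
      · intro y hy hyU
        rw [him, not_or] at hyU
        exact hnone y hy hyU.2
  · rintro ⟨t, x, ht, hx, hval, hnone⟩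
    have hvalU : ∀ B ∈ U, μ (σ B) = (t B).map Term.lit :=
      fun B hB => hval B (Finset.mem_insert_of_mem hB)
    have hvalA := hval A (Finset.mem_insert_self A U)
    cases hw : t A with
    | none =>
      refine Or.inr ⟨⟨t, x, ht, hx, hvalU, ?_⟩, ?_⟩
      · intro y hy hyU
        by_cases hyA : y = σ A
        · rw [hyA, hvalA, hw]
          rfl
        · exact hnone y hy (by simp [hyA, hyU])
      · intro μ' hμ' hc
        obtain ⟨t', x', w, ht', hw', hx', -, -⟩ := (htr μ').mp hμ'
        have hxx := hc v (by simp [Mapping.mem_dom, hx]) (by simp [Mapping.mem_dom, hx'])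
        rw [hx, hx'] at hxx
        obtain rfl : x = x' := by simpa using hxx
        obtain rfl := rowId_unique htid hJ ht ht'
        simp [hw] at hw'
    | some w =>
      -- Split `μ` into its part without `σ A` and its part on `v` and `σ A`; the two overlap only
      -- in `v`.
      refine Or.inl ⟨fun y => if y = σ A then none else μ y, ⟨t, x, ht, ?_, ?_, ?_⟩,
        fun y => if y = v ∨ y = σ A then μ y else none,
        (htr _).mpr ⟨t, x, w, ht, hw, ?_, ?_, ?_⟩, ?_, ?_⟩
      · simp [hvA.symm, hx]
      · intro B hB
        simp [hBA B hB, hvalU B hB]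
      · intro y hy hyU
        by_cases hyA : y = σ A
        · simp [hyA]
        · simp [hyA, hnone y hy (by simp [hyA, hyU])]
      · simp [hx]
      · simp [hvalA, hw]
      · intro y hy hyA
        simp [hy, hyA]
      · intro y hy hy'
        by_cases hyA : y = σ A
        · simp [Mapping.mem_dom, hyA] at hy
        · by_cases hyv : y = v
          · simp [hyv, hvA.symm]
          · simp [Mapping.mem_dom, hyA, hyv] at hy'
      · funext y
        by_cases hyA : y = σ A
        · simp [Mapping.union, hyA]
        · by_cases hyv : y = v
          · simp [Mapping.union, hyv, hvA.symm]
          · simp [Mapping.union, hyA, hyv]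

/-- The chain of `OPT`s starts from the type triple, which exists even for a tuple whose values are
all null. -/
theorem realizable_rowMappings (htid : IsTupleId tid) (hI : ∀ i, (I i).Sat C) {R : RelName}
    {σ : Attr → Var} {v : Var} {U : Finset Attr} (hU : U ⊆ S.att R) (hσ : Set.InjOn σ U)
    (hv : v ∉ U.image σ) : Realizable (fun i => DMpk base tid a S C (I i)) (insert v (U.image σ))
      fun i => rowMappings C (I i) base tid R σ v U := by
  induction U using Finset.induction with
  | empty =>
    refine ((Realizable.triple (.var v) (.iri (.voc .rdfType))
      (.iri (.str (classStr base R)))).mono ?_).congr fun i => ?_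
    · simp [Pattern.vars, PatTerm.vars, PatPred.vars]
    · ext μ
      simp only [mem_eval_triple_const, type_mem_iff (hI i), rowMappings, Set.mem_ofPred_eq,
        Finset.notMem_empty, IsEmpty.forall_iff, implies_true, true_and, Finset.image_empty,
        not_false_eq_true, forall_const]
      constructor
      · rintro ⟨x, ⟨t, ht⟩, h⟩
        exact ⟨t, x, ht, h⟩
      · rintro ⟨t, x, ht, h⟩
        exact ⟨x, ⟨t, ht⟩, h⟩
  | insert A U hAU ih =>
    have hs : (U : Set Attr) ⊆ (insert A U : Finset Attr) := by simp
    have ih := ih ((Finset.subset_insert A U).trans hU) (hσ.mono hs)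
      fun h => hv (Finset.image_subset_image (Finset.subset_insert A U) h)
    refine ((ih.opt (Realizable.triple (.var v) (.iri (.str (dtpStr base A R)))
      (.var (σ A)))).mono ?_).congr fun i =>
        rowMappings_insert htid (hI i) (hU (Finset.mem_insert_self A U)) hAU hσ hv
    intro x
    simp only [Pattern.vars, PatTerm.vars, PatPred.vars, Finset.mem_union, Finset.mem_insert,
      Finset.mem_image, Finset.mem_singleton, Finset.notMem_empty, or_false]
    rintro ((rfl | ⟨B, hB, rfl⟩) | rfl | rfl)
    · exact Or.inl rfl
    · exact Or.inr ⟨B, Or.inr hB, rfl⟩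
    · exact Or.inl rfl
    · exact Or.inr ⟨A, Or.inl rfl, rfl⟩

theorem translatable_class (htid : IsTupleId tid) (hI : ∀ i, (I i).Sat C) {R : RelName}
    (hR : IsClass C R) : Translatable (fun i => DMpk base tid a S C (I i)) I (.rel R) := by
  intro σ hσ
  change Set.InjOn σ (S.att R) at hσ
  change Realizable _ ((S.att R).image σ) fun i => trOn σ (S.att R) '' (I i).rel R
  refine Realizable.hide fun X hX => ?_
  obtain ⟨n, hn⟩ := exists_fresh X
  obtain ⟨v, hvX⟩ : ∃ v, v ∉ X := ⟨_, hn []⟩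
  have hv : v ∉ (S.att R).image σ := fun h => hvX (hX h)
  refine ⟨_, _, Finset.subset_insert _ _, ?_,
    realizable_rowMappings htid hI subset_rfl hσ hv, fun i => ?_⟩
  · intro x hx hxX
    rcases Finset.mem_insert.mp hx with rfl | hx
    · exact absurd hxX hvX
    · exact hx
  · ext μ
    constructor
    · rintro ⟨μ, ⟨t, x, ht, hx, hval, hnone⟩, rfl⟩
      refine ⟨t, (rowId_mem ht).2, ((Mapping.select_eq_iff).mpr ⟨fun y hy => ?_,
        fun y hy => trOn_of_notMem hy⟩).symm⟩
      obtain ⟨A, hA, rfl⟩ := Finset.mem_image.mp hy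
      rw [hval A hA, trOn_apply hσ hA]
    · rintro ⟨t, ht, rfl⟩
      obtain ⟨x, hx⟩ := exists_rowId (base := base) (tid := tid) (hI i) hR ht
      refine ⟨Function.update (trOn σ (S.att R) t) v (some (.node x)),
        ⟨t, x, hx, Function.update_self .., fun A hA => ?_, fun y hy hyU => ?_⟩,
        (Mapping.select_eq_iff).mpr ⟨fun y hy => ?_, fun y hy => trOn_of_notMem hy⟩⟩
      · have hAv : σ A ≠ v := fun h => hv (h ▸ Finset.mem_image_of_mem σ hA)
        rw [Function.update_of_ne hAv, trOn_apply hσ hA]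
      · rw [Function.update_of_ne hy, trOn_of_notMem hyU]
      · have hyv : y ≠ v := fun h => hv (h ▸ hy)
        exact Function.update_of_ne hyv ..

/-- A reference triple from `v` to `z`, joined with the `D`-value of `v` and the `E`-value of `z`.
No `OPT` is needed, since both attributes belong to the key. -/
theorem translatable_binRel (htid : IsTupleId tid) (hI : ∀ i, (I i).Sat C) {R A B T D U E}
    (h : BinRel C R A B T D U E) :
    Translatable (fun i => DMpk base tid a S C (I i)) I (.rel R) := by
  intro σ hσ
  change Set.InjOn σ (S.att R) at hσ
  change Realizable _ ((S.att R).image σ) fun i => trOn σ (S.att R) '' (I i).rel R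
  have hA : A ∈ S.att R := by simp [h.att_eq]
  have hB : B ∈ S.att R := by simp [h.att_eq]
  have hAB : σ A ≠ σ B := fun h' => h.ne (hσ hA hB h')
  have him : ∀ y, y ∈ (S.att R).image σ ↔ y = σ A ∨ y = σ B := by simp [h.att_eq]
  refine Realizable.hide fun X hX => ?_
  obtain ⟨n, hn⟩ := exists_fresh X
  obtain ⟨v, z, hvX, hzX, hvz⟩ : ∃ v z : Var, v ∉ X ∧ z ∉ X ∧ v ≠ z :=
    ⟨_, _, hn [0], hn [1], by simp⟩
  have hvA : σ A ≠ v := fun h => hvX (h ▸ hX (Finset.mem_image_of_mem σ hA))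
  have hvB : σ B ≠ v := fun h => hvX (h ▸ hX (Finset.mem_image_of_mem σ hB))
  have hzA : σ A ≠ z := fun h => hzX (h ▸ hX (Finset.mem_image_of_mem σ hA))
  have hzB : σ B ≠ z := fun h => hzX (h ▸ hX (Finset.mem_image_of_mem σ hB))
  have hr := ((Realizable.triple (G := fun i => DMpk base tid a S C (I i)) (.var v)
    (.iri (.str (binStr base R A B D E))) (.var z)).and
    (Realizable.triple (.var v) (.iri (.str (dtpStr base D T))) (.var (σ A)))).and
    (Realizable.triple (.var z) (.iri (.str (dtpStr base E U))) (.var (σ B)))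
  refine ⟨{v, z, σ A, σ B}, _, ?_, ?_, hr.mono ?_, fun i => ?_⟩
  · intro x hx
    rcases (him x).mp hx with rfl | rfl <;> simp
  · intro x hx hxX
    simp only [Finset.mem_insert, Finset.mem_singleton] at hx
    rcases hx with rfl | rfl | hx
    · exact absurd hxX hvX
    · exact absurd hxX hzX
    · exact (him x).mpr hx
  · intro x
    simp only [Pattern.vars, PatTerm.vars, PatPred.vars, Finset.mem_union, Finset.mem_insert,
      Finset.mem_singleton, Finset.notMem_empty, or_false]
    tauto
  · have hJ := hI i
    ext μ
    constructor
    · rintro ⟨_, ⟨_, ⟨μ₁, hμ₁, μ₂, hμ₂, hc, rfl⟩, μ₃, hμ₃, hc', rfl⟩, rfl⟩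
      obtain ⟨x, o, hm₁, hv₁, hz₁, hn₁⟩ := mem_eval_triple_var.mp hμ₁
      obtain ⟨x', o₂, hm₂, hv₂, hA₂, hn₂⟩ := mem_eval_triple_var.mp hμ₂
      obtain ⟨y', o₃, hm₃, hz₃, hB₃, hn₃⟩ := mem_eval_triple_var.mp hμ₃
      obtain ⟨y, rfl⟩ := exists_node_of_binStr_mem hJ hm₁
      obtain ⟨c, rfl⟩ := exists_lit_of_dtp_mem hJ hm₂
      obtain ⟨d, rfl⟩ := exists_lit_of_dtp_mem hJ hm₃
      obtain rfl : x = x' := by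
        have := hc v (by simp [Mapping.mem_dom, hv₁]) (by simp [Mapping.mem_dom, hv₂])
        simpa [hv₁, hv₂] using this
      have hz₁₂ : μ₁.union μ₂ z = some (.node y) := by
        rw [Mapping.union_of_mem_left (by simp [Mapping.mem_dom, hz₁]), hz₁]
      have hA₁₂ : μ₁.union μ₂ (σ A) = some (.lit c) := by
        rw [Mapping.union_of_notMem_left, hA₂]
        exact fun h => h (hn₁ _ hvA hzA)
      have hB₁₂ : μ₁.union μ₂ (σ B) = none := by
        rw [Mapping.union_of_notMem_left, hn₂ _ hvB hAB.symm]
        exact fun h => h (hn₁ _ hvB hzB)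
      obtain rfl : y = y' := by
        have := hc' z (by simp [Mapping.mem_dom, hz₁₂]) (by simp [Mapping.mem_dom, hz₃])
        simpa [hz₁₂, hz₃] using this
      obtain ⟨T', U', h', t, ht, t₁, t₂, htA, htB, hx, hy⟩ := (binRef_mem_iff hJ).mp hm₁
      -- The IRI of the reference triple names neither `T` nor `U`; uniqueness shows that it links
      -- tuples of just these relations.
      obtain ⟨-, -, rfl, -, rfl, -⟩ := h.unique h'
      obtain ⟨-, t₁', hx', hc₁⟩ := (literal_mem_iff hJ).mp hm₂
      obtain ⟨-, t₂', hy', hd₂⟩ := (literal_mem_iff hJ).mp hm₃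
      obtain rfl := rowId_unique htid hJ hx hx'
      obtain rfl := rowId_unique htid hJ hy hy'
      refine ⟨t, ht, (Mapping.select_eq_iff.mpr ⟨fun w hw => ?_,
        fun w hw => trOn_of_notMem hw⟩).symm⟩
      rcases (him w).mp hw with rfl | rfl
      · rw [trOn_apply hσ hA, htA, hc₁, Mapping.union_of_mem_left, hA₁₂]
        · rfl
        · simp [Mapping.mem_dom, hA₁₂]
      · rw [trOn_apply hσ hB, htB, hd₂, Mapping.union_of_notMem_left, hB₃]
        · rfl
        · exact fun h => h hB₁₂
    · rintro ⟨t, ht, rfl⟩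
      obtain ⟨c, d, t₁, t₂, x, y, hc, hd, hc₁, hd₂, hx, hy⟩ :=
        h.exists_refs (base := base) (tid := tid) hJ ht
      -- The three patterns are matched by restrictions of the single mapping `ν`. Restrictions of
      -- one mapping are compatible, and their unions are again restrictions of it.
      let ν : Mapping := fun w => if w = v then some (.node x) else if w = z then some (.node y)
        else trOn σ (S.att R) t w
      have hνv : ν v = some (.node x) := if_pos rfl
      have hνz : ν z = some (.node y) := by simp [ν, hvz.symm]
      have hνA : ν (σ A) = some (.lit c) := by simp [ν, hvA, hzA, trOn_apply hσ hA, hc]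
      have hνB : ν (σ B) = some (.lit d) := by simp [ν, hvB, hzB, trOn_apply hσ hB, hd]
      have hνn : ∀ w, w ≠ v → w ≠ z → w ≠ σ A → w ≠ σ B → ν w = none := by
        intro w h₁ h₂ h₃ h₄
        simp only [ν, h₁, h₂, if_false]
        exact trOn_of_notMem (by simp [him, h₃, h₄])
      let res : Var → Var → Mapping := fun p q w => if w = p ∨ w = q then ν w else none
      have hres : ∀ p q, (res p q).Agrees ν := by
        intro p q w hw
        simp only [Mapping.mem_dom, res] at hw ⊢
        split_ifs at hw ⊢
        · rfl
        · exact absurd rfl hw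
      have hdom : ∀ p q w, w = p ∨ w = q → res p q w = ν w := fun p q w hw => if_pos hw
      have hnone : ∀ p q w, w ≠ p → w ≠ q → res p q w = none :=
        fun p q w hp hq => if_neg (not_or.mpr ⟨hp, hq⟩)
      have h₁₂ := (hres v z).union (hres v (σ A))
      refine ⟨((res v z).union (res v (σ A))).union (res z (σ B)), ⟨_, ⟨res v z,
        mem_eval_triple_var.mpr ⟨x, .node y, (binRef_mem_iff hJ).mpr ⟨T, U, h, t, ht, t₁, t₂,
          hc.trans hc₁.symm, hd.trans hd₂.symm, hx, hy⟩, ?_, ?_, hnone v z⟩, res v (σ A),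
        mem_eval_triple_var.mpr ⟨x, .lit c, (literal_mem_iff hJ).mpr ⟨h.mem_left, t₁, hx, hc₁⟩,
          ?_, ?_, hnone v (σ A)⟩, (hres v z).compatible (hres v (σ A)), rfl⟩, res z (σ B),
        mem_eval_triple_var.mpr ⟨y, .lit d, (literal_mem_iff hJ).mpr ⟨h.mem_right, t₂, hy, hd₂⟩,
          ?_, ?_, hnone z (σ B)⟩, h₁₂.compatible (hres z (σ B)), rfl⟩,
        Mapping.select_eq_iff.mpr ⟨fun w hw => ?_, fun w hw => trOn_of_notMem hw⟩⟩
      · rw [hdom v z v (Or.inl rfl), hνv]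
      · rw [hdom v z z (Or.inr rfl), hνz]
      · rw [hdom v (σ A) v (Or.inl rfl), hνv]
      · rw [hdom v (σ A) (σ A) (Or.inr rfl), hνA]
      · rw [hdom z (σ B) z (Or.inl rfl), hνz]
      · rw [hdom z (σ B) (σ B) (Or.inr rfl), hνB]
      · rcases (him w).mp hw with rfl | rfl
        · have hA' : σ A ∈ ((res v z).union (res v (σ A))).dom := by
            rw [Mapping.mem_dom, ((hres v z).compatible (hres v (σ A))).union_of_mem_right] <;>
              simp [Mapping.mem_dom, hdom v (σ A) (σ A) (Or.inr rfl), hνA]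
          rw [Mapping.union_of_mem_left hA', h₁₂ _ hA', hνA, trOn_apply hσ hA, hc]
          rfl
        · have hB' : σ B ∈ (res z (σ B)).dom := by
            simp [Mapping.mem_dom, hdom z (σ B) (σ B) (Or.inr rfl), hνB]
          rw [(h₁₂.compatible (hres z (σ B))).union_of_mem_right hB',
            hdom z (σ B) (σ B) (Or.inr rfl), hνB, trOn_apply hσ hB, hd]
          rfl

theorem translatable (htid : IsTupleId tid) (hS : S.rels.Nonempty) (hI : ∀ i, (I i).Sat C) {Q : RA}
    (hQ : Q.WF S) : Translatable (fun i => DMpk base tid a S C (I i)) I Q := by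
  have hG : ∀ i, (DMpk base tid a S C (I i)).Nonempty := fun i => DMpk_nonempty hS _
  induction Q with
  | rel R =>
    by_cases h : IsBinRel C R
    · obtain ⟨A, B, T, D, U, E, h⟩ := h
      exact translatable_binRel htid hI h
    · exact translatable_class htid hI ⟨hQ, h⟩
  | null A => exact translatable_null hG A
  | selEq A c Q ih => exact (ih hQ.2).selEq hQ.1 c
  | selNe A c Q ih => exact (ih hQ.2).selNe hQ.1 c
  | selNull A Q ih => exact (ih hQ.2).selNull hQ.1
  | selNotNull A Q ih => exact (ih hQ.2).selNotNull hQ.1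
  | proj U Q ih => exact (ih hQ.2).proj hQ.1
  | rename A B Q ih => exact (ih hQ.2.2).rename hQ.1 hQ.2.1
  | join Q₁ Q₂ ih₁ ih₂ => exact (ih₁ hQ.1).join (ih₂ hQ.2)
  | union Q₁ Q₂ ih₁ ih₂ => exact (ih₁ hQ.2.1).union (ih₂ hQ.2.2) hQ.1
  | diff Q₁ Q₂ ih₁ ih₂ => exact (ih₁ hQ.2.1).diff hG (ih₂ hQ.2.2) hQ.1 hQ.2.1 hQ.2.2

end Base

theorem queryPreserving_DMpk (base : Str) {tid : RelName → Tuple → Str} (htid : IsTupleId tid)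
    (a : IRI) : QueryPreserving (DMpk base tid a) := by
  intro S C hS Q hQ
  -- Indexing by all satisfying instances gives one pattern for all of them; the naming `id` makes
  -- `?A` the variable of `A`.
  obtain ⟨P, hP, he⟩ := (translatable (C := C) (base := base) (a := a) (ι := {I // I.Sat C})
    (I := Subtype.val) htid hS (fun i => i.2) hQ id (Set.injOn_id _)).exists_isQuery
  refine ⟨P, hP, fun I hI => ?_⟩
  rw [he ⟨I, hI⟩]
  exact Set.image_congr fun t ht => (trOn_id (RA.over_of_mem_eval hQ ht)).symm

end RDBToRDF

theorem proposition2 (base : RDBToRDF.Str) (tid : RDBToRDF.RelName → RDBToRDF.Tuple → RDBToRDF.Str)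
    (htid : RDBToRDF.IsTupleId tid) (a : RDBToRDF.IRI) :
    RDBToRDF.InformationPreserving (RDBToRDF.DMpk base tid a) ∧
    RDBToRDF.QueryPreserving (RDBToRDF.DMpk base tid a) ∧
    RDBToRDF.MonotoneMapping (RDBToRDF.DMpk base tid a) ∧
    RDBToRDF.SemanticsPreservingForKeys (RDBToRDF.DMpk base tid a) :=
  ⟨RDBToRDF.informationPreserving_DMpk base htid a, RDBToRDF.queryPreserving_DMpk base htid a,
    RDBToRDF.monotoneMapping_DMpk base tid a, RDBToRDF.semanticsPreservingForKeys_DMpk base tid a⟩
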